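/- Let $k$ be a field. For a quiver $Q$ (vertex set $Q_0$, arrow set $Q_1$, both possibly infinite), let $kQ=\bigoplus_{n\ge 0}kQ_n$ be its path coalgebra, with basis the paths, graded by length, $\Delta(g)=g\otimes g$, $\varepsilon(g)=1$ for a vertex $g$, and for a path $p=a_n\cdots a_1$ of length $n\ge 1$, $\varepsilon(p)=0$ and $\Delta(p)=p\otimes s(a_1)+\sum_{i=1}^{n-1}a_n\cdots a_{i+1}\otimes a_i\cdots a_1+t(a_n)\otimes p$. A coquasitriangular structure on a Hopf algebra $H$ is a convolution-invertible linear map $\mathcal R:H\otimes H\to k$ with $\mathcal R(ab,c)=\mathcal R(a,c_1)\mathcal R(b,c_2)$, $\mathcal R(a,bc)=\mathcal R(a_1,c)\mathcal R(a_2,b)$ and $b_1a_1\mathcal R(a_2,b_2)=\mathcal R(a_1,b_1)a_2b_2$. The quiver $Q$ is called a coquasitriangular Hopf quiver if the coalgebra $kQ$ admits a graded Hopf algebra structure together with a coquasitriangular structure on it. Let $H$ be a pointed Hopf algebra over $k$ (every simple subcoalgebra is one-dimensional) with a coquasitriangular structure $\mathcal R$. Let $H_0\subseteq H_1\subseteq\cdots$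 be its coradical filtration, let $\operatorname{gr}(H)=H_0\oplus H_1/H_0\oplus H_2/H_1\oplus\cdots$ be the associated graded Hopf algebra, and let $\operatorname{gr}(\mathcal R):\operatorname{gr}(H)\otimes\operatorname{gr}(H)\to k$ be equal to $\mathcal R$ on $H_0\otimes H_0$ and zero on pairs of homogeneous elements of which at least one has positive degree. **Theorem.** There is a coquasitriangular Hopf quiver $Q$, unique up to isomorphism of quivers, for which there exist a graded Hopf algebra structure on the path coalgebra $kQ$ and a bicharacter $\chi$ of the group $Q_0$ of group-like elements of $kQ$ with values in $k^\times$ such that: 1. the trivial extension $\mathfrak R:kQ\otimes kQ\to k$ of $\chi$ (equal to $\chi$ on pairs of vertices, and zero on pairs of paths of which at least one has positive length) is a coquasitriangular structure on $kQ$; 2. $(\operatorname{gr}(H),\operatorname{gr}(\mathcal R))$ is isomorphic to a large sub coquasitriangular Hopf algebra of $(kQ,\mathfrak R)$: there is an isomorphism of Hopf algebras from $\operatorname{gr}(H)$ onto a sub Hopf algebra $A$ of $kQ$ with $kQ_0\oplus kQ_1\subseteq A$, carrying $\operatorname{gr}(\mathcal R)$ to the restriction of $\mathfrak R$ to $A\otimes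 A$. Moreover, for this $Q$ the isomorphism in 2 can be chosen to respect the gradings. -/

import Mathlib

open scoped TensorProduct
open Coalgebra

universe u v w w'

namespace CQT

section PathCoalgebra

/-- All ways of cutting a path `p` into an initial part followed by a final part
(both may be trivial). -/
def pathCuts {V : Type v} [Quiver.{w} V] {a : V} :
    ∀ {b : V}, Quiver.Path a b → List (Σ c : V, Quiver.Path a c × Quiver.Path c b)
  | _, .nil => [⟨a, .nil, .nil⟩]
  | b, .cons p e => ⟨b, p.cons e, .nil⟩ :: (pathCuts p).map fun x => ⟨x.1, x.2.1, x.2.2.cons e⟩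

/-- The underlying vector space of the path coalgebra. -/
def PathCoalgebra (k : Type u) (V : Type v) [Field k] [Quiver.{w} V] : Type (max u v w) :=
  (Σ a b : V, Quiver.Path a b) →₀ k

variable (k : Type u) [Field k] {V : Type v} [Quiver.{w} V]

noncomputable instance : AddCommGroup (PathCoalgebra k V) :=
  inferInstanceAs (AddCommGroup ((Σ a b : V, Quiver.Path a b) →₀ k))

noncomputable instance : Module k (PathCoalgebra k V) :=
  inferInstanceAs (Module k ((Σ a b : V, Quiver.Path a b) →₀ k))

namespace PathCoalgebra

variable (V) in
/-- The basis of `kQ` consisting of all paths. -/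
noncomputable def basis :
    Module.Basis (Σ a b : V, Quiver.Path a b) k (PathCoalgebra k V) :=
  Module.Basis.ofRepr (LinearEquiv.refl k ((Σ a b : V, Quiver.Path a b) →₀ k))

/-- A path, as an element of `kQ`. -/
noncomputable def path {a b : V} (p : Quiver.Path a b) : PathCoalgebra k V :=
  basis k V ⟨a, b, p⟩

/-- A vertex (trivial path), as an element of `kQ`. -/
noncomputable def vertex (a : V) : PathCoalgebra k V := path k (Quiver.Path.nil : Quiver.Path a a)

noncomputable instance : CoalgebraStruct k (PathCoalgebra k V) where
  comul := (basis k V).constr k fun x =>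
    ((pathCuts x.2.2).map fun c => path k c.2.2 ⊗ₜ[k] path k c.2.1).sum
  counit := (basis k V).constr k fun x => if x.2.2.length = 0 then 1 else 0

variable {k}

theorem comul_path {a b : V} (p : Quiver.Path a b) :
    comul (R := k) (path k p) =
      ((pathCuts p).map fun c => path k c.2.2 ⊗ₜ[k] path k c.2.1).sum :=
  (basis k V).constr_basis k _ _

theorem counit_path {a b : V} (p : Quiver.Path a b) :
    counit (R := k) (path k p) = if p.length = 0 then 1 else 0 :=
  (basis k V).constr_basis k _ _

theorem hom_ext {M : Type*} [AddCommGroup M] [Module k M] {f g : PathCoalgebra k V →ₗ[k] M}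
    (h : ∀ (a b : V) (p : Quiver.Path a b), f (path k p) = g (path k p)) : f = g :=
  (basis k V).ext fun x => h x.1 x.2.1 x.2.2

theorem sum_cuts_assoc {M : Type*} [AddCommMonoid M] {a b : V} (p : Quiver.Path a b)
    (f : ∀ c d : V, Quiver.Path a c → Quiver.Path c d → Quiver.Path d b → M) :
    ((pathCuts p).map fun x => ((pathCuts x.2.2).map fun y =>
      f x.1 y.1 x.2.1 y.2.1 y.2.2).sum).sum =
    ((pathCuts p).map fun x => ((pathCuts x.2.1).map fun y =>
      f y.1 x.1 y.2.1 y.2.2 x.2.2).sum).sum := by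
  induction p with
  | nil => simp [pathCuts]
  | cons p e ih =>
    have h := ih fun c d q r s => f c d q r (s.cons e)
    simp only [pathCuts, List.map_cons, List.map_nil, List.sum_cons, List.sum_nil, List.map_map,
      Function.comp_def, add_zero] at h ⊢
    rw [List.sum_map_add, h]
    abel

theorem sum_cuts_left {M : Type*} [AddCommMonoid M] {a b : V} (p : Quiver.Path a b)
    (f : ∀ c : V, Quiver.Path a c → Quiver.Path c b → M) :
    ((pathCuts p).map fun x => if x.2.2.length = 0 then f x.1 x.2.1 x.2.2 else 0).sum =
      f b p .nil := by
  cases p <;> simp [pathCuts, Function.comp_def]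

theorem sum_cuts_right {M : Type*} [AddCommMonoid M] {a b : V} (p : Quiver.Path a b)
    (f : ∀ c : V, Quiver.Path a c → Quiver.Path c b → M) :
    ((pathCuts p).map fun x => if x.2.1.length = 0 then f x.1 x.2.1 x.2.2 else 0).sum =
      f a .nil p := by
  induction p with
  | nil => simp [pathCuts]
  | cons p e ih =>
    have h := ih fun c q r => f c q (r.cons e)
    simpa [pathCuts, Function.comp_def] using h

/-- The path coalgebra `kQ`. -/
noncomputable instance : Coalgebra k (PathCoalgebra k V) where
  coassoc := by
    refine hom_ext fun a b p => ?_
    simp only [LinearMap.comp_apply, LinearEquiv.coe_coe, comul_path, map_list_sum, List.map_map,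
      Function.comp_def, LinearMap.rTensor_tmul, LinearMap.lTensor_tmul]
    have h1 : ∀ x : Σ c : V, Quiver.Path a c × Quiver.Path c b,
        TensorProduct.assoc k _ _ _ (((pathCuts x.2.2).map fun c =>
          path k c.2.2 ⊗ₜ[k] path k c.2.1).sum ⊗ₜ[k] path k x.2.1) =
        ((pathCuts x.2.2).map fun c =>
          path k c.2.2 ⊗ₜ[k] (path k c.2.1 ⊗ₜ[k] path k x.2.1)).sum := by
      intro x
      induction pathCuts x.2.2 with
      | nil => simp
      | cons c l ih => simp [TensorProduct.add_tmul, ih]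
    have h2 : ∀ x : Σ c : V, Quiver.Path a c × Quiver.Path c b,
        path k x.2.2 ⊗ₜ[k] ((pathCuts x.2.1).map fun c =>
          path k c.2.2 ⊗ₜ[k] path k c.2.1).sum =
        ((pathCuts x.2.1).map fun c =>
          path k x.2.2 ⊗ₜ[k] (path k c.2.2 ⊗ₜ[k] path k c.2.1)).sum := by
      intro x
      induction pathCuts x.2.1 with
      | nil => simp
      | cons c l ih => simp [TensorProduct.tmul_add, ih]
    simp only [h1, h2]
    exact sum_cuts_assoc p fun c d q r s => path k s ⊗ₜ[k] (path k r ⊗ₜ[k] path k q)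
  rTensor_counit_comp_comul := by
    refine hom_ext fun a b p => ?_
    simp only [LinearMap.comp_apply, comul_path, map_list_sum, List.map_map,
      Function.comp_def, LinearMap.rTensor_tmul, counit_path, TensorProduct.mk_apply,
      TensorProduct.ite_tmul]
    exact sum_cuts_left p fun c q r => (1 : k) ⊗ₜ[k] path k q
  lTensor_counit_comp_comul := by
    refine hom_ext fun a b p => ?_
    simp only [LinearMap.comp_apply, comul_path, map_list_sum, List.map_map,
      Function.comp_def, LinearMap.lTensor_tmul, counit_path, LinearMap.flip_apply,
      TensorProduct.mk_apply, TensorProduct.tmul_ite]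
    exact sum_cuts_right p fun c q r => path k r ⊗ₜ[k] (1 : k)

theorem isGroupLikeElem_vertex (a : V) : IsGroupLikeElem k (vertex k a) where
  counit_eq_one := by simp [vertex, counit_path]
  comul_eq_tmul_self := by simp [vertex, comul_path, pathCuts]

variable (k V) in
/-- `kQ_n`, the span of the paths of length `n`. -/
noncomputable def homogeneous (n : ℕ) : Submodule k (PathCoalgebra k V) :=
  Submodule.span k {x | ∃ (a b : V) (p : Quiver.Path a b), p.length = n ∧ x = path k p}

end PathCoalgebra
end PathCoalgebra

section GradedHopf

/-- A graded Hopf algebra structure on the path coalgebra `kQ`: a unit, a multiplication and an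
antipode which make the coalgebra `kQ` into a Hopf algebra and respect the grading by length. -/
structure GradedHopfStructure (k : Type u) (V : Type v) [Field k] [Quiver.{w} V] where
  mul : PathCoalgebra k V →ₗ[k] PathCoalgebra k V →ₗ[k] PathCoalgebra k V
  one : PathCoalgebra k V
  antipode : PathCoalgebra k V →ₗ[k] PathCoalgebra k V
  one_mul : ∀ x, mul one x = x
  mul_one : ∀ x, mul x one = x
  mul_assoc : ∀ x y z, mul (mul x y) z = mul x (mul y z)
  counit_one : counit (R := k) one = 1
  counit_mul : ∀ x y, counit (R := k) (mul x y) = counit (R := k) x * counit (R := k) y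
  comul_one : comul (R := k) one = one ⊗ₜ[k] one
  comul_mul : ∀ x y, comul (R := k) (mul x y) =
    TensorProduct.map₂ mul mul (comul (R := k) x) (comul (R := k) y)
  antipode_left : ∀ x, TensorProduct.lift mul (antipode.rTensor _ (comul (R := k) x)) =
    counit (R := k) x • one
  antipode_right : ∀ x, TensorProduct.lift mul (antipode.lTensor _ (comul (R := k) x)) =
    counit (R := k) x • one
  one_mem : one ∈ PathCoalgebra.homogeneous k V 0
  mul_mem : ∀ {m n : ℕ} {x y : PathCoalgebra k V}, x ∈ PathCoalgebra.homogeneous k V m →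
    y ∈ PathCoalgebra.homogeneous k V n → mul x y ∈ PathCoalgebra.homogeneous k V (m + n)
  antipode_mem : ∀ {n : ℕ} {x : PathCoalgebra k V}, x ∈ PathCoalgebra.homogeneous k V n →
    antipode x ∈ PathCoalgebra.homogeneous k V n

namespace GradedHopfStructure

variable {k : Type u} {V : Type v} [Field k] [Quiver.{w} V]

/-- The space `kQ`, regarded as a Hopf algebra through the structure `S`. -/
def Carrier (_S : GradedHopfStructure k V) : Type (max u v w) := PathCoalgebra k V

variable (S : GradedHopfStructure k V)

noncomputable instance : AddCommGroup S.Carrier := inferInstanceAs (AddCommGroup (PathCoalgebra k V))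

noncomputable instance : Module k S.Carrier := inferInstanceAs (Module k (PathCoalgebra k V))

noncomputable instance : Coalgebra k S.Carrier := inferInstanceAs (Coalgebra k (PathCoalgebra k V))

/-- The multiplication of `S`, on `S.Carrier`. -/
noncomputable def carrierMul : S.Carrier →ₗ[k] S.Carrier →ₗ[k] S.Carrier := S.mul

noncomputable instance : Ring S.Carrier where
  __ := (inferInstance : AddCommGroup S.Carrier)
  mul x y := S.carrierMul x y
  one := S.one
  one_mul := S.one_mul
  mul_one := S.mul_one
  mul_assoc := S.mul_assoc
  zero_mul x := LinearMap.map_zero₂ S.carrierMul x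
  mul_zero x := (S.carrierMul x).map_zero
  left_distrib x y z := (S.carrierMul x).map_add y z
  right_distrib x y z := LinearMap.map_add₂ S.carrierMul x y z

noncomputable instance : Algebra k S.Carrier :=
  Algebra.ofModule (fun r x y => LinearMap.map_smul₂ S.carrierMul r x y)
    (fun r x y => (S.carrierMul x).map_smul r y)

theorem mul_eq_carrierMul : LinearMap.mul k S.Carrier = S.carrierMul := rfl

noncomputable instance : Bialgebra k S.Carrier :=
  Bialgebra.mk' k S.Carrier S.counit_one (S.counit_mul _ _) S.comul_one (by
    intro a b
    refine (S.comul_mul a b).trans ?_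
    change TensorProduct.map₂ (LinearMap.mul k S.Carrier) (LinearMap.mul k S.Carrier)
      (comul (R := k) a) (comul (R := k) b) = comul (R := k) a * comul (R := k) b
    induction comul (R := k) a with
    | zero => simp
    | add x y hx hy => rw [map_add, LinearMap.add_apply, hx, hy, add_mul]
    | tmul x y =>
      induction comul (R := k) b with
      | zero => simp
      | add z t hz ht => rw [map_add, hz, ht, mul_add]
      | tmul z t => simp)

noncomputable instance : HopfAlgebra k S.Carrier where
  antipode := S.antipode
  mul_antipode_rTensor_comul := LinearMap.ext fun x =>
    (S.antipode_left x).trans (Algebra.algebraMap_eq_smul_one (A := S.Carrier) _).symm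
  mul_antipode_lTensor_comul := LinearMap.ext fun x =>
    (S.antipode_right x).trans (Algebra.algebraMap_eq_smul_one (A := S.Carrier) _).symm

end GradedHopfStructure

end GradedHopf

section Coquasitriangular

/-- `R : H ⊗ H → k` is a coquasitriangular structure (universal `R`-form) on the Hopf algebra `H`:
it is convolution invertible and, in Sweedler notation,
`R(ab, c) = R(a, c₁) R(b, c₂)`, `R(a, bc) = R(a₁, c) R(a₂, b)` and
`b₁ a₁ R(a₂, b₂) = R(a₁, b₁) a₂ b₂`. -/
structure IsCoquasitriangular {k : Type u} {H : Type v} [Field k] [Ring H] [HopfAlgebra k H]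
    (R : H ⊗[k] H →ₗ[k] k) : Prop where
  isUnit : IsUnit (WithConv.toConv R)
  mul_left : ∀ a b c : H, R ((a * b) ⊗ₜ[k] c) =
    LinearMap.mul' k k (TensorProduct.map (R ∘ₗ TensorProduct.mk k H H a)
      (R ∘ₗ TensorProduct.mk k H H b) (comul (R := k) c))
  mul_right : ∀ a b c : H, R (a ⊗ₜ[k] (b * c)) =
    LinearMap.mul' k k (TensorProduct.map (R ∘ₗ (TensorProduct.mk k H H).flip c)
      (R ∘ₗ (TensorProduct.mk k H H).flip b) (comul (R := k) a))
  /- Here `comul (a ⊗ₜ b)` is `(a₁ ⊗ b₁) ⊗ (a₂ ⊗ b₂)`. -/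
  comm : ∀ a b : H,
    TensorProduct.rid k H (TensorProduct.map
      (LinearMap.mul' k H ∘ₗ (TensorProduct.comm k H H).toLinearMap) R
      (comul (R := k) (a ⊗ₜ[k] b))) =
    TensorProduct.lid k H (TensorProduct.map R (LinearMap.mul' k H)
      (comul (R := k) (a ⊗ₜ[k] b)))

/-- A coquasitriangular Hopf quiver: a quiver `Q` whose path coalgebra `kQ` admits a graded
coquasitriangular Hopf algebra structure. -/
def IsCoquasitriangularHopfQuiver (k : Type u) (V : Type v) [Field k] [Quiver.{w} V] : Prop :=
  ∃ (S : GradedHopfStructure k V) (R : S.Carrier ⊗[k] S.Carrier →ₗ[k] k), IsCoquasitriangular R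

end Coquasitriangular

section Filtration

variable (k : Type u) {C : Type v} [Field k] [AddCommGroup C] [Module k C]

/-- The subspace `A ⊗ B` of `C ⊗ C`. -/
def tens (A B : Submodule k C) : Submodule k (C ⊗[k] C) :=
  Submodule.map₂ (TensorProduct.mk k C C) A B

variable [Coalgebra k C]

/-- Subcoalgebras of a coalgebra. -/
def IsSubcoalgebra (D : Submodule k C) : Prop := ∀ x ∈ D, comul (R := k) x ∈ tens k D D

/-- Simple subcoalgebras of a coalgebra. -/
def IsSimpleSubcoalgebra (D : Submodule k C) : Prop :=
  IsSubcoalgebra k D ∧ D ≠ ⊥ ∧ ∀ E ≤ D, IsSubcoalgebra k E → E = ⊥ ∨ E = D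

variable (C)

/-- A coalgebra is pointed if its simple subcoalgebras are one-dimensional. -/
class IsPointed : Prop where
  finrank_eq_one : ∀ D : Submodule k C, IsSimpleSubcoalgebra k D → Module.finrank k D = 1

/-- The coradical: the sum of all simple subcoalgebras. -/
def coradical : Submodule k C := sSup {D | IsSimpleSubcoalgebra k D}

/-- The coradical filtration: `C₀` is the coradical and
`Cₙ₊₁ = Δ⁻¹(C ⊗ Cₙ + C₀ ⊗ C)`. -/
def coradFiltration : ℕ → Submodule k C
  | 0 => coradical k C
  | n + 1 => (tens k ⊤ (coradFiltration n) ⊔ tens k (coradical k C) ⊤).comap (comul (R := k))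

/-- The preceding term of the coradical filtration, `Cₙ₋₁`, with the convention `C₋₁ = 0`. -/
def coradBelow : ℕ → Submodule k C
  | 0 => ⊥
  | n + 1 => coradFiltration k C n

end Filtration

section LinAlg

variable {k : Type u} {C : Type v} [Field k] [AddCommGroup C] [Module k C]

theorem tmul_mem_tens {A B : Submodule k C} {a b : C} (ha : a ∈ A) (hb : b ∈ B) :
    a ⊗ₜ[k] b ∈ tens k A B := Submodule.apply_mem_map₂ _ ha hb

theorem tens_mono {A A' B B' : Submodule k C} (h : A ≤ A') (h' : B ≤ B') :
    tens k A B ≤ tens k A' B' := Submodule.map₂_le_map₂ h h'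

theorem tens_le {A B : Submodule k C} {P : Submodule k (C ⊗[k] C)}
    (h : ∀ a ∈ A, ∀ b ∈ B, a ⊗ₜ[k] b ∈ P) : tens k A B ≤ P := Submodule.map₂_le.2 h

theorem tens_top_top : tens k (⊤ : Submodule k C) ⊤ = ⊤ :=
  TensorProduct.map₂_mk_top_top_eq_top k C C

theorem map_mem_tens {A B : Submodule k C} {f g : C →ₗ[k] C} (hf : ∀ x, f x ∈ A)
    (hg : ∀ x, g x ∈ B) (z : C ⊗[k] C) : TensorProduct.map f g z ∈ tens k A B := by
  induction z with
  | zero => simp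
  | add x y hx hy => rw [map_add]; exact add_mem hx hy
  | tmul x y => exact tmul_mem_tens (hf x) (hg y)

theorem map_eq_self {A B : Submodule k C} {f g : C →ₗ[k] C} (hf : ∀ x ∈ A, f x = x)
    (hg : ∀ x ∈ B, g x = x) {z : C ⊗[k] C} (hz : z ∈ tens k A B) : TensorProduct.map f g z = z := by
  have : tens k A B ≤ LinearMap.eqLocus (TensorProduct.map f g) LinearMap.id :=
    tens_le fun a ha b hb => by simp [LinearMap.mem_eqLocus, hf a ha, hg b hb]
  exact this hz

theorem exists_proj (A : Submodule k C) :
    ∃ f : C →ₗ[k] C, (∀ x, f x ∈ A) ∧ ∀ x ∈ A, f x = x := by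
  obtain ⟨p, hp⟩ := A.subtype.exists_leftInverse_of_injective A.ker_subtype
  exact ⟨A.subtype ∘ₗ p, fun x => (p x).2,
    fun x hx => congrArg Subtype.val (LinearMap.congr_fun hp ⟨x, hx⟩)⟩

theorem tens_inf (A B : Submodule k C) : tens k A ⊤ ⊓ tens k ⊤ B ≤ tens k A B := by
  rintro z ⟨h1, h2⟩
  obtain ⟨f, hf, hf'⟩ := exists_proj A
  obtain ⟨g, hg, hg'⟩ := exists_proj B
  have e1 : TensorProduct.map f LinearMap.id z = z := map_eq_self hf' (fun _ _ => rfl) h1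
  have e2 : TensorProduct.map LinearMap.id g z = z := map_eq_self (fun _ _ => rfl) hg' h2
  have e3 : TensorProduct.map f LinearMap.id (TensorProduct.map LinearMap.id g z) =
      TensorProduct.map f g z := by
    rw [← LinearMap.comp_apply, ← TensorProduct.map_comp, LinearMap.comp_id, LinearMap.id_comp]
  rw [e2, e1] at e3
  rw [e3]
  exact map_mem_tens hf hg z

/-- The modular law used below. -/
theorem tens_modular {A B B' : Submodule k C} (h : B ≤ B') :
    (tens k A ⊤ ⊔ tens k ⊤ B) ⊓ tens k ⊤ B' ≤ tens k A B' ⊔ tens k ⊤ B := by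
  rw [sup_comm, sup_inf_assoc_of_le _ (tens_mono le_rfl h), sup_comm]
  exact sup_le_sup_right (tens_inf A B') _

theorem exists_comp_of_ker_le {M N N' : Type*} [AddCommGroup M] [Module k M]
    [AddCommGroup N] [Module k N] [AddCommGroup N'] [Module k N']
    {f : M →ₗ[k] N} {f' : M →ₗ[k] N'} (h : LinearMap.ker f ≤ LinearMap.ker f') :
    ∃ u : N →ₗ[k] N', f' = u ∘ₗ f := by
  obtain ⟨s, hs⟩ := f.rangeRestrict.exists_rightInverse_of_surjective f.range_rangeRestrict
  obtain ⟨u, hu⟩ := LinearMap.exists_extend (f' ∘ₗ s)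
  refine ⟨u, LinearMap.ext fun x => ?_⟩
  have h1 : u (f x) = f' (s (f.rangeRestrict x)) := LinearMap.congr_fun hu (f.rangeRestrict x)
  have h2 : f (s (f.rangeRestrict x)) = f x :=
    congrArg Subtype.val (LinearMap.congr_fun hs (f.rangeRestrict x))
  rw [LinearMap.comp_apply, h1, eq_comm, ← sub_eq_zero, ← map_sub]
  exact h (by rw [LinearMap.mem_ker, map_sub, h2, sub_self])

theorem map_eq_zero_of_ker_le {M N N' M' P P' : Type*} [AddCommGroup M] [Module k M]
    [AddCommGroup N] [Module k N] [AddCommGroup N'] [Module k N'] [AddCommGroup M'] [Module k M']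
    [AddCommGroup P] [Module k P] [AddCommGroup P'] [Module k P']
    {f : M →ₗ[k] N} {f' : M →ₗ[k] N'} {g : M' →ₗ[k] P} {g' : M' →ₗ[k] P'}
    (h : LinearMap.ker f ≤ LinearMap.ker f') (h' : LinearMap.ker g ≤ LinearMap.ker g')
    {z : M ⊗[k] M'}
    (hz : TensorProduct.map f g z = 0) : TensorProduct.map f' g' z = 0 := by
  obtain ⟨u, rfl⟩ := exists_comp_of_ker_le h
  obtain ⟨v, rfl⟩ := exists_comp_of_ker_le h'
  rw [TensorProduct.map_comp, LinearMap.comp_apply, hz, map_zero]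

theorem ker_map_mkQ (A B : Submodule k C) :
    LinearMap.ker (TensorProduct.map A.mkQ B.mkQ) = tens k A ⊤ ⊔ tens k ⊤ B := by
  refine le_antisymm (fun z hz => ?_) (sup_le (tens_le fun a ha b _ => ?_)
    (tens_le fun a _ b hb => ?_))
  · obtain ⟨f, hf, hf'⟩ := exists_proj A
    obtain ⟨g, hg, hg'⟩ := exists_proj B
    have h0 : TensorProduct.map (LinearMap.id - f) (LinearMap.id - g) z = 0 := by
      refine map_eq_zero_of_ker_le (f := A.mkQ) (g := B.mkQ) ?_ ?_ hz
      · rw [Submodule.ker_mkQ]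
        intro x hx
        simp [hf' x hx]
      · rw [Submodule.ker_mkQ]
        intro x hx
        simp [hg' x hx]
    have h1 : z = TensorProduct.map f LinearMap.id z +
        TensorProduct.map (LinearMap.id - f) g z := by
      rw [← add_zero (TensorProduct.map f LinearMap.id z + _), ← h0]
      clear h0 hz
      induction z with
      | zero => simp
      | add x y hx hy => simp only [map_add] at hx hy ⊢; nth_rw 1 [hx, hy]; abel
      | tmul x y => simp [TensorProduct.sub_tmul, TensorProduct.tmul_sub]
    rw [h1]
    exact add_mem (Submodule.mem_sup_left (map_mem_tens hf (fun _ => Submodule.mem_top) z))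
      (Submodule.mem_sup_right (map_mem_tens (fun _ => Submodule.mem_top) hg z))
  · rw [LinearMap.mem_ker, TensorProduct.map_tmul, Submodule.mkQ_apply,
      (Submodule.Quotient.mk_eq_zero A).2 ha, TensorProduct.zero_tmul]
  · rw [LinearMap.mem_ker, TensorProduct.map_tmul, Submodule.mkQ_apply (p := B),
      (Submodule.Quotient.mk_eq_zero B).2 hb, TensorProduct.tmul_zero]

theorem mem_tens_sup_iff {A B : Submodule k C} {z : C ⊗[k] C} :
    z ∈ tens k A ⊤ ⊔ tens k ⊤ B ↔ TensorProduct.map A.mkQ B.mkQ z = 0 := by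
  rw [← ker_map_mkQ, LinearMap.mem_ker]

end LinAlg

section Wedge

variable {k : Type u} {C : Type v} [Field k] [AddCommGroup C] [Module k C] [Coalgebra k C]

variable (k) in
/-- The wedge `A ∧ B = Δ⁻¹(A ⊗ C + C ⊗ B)`. -/
def wedge (A B : Submodule k C) : Submodule k C :=
  (tens k A ⊤ ⊔ tens k ⊤ B).comap (comul (R := k))

theorem mem_wedge {A B : Submodule k C} {x : C} :
    x ∈ wedge k A B ↔ comul (R := k) x ∈ tens k A ⊤ ⊔ tens k ⊤ B := Iff.rfl

theorem ker_wedge (A B : Submodule k C) :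
    LinearMap.ker (TensorProduct.map A.mkQ B.mkQ ∘ₗ (comul (R := k))) = wedge k A B := by
  ext x
  rw [mem_wedge, mem_tens_sup_iff]
  rfl

theorem wedge_assoc (A B D : Submodule k C) :
    wedge k (wedge k A B) D = wedge k A (wedge k B D) := by
  ext x
  have h1 : TensorProduct.map (TensorProduct.map A.mkQ B.mkQ ∘ₗ (comul (R := k))) D.mkQ
        (comul (R := k) x) =
      (TensorProduct.assoc k _ _ _).symm (TensorProduct.map A.mkQ
        (TensorProduct.map B.mkQ D.mkQ ∘ₗ (comul (R := k))) (comul (R := k) x)) := by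
    have h2 : TensorProduct.map A.mkQ (TensorProduct.map B.mkQ D.mkQ ∘ₗ (comul (R := k)))
        (comul (R := k) x) = TensorProduct.map A.mkQ (TensorProduct.map B.mkQ D.mkQ)
          ((comul (R := k)).lTensor C (comul (R := k) x)) := by
      rw [LinearMap.lTensor, TensorProduct.map_map, LinearMap.comp_id]
    have h3 : TensorProduct.map (TensorProduct.map A.mkQ B.mkQ ∘ₗ (comul (R := k))) D.mkQ
        (comul (R := k) x) = TensorProduct.map (TensorProduct.map A.mkQ B.mkQ) D.mkQ
          ((comul (R := k)).rTensor C (comul (R := k) x)) := by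
      rw [LinearMap.rTensor, TensorProduct.map_map, LinearMap.comp_id]
    rw [h2, h3, ← coassoc_apply, LinearEquiv.eq_symm_apply]
    induction (comul (R := k)).rTensor C (comul (R := k) x) with
    | zero => simp
    | add x y hx hy => simp only [map_add, hx, hy]
    | tmul x y =>
      induction x with
      | zero => simp
      | add x z hx hy => simp only [map_add, TensorProduct.add_tmul, hx, hy]
      | tmul x z => simp
  rw [mem_wedge, mem_wedge, mem_tens_sup_iff, mem_tens_sup_iff]
  have k1 := ker_wedge A B
  have k2 := ker_wedge B D
  have e1 := (Submodule.ker_mkQ (wedge k A B))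
  have e2 := (Submodule.ker_mkQ (wedge k B D))
  constructor
  · intro h
    have h' := map_eq_zero_of_ker_le (e1.trans k1.symm).le le_rfl h
    rw [h1, LinearEquiv.map_eq_zero_iff] at h'
    exact map_eq_zero_of_ker_le le_rfl (k2.trans e2.symm).le h'
  · intro h
    have h' := map_eq_zero_of_ker_le le_rfl (e2.trans k2.symm).le h
    rw [← LinearEquiv.map_eq_zero_iff (TensorProduct.assoc k _ _ _).symm, ← h1] at h'
    exact map_eq_zero_of_ker_le (k1.trans e1.symm).le le_rfl h'

theorem IsSubcoalgebra.wedge_bot {D : Submodule k C} (h : IsSubcoalgebra k D) :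
    wedge k D ⊥ = D := by
  refine le_antisymm (fun x hx => ?_) fun x hx =>
    Submodule.mem_sup_left (tens_mono le_rfl le_top (h x hx))
  have h0 : tens k (⊤ : Submodule k C) ⊥ = ⊥ := Submodule.map₂_bot_right _ _
  rw [mem_wedge, h0, sup_bot_eq] at hx
  have h1 : tens k D ⊤ ≤ D.comap ((TensorProduct.rid k C).toLinearMap ∘ₗ
      (counit (R := k)).lTensor C) :=
    tens_le fun a ha b _ => by simpa using D.smul_mem _ ha
  simpa using h1 hx

theorem IsSubcoalgebra.bot_wedge {D : Submodule k C} (h : IsSubcoalgebra k D) :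
    wedge k ⊥ D = D := by
  refine le_antisymm (fun x hx => ?_) fun x hx =>
    Submodule.mem_sup_right (tens_mono le_top le_rfl (h x hx))
  have h0 : tens k (⊥ : Submodule k C) ⊤ = ⊥ := Submodule.map₂_bot_left _ _
  rw [mem_wedge, h0, bot_sup_eq] at hx
  have h1 : tens k ⊤ D ≤ D.comap ((TensorProduct.lid k C).toLinearMap ∘ₗ
      (counit (R := k)).rTensor C) :=
    tens_le fun a _ b hb => by simpa using D.smul_mem _ hb
  simpa using h1 hx

theorem isSubcoalgebra_bot : IsSubcoalgebra k (⊥ : Submodule k C) := by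
  rintro x hx
  rw [(Submodule.mem_bot k).1 hx, map_zero]
  exact zero_mem _

theorem isSubcoalgebra_coradical : IsSubcoalgebra k (coradical k C) := by
  have : coradical k C ≤
      (tens k (coradical k C) (coradical k C)).comap (comul (R := k)) :=
    sSup_le fun D hD x hx =>
      tens_mono (le_sSup hD) (le_sSup hD) (hD.1 x hx)
  exact this

theorem coradBelow_succ (n : ℕ) :
    coradBelow k C (n + 1) = wedge k (coradBelow k C 1) (coradBelow k C n) := by
  cases n with
  | zero => exact isSubcoalgebra_coradical.wedge_bot.symm
  | succ n =>
    change (_ : Submodule k _).comap _ = (_ : Submodule k _).comap _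
    rw [sup_comm]
    rfl

theorem coradBelow_add (m n : ℕ) :
    coradBelow k C (m + n) = wedge k (coradBelow k C m) (coradBelow k C n) := by
  induction m with
  | zero =>
    rw [zero_add]
    induction n with
    | zero => exact isSubcoalgebra_bot.bot_wedge.symm
    | succ n ih =>
      rw [coradBelow_succ, ← wedge_assoc]
      congr 1
      exact isSubcoalgebra_coradical.bot_wedge.symm
  | succ m ih => rw [add_right_comm, coradBelow_succ, ih, ← wedge_assoc, ← coradBelow_succ]

/-- `Δ(F_{m+n}) ⊆ F_m ⊗ C + C ⊗ F_n`, where `F_n = C_{n-1}`. -/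
theorem comul_mem_sup {m n : ℕ} {x : C} (hx : x ∈ coradBelow k C (m + n)) :
    comul (R := k) x ∈ tens k (coradBelow k C m) ⊤ ⊔ tens k ⊤ (coradBelow k C n) := by
  rwa [coradBelow_add] at hx

theorem comul_mem_right {n : ℕ} {x : C} (hx : x ∈ coradBelow k C n) :
    comul (R := k) x ∈ tens k ⊤ (coradBelow k C n) := by
  have h := comul_mem_sup (m := 0) (n := n) (by rwa [zero_add])
  have h0 : tens k (⊥ : Submodule k C) ⊤ = ⊥ := Submodule.map₂_bot_left _ _
  rwa [coradBelow, h0, bot_sup_eq] at h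

theorem coradBelow_le_succ (n : ℕ) : coradBelow k C n ≤ coradBelow k C (n + 1) := fun x hx => by
  rw [coradBelow_succ]
  exact Submodule.mem_sup_right (comul_mem_right hx)

theorem coradBelow_mono : Monotone (coradBelow k C) := monotone_nat_of_le_succ coradBelow_le_succ

variable (k C) in
/-- `Σ_{i+j=n} C_i ⊗ C_j` inside `C ⊗ C`. -/
def tensFiltration (n : ℕ) : Submodule k (C ⊗[k] C) :=
  Submodule.span k {z | ∃ (i j : ℕ) (a b : C), i + j = n ∧ a ∈ coradFiltration k C i ∧
    b ∈ coradFiltration k C j ∧ z = a ⊗ₜ[k] b}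

theorem tens_le_tensFiltration {i j n : ℕ} (h : i + j = n) :
    tens k (coradFiltration k C i) (coradFiltration k C j) ≤ tensFiltration k C n :=
  tens_le fun a ha b hb => Submodule.subset_span ⟨i, j, a, b, h, ha, hb, rfl⟩

/-- The coradical filtration is a coalgebra filtration. -/
theorem comul_mem_tensFiltration {n : ℕ} {x : C} (hx : x ∈ coradFiltration k C n) :
    comul (R := k) x ∈ tensFiltration k C n := by
  have key : ∀ r s : ℕ, r + s = n + 1 → comul (R := k) x ∈
      (tensFiltration k C n ⊓ tens k (coradBelow k C r) ⊤) ⊔ tens k ⊤ (coradBelow k C s) := by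
    intro r
    induction r with
    | zero =>
      intro s hs
      rw [zero_add] at hs
      subst hs
      exact Submodule.mem_sup_right (comul_mem_right hx)
    | succ r ih =>
      intro s hs
      obtain ⟨y, hy, w, hw, hyw⟩ := Submodule.mem_sup.1 (ih (s + 1) (by omega))
      have hx' : x ∈ coradBelow k C (r + 1 + s) := by rw [hs]; exact hx
      have h1 := comul_mem_sup hx'
      have hy' : y ∈ tens k (coradBelow k C (r + 1)) ⊤ :=
        tens_mono (coradBelow_le_succ r) le_rfl hy.2
      have h2 : w ∈ tens k (coradBelow k C (r + 1)) ⊤ ⊔ tens k ⊤ (coradBelow k C s) := by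
        have : w = comul (R := k) x - y := by rw [← hyw]; abel
        rw [this]
        exact sub_mem h1 (Submodule.mem_sup_left hy')
      have h3 := tens_modular (coradBelow_le_succ s) ⟨h2, hw⟩
      rw [← hyw]
      have h4 : tens k (coradBelow k C (r + 1)) (coradBelow k C (s + 1)) ≤
          tensFiltration k C n ⊓ tens k (coradBelow k C (r + 1)) ⊤ :=
        le_inf (tens_le_tensFiltration (by omega)) (tens_mono le_rfl le_top)
      exact add_mem (Submodule.mem_sup_left ⟨hy.1, hy'⟩) (sup_le_sup_right h4 _ h3)
  have h := key (n + 1) 0 rfl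
  have h0 : tens k (⊤ : Submodule k C) ⊥ = ⊥ := Submodule.map₂_bot_right _ _
  rw [coradBelow, h0, sup_bot_eq] at h
  exact h.1

end Wedge

section Graded

variable (k : Type u) (C : Type v) [Field k] [AddCommGroup C] [Module k C] [Coalgebra k C]

/-- The homogeneous component `Cₙ / Cₙ₋₁` of `gr C` (with `C₋₁ = 0`). -/
abbrev GrPiece (n : ℕ) : Type v :=
  ↥(coradFiltration k C n) ⧸ (coradBelow k C n).submoduleOf (coradFiltration k C n)

/-- The graded vector space `gr C = C₀ ⊕ C₁/C₀ ⊕ C₂/C₁ ⊕ ⋯` of the coradical filtration. -/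
def Gr : Type v := DirectSum ℕ fun n => GrPiece k C n

noncomputable instance : AddCommGroup (Gr k C) :=
  inferInstanceAs (AddCommGroup (DirectSum ℕ fun n => GrPiece k C n))

noncomputable instance : Module k (Gr k C) :=
  inferInstanceAs (Module k (DirectSum ℕ fun n => GrPiece k C n))

namespace Gr

/-- The class in `Cₙ / Cₙ₋₁ ⊆ gr C` of an element of `Cₙ`. -/
noncomputable def cls (n : ℕ) : ↥(coradFiltration k C n) →ₗ[k] Gr k C :=
  DirectSum.lof k ℕ (fun n => GrPiece k C n) n ∘ₗ
    ((coradBelow k C n).submoduleOf (coradFiltration k C n)).mkQ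

/-- The homogeneous component of degree `n`, as a subspace of `gr C`. -/
noncomputable def homogeneous (n : ℕ) : Submodule k (Gr k C) := LinearMap.range (cls k C n)

/-- A linear extension of `cls n` to all of `C`; only its values on `Cₙ` matter. -/
noncomputable def symb (n : ℕ) : C →ₗ[k] Gr k C := (LinearMap.exists_extend (cls k C n)).choose

variable {k C}

theorem symb_eq_cls {n : ℕ} {x : C} (hx : x ∈ coradFiltration k C n) :
    symb k C n x = cls k C n ⟨x, hx⟩ :=
  LinearMap.congr_fun (LinearMap.exists_extend (cls k C n)).choose_spec ⟨x, hx⟩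

theorem symb_eq_zero {n : ℕ} {x : C} (hx : x ∈ coradBelow k C n) : symb k C n x = 0 := by
  have hx' : x ∈ coradFiltration k C n := coradBelow_le_succ n hx
  have h : ((coradBelow k C n).submoduleOf (coradFiltration k C n)).mkQ ⟨x, hx'⟩ = 0 :=
    (Submodule.Quotient.mk_eq_zero _).2 hx
  rw [symb_eq_cls hx']
  exact (congrArg (DirectSum.lof k ℕ (fun n => GrPiece k C n) n) h).trans (map_zero _)

theorem symb_eq_zero_of_lt {m n : ℕ} {x : C} (hx : x ∈ coradFiltration k C m) (h : m < n) :
    symb k C n x = 0 := symb_eq_zero (coradBelow_mono h hx)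

theorem hom_ext {M : Type*} [AddCommGroup M] [Module k M] {f g : Gr k C →ₗ[k] M}
    (h : ∀ n, ∀ x ∈ coradFiltration k C n, f (symb k C n x) = g (symb k C n x)) : f = g := by
  refine DirectSum.linearMap_ext k fun n => ?_
  refine Submodule.linearMap_qext _ (LinearMap.ext fun x => ?_)
  have := h n x.1 x.2
  rw [symb_eq_cls x.2] at this
  exact this

/-- A family of linear maps `fₙ : Cₙ → M`, vanishing on `Cₙ₋₁`, induces a linear map
`gr C → M`. -/
noncomputable def lift {M : Type*} [AddCommGroup M] [Module k M]
    (f : ∀ n, ↥(coradFiltration k C n) →ₗ[k] M)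
    (hf : ∀ n (x : ↥(coradFiltration k C n)), x.1 ∈ coradBelow k C n → f n x = 0) :
    Gr k C →ₗ[k] M :=
  DirectSum.toModule k ℕ M fun n => Submodule.liftQ _ (f n) fun x hx => hf n x hx

theorem lift_symb {M : Type*} [AddCommGroup M] [Module k M]
    (f : ∀ n, ↥(coradFiltration k C n) →ₗ[k] M)
    (hf : ∀ n (x : ↥(coradFiltration k C n)), x.1 ∈ coradBelow k C n → f n x = 0)
    {n : ℕ} {x : C} (hx : x ∈ coradFiltration k C n) :
    lift f hf (symb k C n x) = f n ⟨x, hx⟩ := by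
  rw [symb_eq_cls hx]
  exact DirectSum.toModule_lof (R := k) (M := fun n => GrPiece k C n)
    (φ := fun n => Submodule.liftQ _ (f n) fun x hx => hf n x hx) n _

theorem sum_antidiagonal_eq {M N : Type*} [AddCommGroup M] [Module k M] [AddCommGroup N]
    [Module k N] {f : ℕ → M} {g : ℕ → N} {i j : ℕ} (hf : ∀ m, i < m → f m = 0)
    (hg : ∀ m, j < m → g m = 0) :
    ∑ p ∈ Finset.HasAntidiagonal.antidiagonal (i + j), f p.1 ⊗ₜ[k] g p.2 = f i ⊗ₜ[k] g j := by
  rw [Finset.sum_eq_single (i, j)]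
  · rintro ⟨a, b⟩ hab hne
    rw [Finset.HasAntidiagonal.mem_antidiagonal] at hab
    rcases lt_trichotomy i a with h | h | h
    · simp [hf a h]
    · exact absurd (Prod.ext h.symm (by simp at hab ⊢; omega)) hne
    · simp [hg b (by simp at hab; omega)]
  · simp

theorem sum_antidiagonal_triple {M : Type*} [AddCommMonoid M] (n : ℕ) (f : ℕ → ℕ → ℕ → M) :
    ∑ p ∈ Finset.HasAntidiagonal.antidiagonal n,
      ∑ q ∈ Finset.HasAntidiagonal.antidiagonal p.1, f q.1 q.2 p.2 =
    ∑ p ∈ Finset.HasAntidiagonal.antidiagonal n,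
      ∑ q ∈ Finset.HasAntidiagonal.antidiagonal p.2, f p.1 q.1 q.2 := by
  rw [Finset.sum_sigma', Finset.sum_sigma']
  refine Finset.sum_nbij' (fun x => ⟨(x.2.1, x.2.2 + x.1.2), (x.2.2, x.1.2)⟩)
    (fun x => ⟨(x.1.1 + x.2.1, x.2.2), (x.1.1, x.2.1)⟩) ?_ ?_ ?_ ?_ ?_
  · rintro ⟨⟨a, b⟩, ⟨c, d⟩⟩ h
    simp at h ⊢
    omega
  · rintro ⟨⟨a, b⟩, ⟨c, d⟩⟩ h
    simp at h ⊢
    omega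
  · rintro ⟨⟨a, b⟩, ⟨c, d⟩⟩ h
    simp at h ⊢
    omega
  · rintro ⟨⟨a, b⟩, ⟨c, d⟩⟩ h
    simp at h ⊢
    omega
  · rintro ⟨⟨a, b⟩, ⟨c, d⟩⟩ h
    rfl

variable (k C) in
/-- The map `a ⊗ b ↦ [a] ⊗ [b]` from `Σ_{i+j=n} C_i ⊗ C_j` to `gr C ⊗ gr C`. -/
noncomputable def symb₂ (n : ℕ) : C ⊗[k] C →ₗ[k] Gr k C ⊗[k] Gr k C :=
  ∑ p ∈ Finset.HasAntidiagonal.antidiagonal n, TensorProduct.map (symb k C p.1) (symb k C p.2)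

theorem symb₂_tmul {i j : ℕ} {a b : C} (ha : a ∈ coradFiltration k C i)
    (hb : b ∈ coradFiltration k C j) :
    symb₂ k C (i + j) (a ⊗ₜ[k] b) = symb k C i a ⊗ₜ[k] symb k C j b := by
  simp only [symb₂, LinearMap.sum_apply, TensorProduct.map_tmul]
  exact sum_antidiagonal_eq (f := fun m => symb k C m a) (g := fun m => symb k C m b)
    (fun m hm => symb_eq_zero_of_lt ha hm) (fun m hm => symb_eq_zero_of_lt hb hm)

/-- Two linear maps which agree on all `a ⊗ b` with `a ∈ C_i`, `b ∈ C_j`, `i + j = n`,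
agree on `Σ_{i+j=n} C_i ⊗ C_j`. -/
theorem tensFiltration_ext {M : Type*} [AddCommGroup M] [Module k M] {f g : C ⊗[k] C →ₗ[k] M}
    {n : ℕ} (h : ∀ i j, i + j = n → ∀ a ∈ coradFiltration k C i, ∀ b ∈ coradFiltration k C j,
      f (a ⊗ₜ[k] b) = g (a ⊗ₜ[k] b)) {z : C ⊗[k] C} (hz : z ∈ tensFiltration k C n) :
    f z = g z := by
  have : tensFiltration k C n ≤ LinearMap.eqLocus f g := by
    refine Submodule.span_le.2 ?_
    rintro _ ⟨i, j, a, b, hij, ha, hb, rfl⟩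
    exact h i j hij a ha b hb
  exact this hz

theorem symb₂_eq_zero_of_lt {m n : ℕ} {z : C ⊗[k] C} (hz : z ∈ tensFiltration k C m) (h : m < n) :
    symb₂ k C n z = 0 := by
  refine tensFiltration_ext (g := 0) (fun i j hij a ha b hb => ?_) hz
  simp only [symb₂, LinearMap.sum_apply, TensorProduct.map_tmul, LinearMap.zero_apply]
  refine Finset.sum_eq_zero fun p hp => ?_
  rw [Finset.HasAntidiagonal.mem_antidiagonal] at hp
  rcases lt_or_ge i p.1 with h1 | h1
  · rw [symb_eq_zero_of_lt ha h1, TensorProduct.zero_tmul]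
  · rw [symb_eq_zero_of_lt hb (by omega), TensorProduct.tmul_zero]

/-- `Δ[x] = Σ [x₁] ⊗ [x₂]` and `ε[x] = ε(x)` in degree `0`, `ε[x] = 0` in positive degrees. -/
noncomputable instance : CoalgebraStruct k (Gr k C) where
  comul := lift (fun n => symb₂ k C n ∘ₗ comul ∘ₗ (coradFiltration k C n).subtype) <| by
    rintro (_ | n) ⟨x, hx'⟩ hx
    · obtain rfl : x = 0 := hx
      simp
    · exact symb₂_eq_zero_of_lt (comul_mem_tensFiltration hx) n.lt_succ_self
  counit := lift (fun n => if n = 0 then counit ∘ₗ (coradFiltration k C n).subtype else 0) <| by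
    rintro (_ | n) ⟨x, hx'⟩ hx
    · obtain rfl : x = 0 := hx
      simp
    · simp

theorem comul_symb {n : ℕ} {x : C} (hx : x ∈ coradFiltration k C n) :
    comul (R := k) (symb k C n x) = symb₂ k C n (comul (R := k) x) :=
  lift_symb _ _ hx

theorem counit_symb_zero {x : C} (hx : x ∈ coradFiltration k C 0) :
    counit (R := k) (symb k C 0 x) = counit (R := k) x :=
  (lift_symb _ _ hx).trans (by simp)

theorem counit_symb_pos {n : ℕ} (hn : n ≠ 0) {x : C} (hx : x ∈ coradFiltration k C n) :
    counit (R := k) (symb k C n x) = 0 :=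
  (lift_symb _ _ hx).trans (by simp [hn])

/-- The graded coalgebra `gr C`. -/
noncomputable instance : Coalgebra k (Gr k C) where
  coassoc := by
    refine hom_ext fun n x hx => ?_
    let Ψ₁ : (C ⊗[k] C) ⊗[k] C →ₗ[k] (Gr k C ⊗[k] Gr k C) ⊗[k] Gr k C :=
      ∑ p ∈ Finset.HasAntidiagonal.antidiagonal n, TensorProduct.map (symb₂ k C p.1) (symb k C p.2)
    let Ψ₂ : C ⊗[k] (C ⊗[k] C) →ₗ[k] Gr k C ⊗[k] (Gr k C ⊗[k] Gr k C) :=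
      ∑ p ∈ Finset.HasAntidiagonal.antidiagonal n, TensorProduct.map (symb k C p.1) (symb₂ k C p.2)
    have h1 : (comul (R := k)).rTensor (Gr k C) (symb₂ k C n (comul (R := k) x)) =
        Ψ₁ ((comul (R := k)).rTensor C (comul (R := k) x)) := by
      refine tensFiltration_ext (f := (comul (R := k)).rTensor (Gr k C) ∘ₗ symb₂ k C n)
        (g := Ψ₁ ∘ₗ (comul (R := k)).rTensor C) (fun i j hij a ha b hb => ?_)
        (comul_mem_tensFiltration hx)
      subst hij
      simp only [LinearMap.comp_apply, symb₂_tmul ha hb, LinearMap.rTensor_tmul, comul_symb ha, Ψ₁,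
        LinearMap.sum_apply, TensorProduct.map_tmul]
      exact (sum_antidiagonal_eq (f := fun m => symb₂ k C m (comul (R := k) a))
        (g := fun m => symb k C m b)
        (fun m hm => symb₂_eq_zero_of_lt (comul_mem_tensFiltration ha) hm)
        (fun m hm => symb_eq_zero_of_lt hb hm)).symm
    have h2 : (comul (R := k)).lTensor (Gr k C) (symb₂ k C n (comul (R := k) x)) =
        Ψ₂ ((comul (R := k)).lTensor C (comul (R := k) x)) := by
      refine tensFiltration_ext (f := (comul (R := k)).lTensor (Gr k C) ∘ₗ symb₂ k C n)
        (g := Ψ₂ ∘ₗ (comul (R := k)).lTensor C) (fun i j hij a ha b hb => ?_)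
        (comul_mem_tensFiltration hx)
      subst hij
      simp only [LinearMap.comp_apply, symb₂_tmul ha hb, LinearMap.lTensor_tmul, comul_symb hb, Ψ₂,
        LinearMap.sum_apply, TensorProduct.map_tmul]
      exact (sum_antidiagonal_eq (f := fun m => symb k C m a)
        (g := fun m => symb₂ k C m (comul (R := k) b))
        (fun m hm => symb_eq_zero_of_lt ha hm)
        (fun m hm => symb₂_eq_zero_of_lt (comul_mem_tensFiltration hb) hm)).symm
    have h3 : (TensorProduct.assoc k _ _ _).toLinearMap ∘ₗ Ψ₁ =
        Ψ₂ ∘ₗ (TensorProduct.assoc k C C C).toLinearMap := by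
      refine TensorProduct.ext_threefold fun a b c => ?_
      simp only [Ψ₁, Ψ₂, symb₂, LinearMap.comp_apply, LinearMap.sum_apply, LinearEquiv.coe_coe,
        TensorProduct.assoc_tmul, TensorProduct.map_tmul, TensorProduct.sum_tmul, map_sum,
        TensorProduct.tmul_sum]
      exact sum_antidiagonal_triple n fun i j l =>
        symb k C i a ⊗ₜ[k] (symb k C j b ⊗ₜ[k] symb k C l c)
    have h4 := LinearMap.congr_fun h3 ((comul (R := k)).rTensor C (comul (R := k) x))
    simp only [LinearMap.comp_apply, LinearEquiv.coe_coe, coassoc_apply] at h4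
    simp only [LinearMap.comp_apply, LinearEquiv.coe_coe, comul_symb hx, h1, h2, h4]
  rTensor_counit_comp_comul := by
    refine hom_ext fun n x hx => ?_
    have h1 : (counit (R := k)).rTensor (Gr k C) (symb₂ k C n (comul (R := k) x)) =
        (symb k C n).lTensor k ((counit (R := k)).rTensor C (comul (R := k) x)) := by
      refine tensFiltration_ext (f := (counit (R := k)).rTensor (Gr k C) ∘ₗ symb₂ k C n)
        (g := (symb k C n).lTensor k ∘ₗ (counit (R := k)).rTensor C) (fun i j hij a ha b hb => ?_)
        (comul_mem_tensFiltration hx)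
      subst hij
      simp only [LinearMap.comp_apply, symb₂_tmul ha hb, LinearMap.rTensor_tmul,
        LinearMap.lTensor_tmul]
      rcases Nat.eq_zero_or_pos i with rfl | hi
      · rw [counit_symb_zero ha, zero_add]
      · rw [counit_symb_pos hi.ne' ha, symb_eq_zero_of_lt (n := i + j) hb (by omega),
          TensorProduct.zero_tmul,
          TensorProduct.tmul_zero]
    rw [LinearMap.comp_apply, comul_symb hx, h1, rTensor_counit_comul, LinearMap.lTensor_tmul,
      TensorProduct.mk_apply]
  lTensor_counit_comp_comul := by
    refine hom_ext fun n x hx => ?_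
    have h1 : (counit (R := k)).lTensor (Gr k C) (symb₂ k C n (comul (R := k) x)) =
        (symb k C n).rTensor k ((counit (R := k)).lTensor C (comul (R := k) x)) := by
      refine tensFiltration_ext (f := (counit (R := k)).lTensor (Gr k C) ∘ₗ symb₂ k C n)
        (g := (symb k C n).rTensor k ∘ₗ (counit (R := k)).lTensor C) (fun i j hij a ha b hb => ?_)
        (comul_mem_tensFiltration hx)
      subst hij
      simp only [LinearMap.comp_apply, symb₂_tmul ha hb, LinearMap.rTensor_tmul,
        LinearMap.lTensor_tmul]
      rcases Nat.eq_zero_or_pos j with rfl | hj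
      · rw [counit_symb_zero hb, add_zero]
      · rw [counit_symb_pos hj.ne' hb, symb_eq_zero_of_lt (n := i + j) ha (by omega),
          TensorProduct.zero_tmul,
          TensorProduct.tmul_zero]
    rw [LinearMap.comp_apply, comul_symb hx, h1, lTensor_counit_comul, LinearMap.rTensor_tmul,
      LinearMap.flip_apply, TensorProduct.mk_apply]

/-- If `Δ(x) = Σ aₛ ⊗ bₛ` with `aₛ ∈ C_{i(s)}`, `bₛ ∈ C_{j(s)}` and `i(s) + j(s) = n`, then
`Δ[x] = Σ [aₛ] ⊗ [bₛ]` for the class `[x]` of `x` in degree `n`. -/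
theorem comul_cls {ι : Type*} (s : Finset ι) (n : ℕ) (i j : ι → ℕ) (hij : ∀ r ∈ s, i r + j r = n)
    (a : ∀ r, ↥(coradFiltration k C (i r))) (b : ∀ r, ↥(coradFiltration k C (j r)))
    (x : ↥(coradFiltration k C n)) (hx : comul (R := k) x.1 = ∑ r ∈ s, (a r).1 ⊗ₜ[k] (b r).1) :
    comul (R := k) (cls k C n x) = ∑ r ∈ s, cls k C (i r) (a r) ⊗ₜ[k] cls k C (j r) (b r) := by
  rw [← symb_eq_cls x.2, comul_symb x.2, hx, map_sum]
  refine Finset.sum_congr rfl fun r hr => ?_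
  rw [← hij r hr, symb₂_tmul (a r).2 (b r).2, symb_eq_cls, symb_eq_cls]

end Gr

end Graded

section GradedHopfAlgebra

variable {k : Type u} {H : Type v} [Field k] [Ring H] [HopfAlgebra k H]

theorem mem_coradical_of_isGroupLikeElem {g : H} (hg : IsGroupLikeElem k g) :
    g ∈ coradical k H := by
  refine (le_sSup ?_ : Submodule.span k {g} ≤ coradical k H) (Submodule.mem_span_singleton_self g)
  refine ⟨fun x hx => ?_, ?_, fun E hE _ => ?_⟩
  · obtain ⟨c, rfl⟩ := Submodule.mem_span_singleton.1 hx
    rw [map_smul, hg.comul_eq_tmul_self]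
    exact Submodule.smul_mem _ _ (tmul_mem_tens (Submodule.mem_span_singleton_self g)
      (Submodule.mem_span_singleton_self g))
  · rw [Ne, Submodule.span_singleton_eq_bot]
    exact hg.ne_zero
  · rcases eq_or_ne E ⊥ with h | h
    · exact Or.inl h
    · obtain ⟨x, hx, hx0⟩ := E.exists_mem_ne_zero_of_ne_bot h
      obtain ⟨c, rfl⟩ := Submodule.mem_span_singleton.1 (hE hx)
      have hc : c ≠ 0 := by rintro rfl; simp at hx0
      refine Or.inr (le_antisymm hE ((Submodule.span_singleton_le_iff_mem g E).2 ?_))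
      simpa [smul_smul, hc] using E.smul_mem c⁻¹ hx

theorem coradical_eq_span [IsPointed k H] :
    coradical k H = Submodule.span k {g | IsGroupLikeElem k g} := by
  refine le_antisymm (sSup_le fun D hD => ?_)
    (Submodule.span_le.2 fun g hg => mem_coradical_of_isGroupLikeElem hg)
  obtain ⟨⟨x, hx⟩, hx0, hspan⟩ := finrank_eq_one_iff'.1 (IsPointed.finrank_eq_one D hD)
  have hx0' : x ≠ 0 := fun h => hx0 (Subtype.ext h)
  have hD' : ∀ y ∈ D, ∃ c : k, c • x = y := fun y hy => by
    obtain ⟨c, hc⟩ := hspan ⟨y, hy⟩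
    exact ⟨c, congrArg Subtype.val hc⟩
  have h1 : tens k D D ≤ Submodule.span k {x ⊗ₜ[k] x} := tens_le fun a ha b hb => by
    obtain ⟨c, rfl⟩ := hD' a ha
    obtain ⟨d, rfl⟩ := hD' b hb
    rw [TensorProduct.smul_tmul_smul]
    exact Submodule.smul_mem _ _ (Submodule.mem_span_singleton_self _)
  obtain ⟨c, hc⟩ := Submodule.mem_span_singleton.1 (h1 (hD.1 x hx))
  have h2 : (c * counit (R := k) x) • x = x := by
    have := congrArg (TensorProduct.lid k H) (rTensor_counit_comul (R := k) x)
    rw [← hc] at this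
    simpa [smul_smul] using this
  have h3 : c * counit (R := k) x = 1 := by
    by_contra h
    have : (c * counit (R := k) x - 1) • x = 0 := by rw [sub_smul, h2, one_smul, sub_self]
    rcases smul_eq_zero.1 this with h' | h'
    · exact h (sub_eq_zero.1 h')
    · exact hx0' h'
  have hc0 : c ≠ 0 := by rintro rfl; simp at h3
  have hg : IsGroupLikeElem k (c • x) :=
    ⟨by rw [map_smul, smul_eq_mul, h3],
      by rw [map_smul, ← hc, TensorProduct.smul_tmul_smul, smul_smul]⟩
  intro y hy
  obtain ⟨d, rfl⟩ := hD' y hy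
  have : d • x = (d * c⁻¹) • (c • x) := by rw [smul_smul, mul_assoc, inv_mul_cancel₀ hc0, mul_one]
  rw [this]
  exact Submodule.smul_mem _ _ (Submodule.subset_span hg)

theorem one_mem_coradical : (1 : H) ∈ coradical k H :=
  mem_coradical_of_isGroupLikeElem IsGroupLikeElem.one

theorem mul_mem_coradical [IsPointed k H] {x y : H} (hx : x ∈ coradical k H)
    (hy : y ∈ coradical k H) : x * y ∈ coradical k H := by
  rw [coradical_eq_span] at hx hy
  induction hx, hy using Submodule.span_induction₂ with
  | mem_mem x y hx hy => exact mem_coradical_of_isGroupLikeElem (hx.mul hy)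
  | zero_left y hy => rw [zero_mul]; exact zero_mem _
  | zero_right x hx => rw [mul_zero]; exact zero_mem _
  | add_left x y z hx hy hz h1 h2 => rw [add_mul]; exact add_mem h1 h2
  | add_right x y z hx hy hz h1 h2 => rw [mul_add]; exact add_mem h1 h2
  | smul_left r x y hx hy h => rw [smul_mul_assoc]; exact Submodule.smul_mem _ _ h
  | smul_right r x y hx hy h => rw [mul_smul_comm]; exact Submodule.smul_mem _ _ h

theorem antipode_mem_coradical [IsPointed k H] {x : H} (hx : x ∈ coradical k H) :
    HopfAlgebra.antipode k x ∈ coradical k H := by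
  rw [coradical_eq_span] at hx
  induction hx using Submodule.span_induction with
  | mem x hx => exact mem_coradical_of_isGroupLikeElem hx.antipode
  | zero => rw [map_zero]; exact zero_mem _
  | add x y hx hy h1 h2 => rw [map_add]; exact add_mem h1 h2
  | smul r x hx h => rw [map_smul]; exact Submodule.smul_mem _ _ h

theorem antipode_mul_comul (b : H) :
    TensorProduct.lift ((LinearMap.mul k (H ⊗[k] H)).compl₁₂
      ((TensorProduct.mk k H H).flip 1 ∘ₗ HopfAlgebra.antipode k) (comul (R := k)))
      (comul (R := k) b) = 1 ⊗ₜ[k] b := by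
  let U : (H ⊗[k] H) ⊗[k] H →ₗ[k] H ⊗[k] H :=
    (LinearMap.mul' k H ∘ₗ (HopfAlgebra.antipode k).rTensor H).rTensor H
  have h1 : TensorProduct.lift ((LinearMap.mul k (H ⊗[k] H)).compl₁₂
      ((TensorProduct.mk k H H).flip 1 ∘ₗ HopfAlgebra.antipode k) (comul (R := k))) =
      U ∘ₗ (TensorProduct.assoc k H H H).symm.toLinearMap ∘ₗ (comul (R := k)).lTensor H := by
    refine TensorProduct.ext' fun p q => ?_
    simp only [TensorProduct.lift.tmul, LinearMap.compl₁₂_apply, LinearMap.comp_apply,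
      LinearMap.flip_apply, TensorProduct.mk_apply, LinearMap.mul_apply', LinearMap.lTensor_tmul,
      LinearEquiv.coe_coe]
    induction comul (R := k) q with
    | zero => simp
    | add x y hx hy => rw [mul_add, hx, hy, TensorProduct.tmul_add, map_add, map_add]
    | tmul x y => simp [U]
  have h2 : U ∘ₗ (comul (R := k)).rTensor H =
      (Algebra.linearMap k H).rTensor H ∘ₗ (counit (R := k)).rTensor H := by
    refine TensorProduct.ext' fun p q => ?_
    simp only [U, LinearMap.comp_apply, LinearMap.rTensor_tmul,
      HopfAlgebra.mul_antipode_rTensor_comul_apply, Algebra.linearMap_apply]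
  rw [h1]
  simp only [LinearMap.comp_apply, LinearEquiv.coe_coe, coassoc_symm_apply]
  have h3 := LinearMap.congr_fun h2 (comul (R := k) b)
  simp only [LinearMap.comp_apply] at h3
  rw [h3, rTensor_counit_comul, LinearMap.rTensor_tmul, Algebra.linearMap_apply, map_one]

/-- The antipode is an anti-coalgebra map. -/
theorem comul_antipode (x : H) : comul (R := k) (HopfAlgebra.antipode k x) =
    TensorProduct.map (HopfAlgebra.antipode k) (HopfAlgebra.antipode k)
      (TensorProduct.comm k H H (comul (R := k) x)) := by
  let G : H →ₗ[k] H ⊗[k] H := TensorProduct.map (HopfAlgebra.antipode k) (HopfAlgebra.antipode k) ∘ₗ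
    (TensorProduct.comm k H H).toLinearMap ∘ₗ comul (R := k)
  let T : H ⊗[k] (H ⊗[k] H) →ₗ[k] H ⊗[k] H := TensorProduct.lift
    ((LinearMap.mul k (H ⊗[k] H)).compl₁₂ (TensorProduct.mk k H H 1 ∘ₗ HopfAlgebra.antipode k)
      (TensorProduct.lift ((LinearMap.mul k (H ⊗[k] H)).compl₁₂
      ((TensorProduct.mk k H H).flip 1 ∘ₗ HopfAlgebra.antipode k) (comul (R := k)))))
  have hG : WithConv.toConv G * WithConv.toConv (comul (R := k) : H →ₗ[k] H ⊗[k] H) = 1 := by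
    refine WithConv.ext (LinearMap.ext fun y => ?_)
    change LinearMap.mul' k (H ⊗[k] H) (TensorProduct.map G (comul (R := k)) (comul (R := k) y)) =
      algebraMap k (H ⊗[k] H) (counit (R := k) y)
    have h1 : LinearMap.mul' k (H ⊗[k] H) ∘ₗ TensorProduct.map G (comul (R := k)) =
        T ∘ₗ (TensorProduct.assoc k H H H).toLinearMap ∘ₗ (comul (R := k)).rTensor H := by
      refine TensorProduct.ext' fun p q => ?_
      simp only [LinearMap.comp_apply, TensorProduct.map_tmul, LinearMap.mul'_apply, G,
        LinearEquiv.coe_coe, LinearMap.rTensor_tmul]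
      induction comul (R := k) p with
      | zero => simp
      | add x y hx hy => simp only [map_add, add_mul, hx, hy, TensorProduct.add_tmul]
      | tmul x y =>
        simp [T, ← mul_assoc]
    have h2 : T ∘ₗ (comul (R := k)).lTensor H = TensorProduct.mk k H H 1 ∘ₗ
        LinearMap.mul' k H ∘ₗ (HopfAlgebra.antipode k).rTensor H := by
      refine TensorProduct.ext' fun p q => ?_
      simp only [T, LinearMap.comp_apply, LinearMap.lTensor_tmul, TensorProduct.lift.tmul,
        LinearMap.compl₁₂_apply, antipode_mul_comul]
      simp
    have h3 := LinearMap.congr_fun h1 (comul (R := k) y)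
    have h4 := LinearMap.congr_fun h2 (comul (R := k) y)
    simp only [LinearMap.comp_apply, LinearEquiv.coe_coe, coassoc_apply] at h3 h4
    rw [h3, h4, HopfAlgebra.mul_antipode_rTensor_comul_apply, TensorProduct.mk_apply,
      Algebra.algebraMap_eq_smul_one, Algebra.algebraMap_eq_smul_one,
      TensorProduct.tmul_smul, Algebra.TensorProduct.one_def]
  have h := left_inv_eq_right_inv hG LinearMap.comul_right_inv
  exact (LinearMap.congr_fun (congrArg WithConv.ofConv h) x).symm

theorem mul_mem_coradFiltration [IsPointed k H] {m n : ℕ} {x y : H}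
    (hx : x ∈ coradFiltration k H m) (hy : y ∈ coradFiltration k H n) :
    x * y ∈ coradFiltration k H (m + n) := by
  induction hN : m + n using Nat.strong_induction_on generalizing m n x y with
  | _ N ih =>
    subst hN
    change x * y ∈ coradBelow k H (m + n + 1)
    rw [add_comm, coradBelow_add, mem_wedge, Bialgebra.comul_mul]
    have aux : ∀ (r : ℕ) (z : H), z ∈ coradFiltration k H r → comul (R := k) z ∈
        tens k (coradBelow k H 1) (coradFiltration k H r) ⊔ tens k ⊤ (coradBelow k H r) := by
      intro r z hz
      refine tens_modular (coradBelow_le_succ r) ⟨?_, comul_mem_right hz⟩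
      exact comul_mem_sup (by rw [add_comm]; exact hz)
    have below : ∀ (r s : ℕ) (a b : H), a ∈ coradBelow k H r → b ∈ coradFiltration k H s →
        r + s ≤ m + n → a * b ∈ coradBelow k H (m + n) := by
      rintro (_ | r) s a b ha hb hrs
      · obtain rfl : a = 0 := ha
        rw [zero_mul]; exact zero_mem _
      · exact coradBelow_mono (show r + s + 1 ≤ m + n by omega)
          (ih (r + s) (by omega) ha hb rfl)
    have below' : ∀ (r s : ℕ) (a b : H), a ∈ coradFiltration k H r → b ∈ coradBelow k H s →
        r + s ≤ m + n → a * b ∈ coradBelow k H (m + n) := by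
      rintro r (_ | s) a b ha hb hrs
      · obtain rfl : b = 0 := hb
        rw [mul_zero]; exact zero_mem _
      · exact coradBelow_mono (show r + s + 1 ≤ m + n by omega)
          (ih (r + s) (by omega) ha hb rfl)
    obtain ⟨u, hu, v, hv, huv⟩ := Submodule.mem_sup.1 (aux m x hx)
    obtain ⟨u', hu', v', hv', huv'⟩ := Submodule.mem_sup.1 (aux n y hy)
    have tmul : ∀ {A B A' B' P Q : Submodule k H}, (∀ a ∈ A, ∀ a' ∈ A', a * a' ∈ P) →
        (∀ b ∈ B, ∀ b' ∈ B', b * b' ∈ Q) → ∀ z ∈ tens k A B, ∀ z' ∈ tens k A' B',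
        z * z' ∈ tens k P Q := by
      intro A B A' B' P Q h1 h2 z hz z' hz'
      have e : tens k A B ≤ (tens k P Q).comap
          ((LinearMap.mul k (H ⊗[k] H)).flip z') := tens_le fun a ha b hb => by
        have e' : tens k A' B' ≤ (tens k P Q).comap (LinearMap.mul k (H ⊗[k] H) (a ⊗ₜ[k] b)) :=
          tens_le fun a' ha' b' hb' => by
            rw [Submodule.mem_comap, LinearMap.mul_apply', Algebra.TensorProduct.tmul_mul_tmul]
            exact tmul_mem_tens (h1 a ha a' ha') (h2 b hb b' hb')
        exact e' hz'
      exact e hz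
    rw [← huv, ← huv', add_mul, mul_add, mul_add]
    refine add_mem (add_mem (Submodule.mem_sup_left ?_) (Submodule.mem_sup_right ?_))
      (add_mem (Submodule.mem_sup_right ?_) (Submodule.mem_sup_right ?_))
    · exact tmul (fun a ha a' ha' => mul_mem_coradical ha ha') (fun _ _ _ _ => Submodule.mem_top)
        u hu u' hu'
    · exact tmul (fun _ _ _ _ => Submodule.mem_top) (fun b hb b' hb' => below' m n b b' hb hb' le_rfl)
        u hu v' hv'
    · exact tmul (fun _ _ _ _ => Submodule.mem_top) (fun b hb b' hb' => below m n b b' hb hb' le_rfl)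
        v hv u' hu'
    · exact tmul (fun _ _ _ _ => Submodule.mem_top) (fun b hb b' hb' =>
        below m n b b' hb (coradBelow_le_succ n hb') le_rfl) v hv v' hv'

theorem antipode_mem_coradFiltration [IsPointed k H] {n : ℕ} {x : H}
    (hx : x ∈ coradFiltration k H n) : HopfAlgebra.antipode k x ∈ coradFiltration k H n := by
  induction n generalizing x with
  | zero => exact antipode_mem_coradical hx
  | succ n ih =>
    change _ ∈ coradBelow k H (n + 1 + 1)
    rw [coradBelow_succ, mem_wedge, comul_antipode]
    have h1 : comul (R := k) x ∈ tens k (coradBelow k H (n + 1)) ⊤ ⊔ tens k ⊤ (coradBelow k H 1) :=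
      comul_mem_sup hx
    have h2 : tens k (coradBelow k H (n + 1)) ⊤ ⊔ tens k ⊤ (coradBelow k H 1) ≤
        (tens k (coradBelow k H 1) ⊤ ⊔ tens k ⊤ (coradBelow k H (n + 1))).comap
          (TensorProduct.map (HopfAlgebra.antipode k) (HopfAlgebra.antipode k) ∘ₗ
            (TensorProduct.comm k H H).toLinearMap) := by
      refine sup_le (tens_le fun a ha b _ => ?_) (tens_le fun a _ b hb => ?_)
      · exact Submodule.mem_sup_right (tmul_mem_tens Submodule.mem_top (ih ha))
      · exact Submodule.mem_sup_left (tmul_mem_tens (antipode_mem_coradical hb) Submodule.mem_top)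
    exact h2 h1

namespace Gr

variable (k H) in
/-- Multiplication by a class from the right: `[y] ↦ (x ↦ [x y])`. -/
noncomputable def mulAux [IsPointed k H] (m : ℕ) :
    Gr k H →ₗ[k] ↥(coradFiltration k H m) →ₗ[k] Gr k H :=
  lift (fun n => (((LinearMap.mul k H).compr₂ (symb k H (m + n))).flip.domRestrict₁₂
    (coradFiltration k H n) (coradFiltration k H m))) <| by
    rintro (_ | n) ⟨y, hy'⟩ hy
    · obtain rfl : y = 0 := hy
      exact LinearMap.ext fun x => symb_eq_zero (x := x.1 * 0) (by rw [mul_zero]; exact zero_mem _)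
    · exact LinearMap.ext fun x =>
        symb_eq_zero (mul_mem_coradFiltration x.2 (show y ∈ coradFiltration k H n from hy))

theorem mulAux_symb [IsPointed k H] {m n : ℕ} {x y : H} (hx : x ∈ coradFiltration k H m)
    (hy : y ∈ coradFiltration k H n) :
    mulAux k H m (symb k H n y) ⟨x, hx⟩ = symb k H (m + n) (x * y) := by
  have h : mulAux k H m (symb k H n y) = _ := lift_symb _ _ hy
  rw [h]
  rfl

variable (k H) in
/-- The multiplication `[x] [y] = [x y]` of `gr H`. -/
noncomputable def mulMap [IsPointed k H] : Gr k H →ₗ[k] Gr k H →ₗ[k] Gr k H :=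
  lift (fun m => (mulAux k H m).flip) <| by
    rintro (_ | m) ⟨x, hx'⟩ hx
    · obtain rfl : x = 0 := hx
      exact map_zero _
    · refine hom_ext fun n y hy => (mulAux_symb (m := m + 1) (x := x) hx' hy).trans ?_
      rw [LinearMap.zero_apply]
      refine symb_eq_zero ?_
      rw [add_right_comm]
      exact mul_mem_coradFiltration (show x ∈ coradFiltration k H m from hx) hy

theorem mulMap_symb [IsPointed k H] {m n : ℕ} {x y : H} (hx : x ∈ coradFiltration k H m)
    (hy : y ∈ coradFiltration k H n) :
    mulMap k H (symb k H m x) (symb k H n y) = symb k H (m + n) (x * y) := by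
  have h : mulMap k H (symb k H m x) = (mulAux k H m).flip ⟨x, hx⟩ := lift_symb _ _ hx
  rw [h]
  exact mulAux_symb hx hy

theorem hom_ext₂ {M : Type*} [AddCommGroup M] [Module k M] {f g : Gr k H →ₗ[k] Gr k H →ₗ[k] M}
    (h : ∀ m, ∀ x ∈ coradFiltration k H m, ∀ n, ∀ y ∈ coradFiltration k H n,
      f (symb k H m x) (symb k H n y) = g (symb k H m x) (symb k H n y)) : f = g :=
  hom_ext fun m x hx => hom_ext fun n y hy => h m x hx n y hy

variable [IsPointed k H]

noncomputable instance : Ring (Gr k H) where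
  __ := (inferInstance : AddCommGroup (Gr k H))
  mul x y := mulMap k H x y
  one := symb k H 0 1
  one_mul x := by
    have : mulMap k H (symb k H 0 1) = LinearMap.id := hom_ext fun n x hx => by
      rw [mulMap_symb (one_mem_coradical) hx, one_mul, zero_add, LinearMap.id_apply]
    exact LinearMap.congr_fun this x
  mul_one x := by
    have : (mulMap k H).flip (symb k H 0 1) = LinearMap.id := hom_ext fun n x hx => by
      rw [LinearMap.flip_apply, mulMap_symb hx (one_mem_coradical), mul_one, add_zero,
        LinearMap.id_apply]
    exact LinearMap.congr_fun this x
  mul_assoc x y z := by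
    have : (mulMap k H).compr₂ (mulMap k H) =
        ((LinearMap.llcomp k (Gr k H) (Gr k H) (Gr k H)) ∘ₗ mulMap k H).compl₂ (mulMap k H) :=
      hom_ext₂ fun m x hx n y hy => hom_ext fun p z hz => by
        simp only [LinearMap.compr₂_apply, LinearMap.compl₂_apply, LinearMap.comp_apply,
          LinearMap.llcomp_apply]
        rw [mulMap_symb hx hy, mulMap_symb hy hz, mulMap_symb (mul_mem_coradFiltration hx hy) hz,
          mulMap_symb hx (mul_mem_coradFiltration hy hz), mul_assoc, add_assoc]
    exact LinearMap.congr_fun (LinearMap.congr_fun₂ this x y) z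
  zero_mul x := LinearMap.map_zero₂ (mulMap k H) x
  mul_zero x := (mulMap k H x).map_zero
  left_distrib x y z := (mulMap k H x).map_add y z
  right_distrib x y z := LinearMap.map_add₂ (mulMap k H) x y z

noncomputable instance : Algebra k (Gr k H) :=
  Algebra.ofModule (fun r x y => LinearMap.map_smul₂ (mulMap k H) r x y)
    (fun r x y => (mulMap k H x).map_smul r y)

theorem one_eq_symb : (1 : Gr k H) = symb k H 0 1 := rfl

theorem symb_mul_symb {m n : ℕ} {x y : H} (hx : x ∈ coradFiltration k H m)
    (hy : y ∈ coradFiltration k H n) :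
    symb k H m x * symb k H n y = symb k H (m + n) (x * y) := mulMap_symb hx hy

/-- The product of `gr H`, on classes: `[x] [y] = [x y]`. -/
theorem cls_mul_cls {m n : ℕ} (x : ↥(coradFiltration k H m)) (y : ↥(coradFiltration k H n)) :
    cls k H m x * cls k H n y =
      cls k H (m + n) ⟨x.1 * y.1, mul_mem_coradFiltration x.2 y.2⟩ := by
  rw [← symb_eq_cls x.2, ← symb_eq_cls y.2, symb_mul_symb x.2 y.2, symb_eq_cls]

theorem symb₂_mul {m n : ℕ} {z w : H ⊗[k] H} (hz : z ∈ tensFiltration k H m)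
    (hw : w ∈ tensFiltration k H n) :
    symb₂ k H (m + n) (z * w) = symb₂ k H m z * symb₂ k H n w := by
  refine tensFiltration_ext (f := symb₂ k H (m + n) ∘ₗ (LinearMap.mul k (H ⊗[k] H)).flip w)
    (g := (LinearMap.mul k (Gr k H ⊗[k] Gr k H)).flip (symb₂ k H n w) ∘ₗ symb₂ k H m)
    (fun i j hij a ha b hb => ?_) hz
  refine tensFiltration_ext (f := symb₂ k H (m + n) ∘ₗ LinearMap.mul k (H ⊗[k] H) (a ⊗ₜ[k] b))
    (g := LinearMap.mul k (Gr k H ⊗[k] Gr k H) (symb₂ k H m (a ⊗ₜ[k] b)) ∘ₗ symb₂ k H n)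
    (fun i' j' hij' a' ha' b' hb' => ?_) hw
  subst hij hij'
  simp only [LinearMap.comp_apply, LinearMap.mul_apply', symb₂_tmul ha hb, symb₂_tmul ha' hb',
    Algebra.TensorProduct.tmul_mul_tmul, symb_mul_symb ha ha', symb_mul_symb hb hb']
  rw [add_add_add_comm, symb₂_tmul (mul_mem_coradFiltration ha ha') (mul_mem_coradFiltration hb hb')]

noncomputable instance : Bialgebra k (Gr k H) :=
  Bialgebra.mk' k (Gr k H)
    (by rw [one_eq_symb, counit_symb_zero one_mem_coradical, Bialgebra.counit_one])
    (by
      intro a b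
      have : (LinearMap.mul k (Gr k H)).compr₂ (counit (R := k)) =
          (LinearMap.mul k k).compl₁₂ (counit (R := k)) (counit (R := k)) :=
        hom_ext₂ fun m x hx n y hy => by
          simp only [LinearMap.compr₂_apply, LinearMap.compl₁₂_apply, LinearMap.mul_apply']
          rw [symb_mul_symb hx hy]
          rcases Nat.eq_zero_or_pos m with rfl | hm
          · rcases Nat.eq_zero_or_pos n with rfl | hn
            · rw [counit_symb_zero hx, counit_symb_zero hy,
                counit_symb_zero (mul_mem_coradFiltration hx hy), Bialgebra.counit_mul]
            · rw [counit_symb_pos hn.ne' hy, mul_zero,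
                counit_symb_pos (by omega) (mul_mem_coradFiltration hx hy)]
          · rw [counit_symb_pos hm.ne' hx, zero_mul,
              counit_symb_pos (by omega) (mul_mem_coradFiltration hx hy)]
      exact LinearMap.congr_fun₂ this a b)
    (by
      rw [one_eq_symb, comul_symb one_mem_coradical, Bialgebra.comul_one,
        Algebra.TensorProduct.one_def]
      exact symb₂_tmul (i := 0) (j := 0) one_mem_coradical one_mem_coradical)
    (by
      intro a b
      have : (LinearMap.mul k (Gr k H)).compr₂ (comul (R := k)) =
          (LinearMap.mul k (Gr k H ⊗[k] Gr k H)).compl₁₂ (comul (R := k)) (comul (R := k)) :=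
        hom_ext₂ fun m x hx n y hy => by
          simp only [LinearMap.compr₂_apply, LinearMap.compl₁₂_apply, LinearMap.mul_apply']
          rw [symb_mul_symb hx hy, comul_symb hx, comul_symb hy,
            comul_symb (mul_mem_coradFiltration hx hy), Bialgebra.comul_mul,
            symb₂_mul (comul_mem_tensFiltration hx) (comul_mem_tensFiltration hy)]
      exact LinearMap.congr_fun₂ this a b)

variable (k H) in
/-- The antipode `[x] ↦ [S(x)]` of `gr H`. -/
noncomputable def antipodeMap : Gr k H →ₗ[k] Gr k H :=
  lift (fun n => symb k H n ∘ₗ HopfAlgebra.antipode k ∘ₗ (coradFiltration k H n).subtype) <| by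
    rintro (_ | n) ⟨x, hx'⟩ hx
    · obtain rfl : x = 0 := hx
      simp
    · exact symb_eq_zero (n := n + 1)
        (antipode_mem_coradFiltration (show x ∈ coradFiltration k H n from hx))

theorem antipodeMap_symb {n : ℕ} {x : H} (hx : x ∈ coradFiltration k H n) :
    antipodeMap k H (symb k H n x) = symb k H n (HopfAlgebra.antipode k x) :=
  lift_symb _ _ hx

theorem symb_algebraMap_counit {n : ℕ} {x : H} (hx : x ∈ coradFiltration k H n) :
    symb k H n (algebraMap k H (counit x)) =
      algebraMap k (Gr k H) (counit (R := k) (symb k H n x)) := by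
  rcases Nat.eq_zero_or_pos n with rfl | hn
  · rw [counit_symb_zero hx, Algebra.algebraMap_eq_smul_one, Algebra.algebraMap_eq_smul_one,
      map_smul, one_eq_symb]
  · rw [counit_symb_pos hn.ne' hx, map_zero, Algebra.algebraMap_eq_smul_one, map_smul,
      symb_eq_zero_of_lt one_mem_coradical hn, smul_zero]

/-- The Hopf algebra `gr H` of a pointed Hopf algebra `H`. -/
noncomputable instance : HopfAlgebra k (Gr k H) where
  antipode := antipodeMap k H
  mul_antipode_rTensor_comul := hom_ext fun n x hx => by
    have h1 : LinearMap.mul' k (Gr k H) ((antipodeMap k H).rTensor (Gr k H)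
        (symb₂ k H n (comul (R := k) x))) = symb k H n (LinearMap.mul' k H
          ((HopfAlgebra.antipode k).rTensor H (comul (R := k) x))) := by
      refine tensFiltration_ext
        (f := LinearMap.mul' k (Gr k H) ∘ₗ (antipodeMap k H).rTensor (Gr k H) ∘ₗ symb₂ k H n)
        (g := symb k H n ∘ₗ LinearMap.mul' k H ∘ₗ (HopfAlgebra.antipode k).rTensor H)
        (fun i j hij a ha b hb => ?_) (comul_mem_tensFiltration hx)
      subst hij
      simp only [LinearMap.comp_apply, symb₂_tmul ha hb, LinearMap.rTensor_tmul,
        LinearMap.mul'_apply, antipodeMap_symb ha]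
      exact symb_mul_symb (antipode_mem_coradFiltration ha) hb
    simp only [LinearMap.comp_apply, comul_symb hx]
    rw [h1, HopfAlgebra.mul_antipode_rTensor_comul_apply, symb_algebraMap_counit hx]
    rfl
  mul_antipode_lTensor_comul := hom_ext fun n x hx => by
    have h1 : LinearMap.mul' k (Gr k H) ((antipodeMap k H).lTensor (Gr k H)
        (symb₂ k H n (comul (R := k) x))) = symb k H n (LinearMap.mul' k H
          ((HopfAlgebra.antipode k).lTensor H (comul (R := k) x))) := by
      refine tensFiltration_ext
        (f := LinearMap.mul' k (Gr k H) ∘ₗ (antipodeMap k H).lTensor (Gr k H) ∘ₗ symb₂ k H n)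
        (g := symb k H n ∘ₗ LinearMap.mul' k H ∘ₗ (HopfAlgebra.antipode k).lTensor H)
        (fun i j hij a ha b hb => ?_) (comul_mem_tensFiltration hx)
      subst hij
      simp only [LinearMap.comp_apply, symb₂_tmul ha hb, LinearMap.lTensor_tmul,
        LinearMap.mul'_apply, antipodeMap_symb hb]
      exact symb_mul_symb ha (antipode_mem_coradFiltration hb)
    simp only [LinearMap.comp_apply, comul_symb hx]
    rw [h1, HopfAlgebra.mul_antipode_lTensor_comul_apply, symb_algebraMap_counit hx]
    rfl

end Gr

end GradedHopfAlgebra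

section Statement

namespace Gr

variable (k : Type u) {H : Type v} [Field k] [Ring H] [HopfAlgebra k H]

/-- The projection of `gr H` onto its component of degree `0`, which is `H₀ / 0 = H₀ ⊆ H`. -/
noncomputable def degreeZero : Gr k H →ₗ[k] H :=
  lift (fun n => if n = 0 then (coradFiltration k H n).subtype else 0) <| by
    rintro (_ | n) ⟨x, hx'⟩ hx
    · exact hx
    · simp

variable {k}

/-- The form `gr R` on `gr H`: it equals `R` on `H₀ ⊗ H₀`, and vanishes on pairs of homogeneous
elements one of which has positive degree. -/
noncomputable def grForm (R : H ⊗[k] H →ₗ[k] k) : Gr k H ⊗[k] Gr k H →ₗ[k] k :=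
  R ∘ₗ TensorProduct.map (degreeZero k) (degreeZero k)

theorem grForm_cls_zero (R : H ⊗[k] H →ₗ[k] k) (x y : ↥(coradFiltration k H 0)) :
    grForm R (cls k H 0 x ⊗ₜ[k] cls k H 0 y) = R (x.1 ⊗ₜ[k] y.1) := by
  rw [← symb_eq_cls x.2, ← symb_eq_cls y.2]
  have h : ∀ x (hx : x ∈ coradFiltration k H 0), degreeZero k (symb k H 0 x) = x :=
    fun x hx => (lift_symb _ _ hx).trans (by simp)
  simp only [grForm, LinearMap.comp_apply, TensorProduct.map_tmul, h _ x.2, h _ y.2]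

theorem grForm_cls_of_ne (R : H ⊗[k] H →ₗ[k] k) {m n : ℕ} (h : m ≠ 0 ∨ n ≠ 0)
    (x : ↥(coradFiltration k H m)) (y : ↥(coradFiltration k H n)) :
    grForm R (cls k H m x ⊗ₜ[k] cls k H n y) = 0 := by
  rw [← symb_eq_cls x.2, ← symb_eq_cls y.2]
  have h' : ∀ n x, n ≠ 0 → x ∈ coradFiltration k H n → degreeZero k (symb k H n x) = 0 :=
    fun n x hn hx => (lift_symb _ _ hx).trans (by simp [hn])
  rcases h with h | h
  · simp [grForm, h' m x.1 h x.2]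
  · simp [grForm, h' n y.1 h y.2]

end Gr

namespace GradedHopfStructure

variable {k : Type u} {V : Type v} [Field k] [Quiver.{w} V] (S : GradedHopfStructure k V)

/-- The vertices of `Q` are group-like elements of `kQ`; the group `GroupLike k S.Carrier` is
the set of vertices with the group structure given by the multiplication of `S`. -/
noncomputable def vertexGroupLike (a : V) : GroupLike k S.Carrier :=
  ⟨PathCoalgebra.vertex k a, PathCoalgebra.isGroupLikeElem_vertex a⟩

/-- The trivial extension to `kQ × kQ` of a bicharacter `χ` of the group of vertices, as a bilinear
form: it is `χ` on pairs of vertices, and vanishes on all pairs of paths one of which has positive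
length. -/
noncomputable def trivialExtensionBilin
    (χ : GroupLike k S.Carrier →* GroupLike k S.Carrier →* kˣ) :
    PathCoalgebra k V →ₗ[k] PathCoalgebra k V →ₗ[k] k :=
  (PathCoalgebra.basis k V).constr k fun x => (PathCoalgebra.basis k V).constr k fun y =>
    if x.2.2.length = 0 ∧ y.2.2.length = 0 then
      (χ (S.vertexGroupLike x.1) (S.vertexGroupLike y.1) : k) else 0

/-- The trivial extension of a bicharacter, as a linear form on `kQ ⊗ kQ`. -/
noncomputable def trivialExtension
    (χ : GroupLike k S.Carrier →* GroupLike k S.Carrier →* kˣ) :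
    S.Carrier ⊗[k] S.Carrier →ₗ[k] k :=
  TensorProduct.lift (M := S.Carrier) (N := S.Carrier) (S.trivialExtensionBilin χ)

end GradedHopfStructure

/-- A realization of `(gr H, gr R)` as a large sub coquasitriangular Hopf algebra of some
`(kQ, 𝔑)`: a graded Hopf structure on `kQ` and a bicharacter `χ` of the group of vertices whose
trivial extension `𝔑` is a coquasitriangular structure on `kQ`, together with an
isomorphism of Hopf algebras from `gr H` onto a sub Hopf algebra of `kQ` which contains
`kQ₀ ⊕ kQ₁`, such that `gr R` corresponds to the restriction of `𝔑`. -/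
structure LargeRealization {k : Type u} {H : Type v} [Field k] [Ring H] [HopfAlgebra k H]
    [IsPointed k H] (R : H ⊗[k] H →ₗ[k] k) (V : Type*) [Quiver V] where
  S : GradedHopfStructure k V
  χ : GroupLike k S.Carrier →* GroupLike k S.Carrier →* kˣ
  isCoquasitriangular : IsCoquasitriangular (S.trivialExtension χ)
  /- The isomorphism onto the sub Hopf algebra, viewed as an injective morphism to `kQ`. -/
  emb : Gr k H →ₐc[k] S.Carrier
  injective : Function.Injective emb
  antipode_emb : ∀ x, emb (HopfAlgebra.antipode k x) = HopfAlgebra.antipode k (emb x)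
  large : ∀ n ≤ 1, ∀ x ∈ PathCoalgebra.homogeneous k V n, ∃ y, emb y = (show S.Carrier from x)
  form_emb : ∀ x y : Gr k H,
    S.trivialExtension χ (emb x ⊗ₜ[k] emb y) = Gr.grForm R (x ⊗ₜ[k] y)

/-- The realization respects the gradings of `gr H` and of `kQ`. -/
def LargeRealization.IsGraded {k : Type u} {H : Type v} [Field k] [Ring H] [HopfAlgebra k H]
    [IsPointed k H] {R : H ⊗[k] H →ₗ[k] k} {V : Type*} [Quiver V]
    (E : LargeRealization R V) : Prop :=
  ∀ n, ∀ x ∈ Gr.homogeneous k H n,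
    (show PathCoalgebra k V from E.emb x) ∈ PathCoalgebra.homogeneous k V n

/-- Two quivers are isomorphic. -/
def QuiverIso (V : Type*) [Quiver V] (W : Type*) [Quiver W] : Prop :=
  ∃ e : V ≃ W, ∀ a b : V, Nonempty ((a ⟶ b) ≃ (e a ⟶ e b))

end Statement

end CQT

/-! Write `G` for the group of group-like elements of `H`. At group-like arguments the axioms say
that `G` is commutative and that `R` restricts to a bicharacter `χ` of `G`
(`IsCoquasitriangular.groupLike_mul_comm`, `IsCoquasitriangular.bichar`). As `H` is pointed, degree
zero of `gr H` is spanned by `G`, and degree one is the direct sum of the translates by `g` of the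
spaces of elements `z` with `Δ(z) = z ⊗ 1 + d ⊗ z`, for `g`, `d` in `G`. The commutation axiom with
one group-like argument passes to `gr H` and becomes `h z = χ(d, h) z h` and `z h = χ(h, d) h z`.
Hence `χ(d, h) χ(h, d) = 1` for all `h` as soon as some such `z` is nonzero
(`Gr.bichar_mul_bichar`).

The quiver has vertex set `G` and, for every `g` and every member of a chosen basis of the space of
elements `z` belonging to `d`, one arrow from `g` to `g d`. Its path coalgebra carries a quantum
shuffle product in which an arrow belonging to `d` passes a vertex `h` at the cost `χ(d, h)⁻¹`. Two
facts keep this product under control: the removal of a last arrow is a skew derivation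
(`unsnoc_shuffleMul`), and a coalgebra map into a path coalgebra is determined by the coefficients
of vertices and arrows (`coalgHom_ext`). The antipode is a convolution geometric series. Because of
the symmetry of `χ` on the labels, exchanging two factors multiplies their product by exactly the
scalar in the commutation axiom (`shuffle_comm`), so the trivial extension of `χ` is a
coquasitriangular structure.

The coordinates of `gr H` in degrees zero and one extend to a graded coalgebra map into the path
coalgebra by a universal property (`exists_coalgHom`). It is injective because the component of
bidegree `(1, n)` of the coproduct is injective on degree `n + 1` of `gr H`, a consequence of `C_n =
C_0 ∧ C_{n-1}` (`Gr.symb_eq_zero_of_map_toQuotient`). It is multiplicative because two coalgebra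
maps from `gr H ⊗ gr H` need only be compared in total degree at most one, where both sides are
given by the same bicharacter.

For uniqueness, the vertices of a quiver are the group-like elements of its path coalgebra, and the
arrows from `a` to `b` index a basis of the corresponding skew primitive elements modulo the trivial
ones. Both can be read off from any subcoalgebra which contains the vertices and arrows, hence from
`gr H` alone (`quiverIso_of_large`). -/

namespace CQT

/-! ### Paths of a Cayley type quiver as words, and their coefficients -/

section Words

/-- The vertices of the quiver which has, for every `x : X` and every `g : G`, one arrow
`g ⟶ g * c x`. -/
@[nolint unusedArguments]
structure Cayley {G : Type v} {X : Type w} (c : X → G) : Type v where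
  pt : G

/-- The end point of the path which starts at `g` and runs along the arrows labelled by a list.
The head of the list is the last arrow. -/
def tgt {G : Type v} {X : Type w} [Mul G] (c : X → G) (g : G) : List X → G
  | [] => g
  | x :: l => tgt c g l * c x

variable {G : Type v} {X : Type w} [CommGroup G] {c : X → G}

instance : Quiver (Cayley c) where
  Hom a b := {x : X // a.pt * c x = b.pt}

theorem tgt_mul (g h : G) (l : List X) : tgt c (g * h) l = g * tgt c h l := by
  induction l with
  | nil => rfl
  | cons x l ih => rw [tgt, tgt, ih, mul_assoc]

variable (c) in
/-- The path which starts at `g` and runs along the arrows labelled by a list. -/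
def wordPath (g : G) : ∀ l : List X, Quiver.Path (⟨g⟩ : Cayley c) (⟨tgt c g l⟩ : Cayley c)
  | [] => .nil
  | x :: l => (wordPath g l).cons ⟨x, rfl⟩

/-- The labels of the arrows of a path. -/
def labels {a : Cayley c} : ∀ {b : Cayley c}, Quiver.Path a b → List X
  | _, .nil => []
  | _, .cons p e => e.1 :: labels p

theorem length_labels {a b : Cayley c} (p : Quiver.Path a b) : (labels p).length = p.length := by
  induction p with
  | nil => rfl
  | cons p e ih => rw [labels, List.length_cons, ih, Quiver.Path.length_cons]

theorem length_wordPath (g : G) (l : List X) : (wordPath c g l).length = l.length := by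
  induction l with
  | nil => rfl
  | cons x l ih => rw [wordPath, Quiver.Path.length_cons, ih, List.length_cons]

/-- The end point `tgt c a.pt (labels p)` agrees with `b` only propositionally, so the two paths are
compared in the type of all paths starting at `a`. -/
theorem wordPath_labels {a b : Cayley c} (p : Quiver.Path a b) :
    (⟨⟨tgt c a.pt (labels p)⟩, wordPath c a.pt (labels p)⟩ : Σ b : Cayley c, Quiver.Path a b) =
      ⟨b, p⟩ := by
  induction p with
  | nil => rfl
  | @cons b b' p e ih =>
    obtain ⟨h⟩ := b'
    obtain ⟨x, hx⟩ := e
    dsimp only at hx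
    subst hx
    exact congrArg (fun y : Σ b : Cayley c, Quiver.Path a b =>
      (⟨⟨y.1.pt * c x⟩, y.2.cons ⟨x, rfl⟩⟩ : Σ b : Cayley c, Quiver.Path a b)) ih

theorem labels_wordPath (g : G) (l : List X) : labels (wordPath c g l) = l := by
  induction l with
  | nil => rfl
  | cons x l ih => exact congrArg (x :: ·) ih

variable (c) in
/-- The paths of `Cayley c` correspond to the pairs of a vertex and a list of labels. -/
def pathEquiv : (Σ a b : Cayley c, Quiver.Path a b) ≃ G × List X where
  toFun p := (p.1.pt, labels p.2.2)
  invFun p := ⟨⟨p.1⟩, _, wordPath c p.1 p.2⟩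
  left_inv p := congrArg (fun y => (⟨p.1, y⟩ : Σ a b : Cayley c, Quiver.Path a b))
    (wordPath_labels p.2.2)
  right_inv p := Prod.ext rfl (labels_wordPath p.1 p.2)

variable (k : Type u) [Field k]

variable (c) in
/-- The basis of the path coalgebra of `Cayley c` which consists of all paths. -/
noncomputable def wordBasis : Module.Basis (G × List X) k (PathCoalgebra k (Cayley c)) :=
  (PathCoalgebra.basis k (Cayley c)).reindex (pathEquiv c)

variable (c) in
/-- The path which starts at `g` and runs along the arrows labelled by `l`. -/
noncomputable def word (g : G) (l : List X) : PathCoalgebra k (Cayley c) :=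
  wordBasis c k (g, l)

variable {k}

theorem word_eq_path (g : G) (l : List X) :
    word c k g l = PathCoalgebra.path k (wordPath c g l) :=
  (PathCoalgebra.basis k (Cayley c)).reindex_apply (pathEquiv c) (g, l)

theorem path_eq_word {a b : Cayley c} (p : Quiver.Path a b) :
    PathCoalgebra.path k p = word c k a.pt (labels p) := by
  rw [word_eq_path]
  exact congrArg (fun y : Σ b : Cayley c, Quiver.Path a b => PathCoalgebra.path k y.2)
    (wordPath_labels p).symm

theorem vertex_eq_word (a : Cayley c) : PathCoalgebra.vertex k a = word c k a.pt [] :=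
  path_eq_word _

theorem word_hom_ext {M : Type*} [AddCommGroup M] [Module k M]
    {f f' : PathCoalgebra k (Cayley c) →ₗ[k] M} (h : ∀ g l, f (word c k g l) = f' (word c k g l)) :
    f = f' :=
  (wordBasis c k).ext fun p => h p.1 p.2

/-- The linear map with given values on paths. -/
noncomputable def wordLift {M : Type*} [AddCommGroup M] [Module k M] (f : G → List X → M) :
    PathCoalgebra k (Cayley c) →ₗ[k] M :=
  (wordBasis c k).constr k fun p => f p.1 p.2

@[simp]
theorem wordLift_word {M : Type*} [AddCommGroup M] [Module k M] (f : G → List X → M) (g : G)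
    (l : List X) : wordLift f (word c k g l) = f g l :=
  (wordBasis c k).constr_basis k _ _

variable (c k) in
/-- The operator which appends to every path the arrow labelled by `x`. -/
noncomputable def snoc (x : X) : PathCoalgebra k (Cayley c) →ₗ[k] PathCoalgebra k (Cayley c) :=
  wordLift fun g l => word c k g (x :: l)

@[simp]
theorem snoc_word (x : X) (g : G) (l : List X) :
    snoc c k x (word c k g l) = word c k g (x :: l) := wordLift_word _ _ _

theorem snoc_path {a b b' : Cayley c} (p : Quiver.Path a b) (e : b ⟶ b') :
    snoc c k e.1 (PathCoalgebra.path k p) = PathCoalgebra.path k (p.cons e) := by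
  rw [path_eq_word, snoc_word, path_eq_word, labels]

theorem comul_word_nil (g : G) :
    comul (R := k) (word c k g []) = word c k g [] ⊗ₜ[k] word c k g [] := by
  rw [word_eq_path, PathCoalgebra.comul_path]
  exact add_zero _

/-- A cut of a path is either the cut behind its last arrow, or a cut of the shorter path with the
last arrow put back on the final part, which is the left tensor factor. This recursion replaces
`pathCuts` in the arguments about words. -/
theorem comul_word_cons (g : G) (x : X) (l : List X) :
    comul (R := k) (word c k g (x :: l)) =
      word c k (tgt c g (x :: l)) [] ⊗ₜ[k] word c k g (x :: l) +
        (snoc c k x).rTensor _ (comul (R := k) (word c k g l)) := by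
  rw [word_eq_path, PathCoalgebra.comul_path, wordPath, pathCuts, List.map_cons, List.sum_cons,
    word_eq_path g l, PathCoalgebra.comul_path, map_list_sum, List.map_map, List.map_map]
  congr 1
  · rw [word_eq_path]
    rfl
  · congr 1
    refine List.map_congr_left fun y _ => ?_
    simp only [Function.comp_apply, LinearMap.rTensor_tmul]
    rw [← snoc_path]

theorem counit_word (g : G) (l : List X) :
    counit (R := k) (word c k g l) = if l = [] then 1 else 0 := by
  rw [word_eq_path, PathCoalgebra.counit_path, length_wordPath]
  simp only [List.length_eq_zero_iff]

theorem word_mem_homogeneous (g : G) (l : List X) :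
    word c k g l ∈ PathCoalgebra.homogeneous k (Cayley c) l.length :=
  Submodule.subset_span ⟨_, _, wordPath c g l, length_wordPath _ _, word_eq_path _ _⟩

theorem homogeneous_eq_span (n : ℕ) : PathCoalgebra.homogeneous k (Cayley c) n =
    Submodule.span k {z | ∃ g l, l.length = n ∧ z = word c k g l} := by
  refine le_antisymm (Submodule.span_mono ?_) (Submodule.span_le.2 ?_)
  · rintro _ ⟨a, b, p, rfl, rfl⟩
    exact ⟨a.pt, labels p, length_labels p, path_eq_word p⟩
  · rintro _ ⟨g, l, rfl, rfl⟩
    exact word_mem_homogeneous g l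

theorem homogeneous_le {n : ℕ} {P : Submodule k (PathCoalgebra k (Cayley c))}
    (h : ∀ g l, l.length = n → word c k g l ∈ P) :
    PathCoalgebra.homogeneous k (Cayley c) n ≤ P := by
  rw [homogeneous_eq_span, Submodule.span_le]
  rintro _ ⟨g, l, hl, rfl⟩
  exact h g l hl

theorem homogeneous_ext {M : Type*} [AddCommGroup M] [Module k M] {n : ℕ}
    {f f' : PathCoalgebra k (Cayley c) →ₗ[k] M}
    (h : ∀ g l, l.length = n → f (word c k g l) = f' (word c k g l))
    {z : PathCoalgebra k (Cayley c)} (hz : z ∈ PathCoalgebra.homogeneous k (Cayley c) n) :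
    f z = f' z :=
  homogeneous_le (P := LinearMap.eqLocus f f') h hz

/-- Only the cut at the end of a path has a trivial final part. -/
theorem map_comul_of_left {M N : Type*} [AddCommGroup M] [Module k M] [AddCommGroup N] [Module k N]
    {ζ : PathCoalgebra k (Cayley c) →ₗ[k] M} (hζ : ∀ g x l, ζ (word c k g (x :: l)) = 0)
    (ψ : PathCoalgebra k (Cayley c) →ₗ[k] N) (g : G) (l : List X) :
    TensorProduct.map ζ ψ (comul (R := k) (word c k g l)) =
      ζ (word c k (tgt c g l) []) ⊗ₜ[k] ψ (word c k g l) := by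
  cases l with
  | nil => rw [comul_word_nil]; rfl
  | cons x l =>
    have h : ζ ∘ₗ snoc c k x = 0 := word_hom_ext fun g l => by simp [hζ]
    rw [comul_word_cons, map_add, TensorProduct.map_tmul, LinearMap.rTensor, TensorProduct.map_map,
      h, TensorProduct.map_zero_left, LinearMap.zero_apply, add_zero]

/-- Only the cut at the start of a path has a trivial initial part. -/
theorem map_comul_of_right {M N : Type*} [AddCommGroup M] [Module k M] [AddCommGroup N] [Module k N]
    (ψ : PathCoalgebra k (Cayley c) →ₗ[k] M) {ζ : PathCoalgebra k (Cayley c) →ₗ[k] N}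
    (hζ : ∀ g x l, ζ (word c k g (x :: l)) = 0) (g : G) (l : List X) :
    TensorProduct.map ψ ζ (comul (R := k) (word c k g l)) =
      ψ (word c k g l) ⊗ₜ[k] ζ (word c k g []) := by
  induction l generalizing ψ with
  | nil => rw [comul_word_nil]; rfl
  | cons x l ih =>
    rw [comul_word_cons, map_add, TensorProduct.map_tmul, hζ, TensorProduct.tmul_zero, zero_add,
      LinearMap.rTensor, TensorProduct.map_map, LinearMap.comp_id, ih, LinearMap.comp_apply,
      snoc_word]

variable (c k) in
/-- The coefficient of a path, as an element of the convolution algebra of linear forms. -/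
noncomputable def coef (g : G) (l : List X) : WithConv (PathCoalgebra k (Cayley c) →ₗ[k] k) :=
  WithConv.toConv ((wordBasis c k).coord (g, l))

open Classical in
theorem coef_word (g : G) (l : List X) (h : G) (l' : List X) :
    coef c k g l (word c k h l') = if g = h ∧ l = l' then 1 else 0 := by
  change (wordBasis c k).coord (g, l) (wordBasis c k (h, l')) = _
  rw [Module.Basis.coord_apply, Module.Basis.repr_self, Finsupp.single_apply]
  simp only [Prod.mk.injEq]
  congr 1
  exact propext ⟨fun h => ⟨h.1.symm, h.2.symm⟩, fun h => ⟨h.1.symm, h.2.symm⟩⟩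

theorem eq_of_coef_eq {z z' : PathCoalgebra k (Cayley c)}
    (h : ∀ g l, coef c k g l z = coef c k g l z') : z = z' :=
  (wordBasis c k).ext_elem fun p => h p.1 p.2

/-- A path of positive length has exactly one cut whose final part is its last arrow. So the vertex
and arrow coefficients generate all the others under convolution; this is what makes the path
coalgebra behave like a cofree one. -/
theorem coef_cons (g : G) (x : X) (l : List X) :
    coef c k g (x :: l) = coef c k (tgt c g l) [x] * coef c k g l := by
  classical
  refine WithConv.ext (word_hom_ext fun h l' => ?_)
  change coef c k g (x :: l) (word c k h l') = LinearMap.mul' k k (TensorProduct.map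
    (coef c k (tgt c g l) [x]).ofConv (coef c k g l).ofConv (comul (R := k) (word c k h l')))
  cases l' with
  | nil =>
    rw [comul_word_nil, TensorProduct.map_tmul, LinearMap.mul'_apply]
    change _ = coef c k (tgt c g l) [x] (word c k h []) * _
    simp [coef_word]
  | cons y l' =>
    -- Appending an arrow yields the one-arrow word `[x]` only from a trivial path and for `y = x`.
    have h1 : (coef c k (tgt c g l) [x]).ofConv ∘ₗ snoc c k y =
        if x = y then (coef c k (tgt c g l) []).ofConv else 0 := by
      refine word_hom_ext fun g' l'' => ?_
      change coef c k (tgt c g l) [x] (snoc c k y (word c k g' l'')) = _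
      rw [snoc_word, coef_word]
      split_ifs with h2 h3 h4
      · change 1 = coef c k (tgt c g l) [] (word c k g' l'')
        rw [coef_word, if_pos ⟨h2.1, (List.cons.inj h2.2).2⟩]
      · exact absurd (List.cons.inj h2.2).1 h3
      · change 0 = coef c k (tgt c g l) [] (word c k g' l'')
        rw [coef_word, if_neg]
        rintro ⟨rfl, rfl⟩
        exact h2 ⟨rfl, by rw [h4]⟩
      · rfl
    rw [comul_word_cons, map_add, TensorProduct.map_tmul, LinearMap.rTensor, TensorProduct.map_map,
      LinearMap.comp_id, h1, map_add, LinearMap.mul'_apply]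
    change _ = coef c k (tgt c g l) [x] (word c k _ []) * _ + _
    rw [coef_word (tgt c g l) [x], if_neg (by simp), zero_mul, zero_add]
    split_ifs with hxy
    · subst hxy
      rw [map_comul_of_left (ζ := (coef c k (tgt c g l) []).ofConv)
        (fun g' y l => by
          change coef c k _ [] (word c k g' (y :: l)) = 0
          rw [coef_word, if_neg (by simp)]), LinearMap.mul'_apply]
      change _ = coef c k _ [] (word c k _ []) * coef c k g l (word c k h l')
      simp only [coef_word, List.cons.injEq, true_and, and_true]
      by_cases h' : g = h ∧ l = l'
      · obtain ⟨rfl, rfl⟩ := h'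
        simp
      · simp [h']
    · rw [TensorProduct.map_zero_left, LinearMap.zero_apply, map_zero, coef_word, if_neg]
      rintro ⟨-, h2⟩
      exact hxy (List.cons.inj h2).1

theorem coef_eq_zero {n : ℕ} {z : PathCoalgebra k (Cayley c)}
    (hz : z ∈ PathCoalgebra.homogeneous k (Cayley c) n) {g : G} {l : List X} (hl : l.length ≠ n) :
    coef c k g l z = 0 := by
  refine homogeneous_ext (f := (coef c k g l).ofConv) (f' := 0) (fun h l' hl' => ?_) hz
  classical
  change coef c k g l (word c k h l') = 0
  rw [coef_word, if_neg]
  rintro ⟨-, rfl⟩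
  exact hl hl'

/-- A coalgebra map to the path coalgebra is determined by the coefficients of the paths of length
at most one. -/
theorem coalgHom_ext {C : Type*} [AddCommGroup C] [Module k C] [Coalgebra k C]
    {F F' : C →ₗc[k] PathCoalgebra k (Cayley c)}
    (h : ∀ g l, l.length ≤ 1 →
      (coef c k g l).ofConv ∘ₗ F.toLinearMap = (coef c k g l).ofConv ∘ₗ F'.toLinearMap) : F = F' := by
  have key : ∀ g l,
      (coef c k g l).ofConv ∘ₗ F.toLinearMap = (coef c k g l).ofConv ∘ₗ F'.toLinearMap := by
    intro g l
    induction l with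
    | nil => exact h g [] (by simp)
    | cons x l ih =>
      -- Convolution is compatible with composition with a coalgebra map, so the factorization of
      -- the coefficient reduces the claim to one arrow and a shorter path.
      rw [coef_cons]
      refine (LinearMap.convMul_comp_coalgHom_distrib (coef c k (tgt c g l) [x]) (coef c k g l)
        F).trans (Eq.trans ?_ (LinearMap.convMul_comp_coalgHom_distrib (coef c k (tgt c g l) [x])
        (coef c k g l) F').symm)
      rw [h (tgt c g l) [x] (by simp), ih]
  exact CoalgHom.ext fun y => eq_of_coef_eq fun g l => LinearMap.congr_fun (key g l) y

end Words

/-! ### The quantum shuffle product -/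

section Shuffle

variable {G : Type v} {X : Type w} [CommGroup G] (c : X → G) {k : Type u} [Field k]
  (χ : G →* G →* kˣ)

/-- The product of two paths of `Cayley c`, a quantum shuffle. -/
noncomputable def shuffle (g : G) : List X → G → List X → PathCoalgebra k (Cayley c)
  | [], h, m => word c k (g * h) m
  | x :: l, h, [] => ((χ (c x) h)⁻¹ : kˣ).1 • snoc c k x (shuffle g l h [])
  -- The last arrow of the product comes from one of the two factors. Coming from the left one, it
  -- passes the whole right path, at the cost of the inverse value of `χ` at its label and the end
  -- point of that path; coming from the right one, it passes nothing.
  | x :: l, h, y :: m =>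
    ((χ (c x) (tgt c h (y :: m)))⁻¹ : kˣ).1 • snoc c k x (shuffle g l h (y :: m)) +
      snoc c k y (shuffle g (x :: l) h m)
termination_by l _ m => l.length + m.length

/-- The quantum shuffle product on the path coalgebra of `Cayley c`. -/
noncomputable def shuffleMul : PathCoalgebra k (Cayley c) →ₗ[k] PathCoalgebra k (Cayley c) →ₗ[k]
    PathCoalgebra k (Cayley c) :=
  wordLift fun g l => wordLift fun h m => shuffle c χ g l h m

theorem shuffleMul_word (g : G) (l : List X) (h : G) (m : List X) :
    shuffleMul c χ (word c k g l) (word c k h m) = shuffle c χ g l h m := by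
  rw [shuffleMul, wordLift_word, wordLift_word]

theorem shuffleMul_vertex_word (g h : G) (m : List X) :
    shuffleMul c χ (word c k g []) (word c k h m) = word c k (g * h) m := by
  rw [shuffleMul_word, shuffle]

theorem shuffleMul_word_vertex (g : G) (x : X) (l : List X) (h : G) :
    shuffleMul c χ (word c k g (x :: l)) (word c k h []) =
      ((χ (c x) h)⁻¹ : kˣ).1 • snoc c k x (shuffleMul c χ (word c k g l) (word c k h [])) := by
  rw [shuffleMul_word, shuffle, shuffleMul_word]

theorem shuffleMul_word_word (g : G) (x : X) (l : List X) (h : G) (y : X) (m : List X) :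
    shuffleMul c χ (word c k g (x :: l)) (word c k h (y :: m)) =
      ((χ (c x) (tgt c h (y :: m)))⁻¹ : kˣ).1 •
        snoc c k x (shuffleMul c χ (word c k g l) (word c k h (y :: m))) +
      snoc c k y (shuffleMul c χ (word c k g (x :: l)) (word c k h m)) := by
  rw [shuffleMul_word, shuffle, shuffleMul_word, shuffleMul_word]

theorem snoc_mem_homogeneous {n : ℕ} {z : PathCoalgebra k (Cayley c)}
    (hz : z ∈ PathCoalgebra.homogeneous k (Cayley c) n) (x : X) :
    snoc c k x z ∈ PathCoalgebra.homogeneous k (Cayley c) (n + 1) := by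
  refine homogeneous_le (P := (PathCoalgebra.homogeneous k (Cayley c) (n + 1)).comap (snoc c k x))
    (fun g l hl => ?_) hz
  subst hl
  rw [Submodule.mem_comap, snoc_word]
  exact word_mem_homogeneous g (x :: l)

theorem shuffle_mem_homogeneous (g : G) (l : List X) (h : G) (m : List X) :
    shuffle c χ g l h m ∈ PathCoalgebra.homogeneous k (Cayley c) (l.length + m.length) := by
  fun_induction shuffle c χ g l h m with
  | case1 h m => rw [List.length_nil, zero_add]; exact word_mem_homogeneous _ _
  | case2 x l h ih =>
    rw [List.length_cons, add_right_comm]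
    exact Submodule.smul_mem _ _ (snoc_mem_homogeneous c ih x)
  | case3 x l h y m ih1 ih2 =>
    refine add_mem (Submodule.smul_mem _ _ ?_) ?_
    · rw [List.length_cons, add_right_comm]
      exact snoc_mem_homogeneous c ih1 x
    · exact snoc_mem_homogeneous c ih2 y

theorem shuffleMul_mem_homogeneous {i j : ℕ} {z z' : PathCoalgebra k (Cayley c)}
    (hz : z ∈ PathCoalgebra.homogeneous k (Cayley c) i)
    (hz' : z' ∈ PathCoalgebra.homogeneous k (Cayley c) j) :
    shuffleMul c χ z z' ∈ PathCoalgebra.homogeneous k (Cayley c) (i + j) := by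
  refine homogeneous_le (P := (PathCoalgebra.homogeneous k (Cayley c) (i + j)).comap
    ((shuffleMul c χ).flip z')) (fun g l hl => ?_) hz
  refine homogeneous_le (P := (PathCoalgebra.homogeneous k (Cayley c) (i + j)).comap
    (shuffleMul c χ (word c k g l))) (fun h m hm => ?_) hz'
  subst hl hm
  rw [Submodule.mem_comap, shuffleMul_word]
  exact shuffle_mem_homogeneous c χ g l h m

open Classical in
variable (k) in
/-- The operator which removes the last arrow from the paths whose last arrow has the label `x`,
and which vanishes on the other paths. -/
noncomputable def unsnoc (x : X) : PathCoalgebra k (Cayley c) →ₗ[k] PathCoalgebra k (Cayley c) :=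
  wordLift fun g l => match l with
    | [] => 0
    | y :: l => if x = y then word c k g l else 0

theorem unsnoc_nil (x : X) (g : G) : unsnoc c k x (word c k g []) = 0 := wordLift_word _ _ _

open Classical in
theorem unsnoc_cons (x : X) (g : G) (y : X) (l : List X) :
    unsnoc c k x (word c k g (y :: l)) = if x = y then word c k g l else 0 := wordLift_word _ _ _

open Classical in
theorem unsnoc_snoc (x y : X) (z : PathCoalgebra k (Cayley c)) :
    unsnoc c k x (snoc c k y z) = if x = y then z else 0 := by
  have : unsnoc c k x ∘ₗ snoc c k y = if x = y then LinearMap.id else 0 :=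
    word_hom_ext fun g l => by
      rw [LinearMap.comp_apply, snoc_word, unsnoc_cons]
      split_ifs <;> rfl
  refine (LinearMap.congr_fun this z).trans ?_
  split_ifs <;> rfl

/-- The operator which multiplies a path with end point `h` by `χ (c x, h)⁻¹`. -/
noncomputable def twist (x : X) : PathCoalgebra k (Cayley c) →ₗ[k] PathCoalgebra k (Cayley c) :=
  wordLift fun g l => ((χ (c x) (tgt c g l))⁻¹ : kˣ).1 • word c k g l

theorem twist_word (x : X) (g : G) (l : List X) :
    twist c χ x (word c k g l) = ((χ (c x) (tgt c g l))⁻¹ : kˣ).1 • word c k g l :=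
  wordLift_word _ _ _

theorem twist_snoc (x y : X) (z : PathCoalgebra k (Cayley c)) :
    twist c χ x (snoc c k y z) = ((χ (c x) (c y))⁻¹ : kˣ).1 • snoc c k y (twist c χ x z) := by
  have : twist c χ x ∘ₗ snoc c k y = ((χ (c x) (c y))⁻¹ : kˣ).1 • snoc c k y ∘ₗ twist c χ x :=
    word_hom_ext fun g l => by
      simp only [LinearMap.comp_apply, LinearMap.smul_apply, snoc_word, twist_word, map_smul]
      rw [smul_smul, tgt, map_mul, mul_inv, mul_comm, Units.val_mul]
  exact LinearMap.congr_fun this z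

/-- This is the recursion of the product in the form of a skew Leibniz rule: removing a last arrow
is a derivation twisted by `twist`. The proofs for the coproduct and for associativity work with
this rule. -/
theorem unsnoc_shuffleMul (x : X) (z z' : PathCoalgebra k (Cayley c)) :
    unsnoc c k x (shuffleMul c χ z z') =
      shuffleMul c χ (unsnoc c k x z) (twist c χ x z') + shuffleMul c χ z (unsnoc c k x z') := by
  have : (shuffleMul c χ).compr₂ (unsnoc c k x) =
      (shuffleMul c χ).compl₁₂ (unsnoc c k x) (twist c χ x) +
      (shuffleMul c χ).compl₂ (unsnoc c k x) := by
    refine word_hom_ext fun g l => word_hom_ext fun h m => ?_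
    simp only [LinearMap.compr₂_apply, LinearMap.add_apply, LinearMap.compl₁₂_apply,
      LinearMap.compl₂_apply, twist_word, map_smul]
    cases l with
    | nil =>
      rw [shuffleMul_vertex_word, unsnoc_nil, LinearMap.map_zero₂, smul_zero, zero_add]
      cases m with
      | nil => rw [unsnoc_nil, unsnoc_nil, map_zero]
      | cons y m =>
        rw [unsnoc_cons, unsnoc_cons]
        split_ifs
        · rw [shuffleMul_vertex_word]
        · rw [map_zero]
    | cons y l =>
      cases m with
      | nil =>
        rw [shuffleMul_word_vertex, unsnoc_nil, map_zero, add_zero, map_smul, unsnoc_snoc,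
          unsnoc_cons]
        split_ifs with h
        · subst h; rfl
        · rw [LinearMap.map_zero₂, smul_zero, smul_zero]
      | cons y' m =>
        rw [shuffleMul_word_word, map_add, map_smul, unsnoc_snoc, unsnoc_snoc, unsnoc_cons,
          unsnoc_cons]
        congr 1
        · split_ifs with h
          · subst h; rfl
          · rw [LinearMap.map_zero₂, smul_zero, smul_zero]
        · split_ifs
          · rfl
          · rw [map_zero]
  exact LinearMap.congr_fun₂ this z z'

/-- `twist` depends only on the end point, every term of a product of paths ends at the product of
the end points, and `χ` is multiplicative. So `twist` is an algebra endomorphism. -/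
theorem twist_shuffleMul (x : X) (z z' : PathCoalgebra k (Cayley c)) :
    twist c χ x (shuffleMul c χ z z') = shuffleMul c χ (twist c χ x z) (twist c χ x z') := by
  have : (shuffleMul c χ).compr₂ (twist c χ x) =
      (shuffleMul c χ).compl₁₂ (twist c χ x) (twist c χ x) := by
    refine word_hom_ext fun g l => word_hom_ext fun h m => ?_
    simp only [LinearMap.compr₂_apply, LinearMap.compl₁₂_apply, twist_word, map_smul,
      LinearMap.smul_apply, shuffleMul_word, smul_smul]
    rw [← Units.val_mul, ← mul_inv, ← map_mul]
    fun_induction shuffle c χ g l h m with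
    | case1 h m => rw [twist_word, tgt, tgt_mul, mul_comm]
    | case2 y l h ih =>
      rw [map_smul, twist_snoc, ih, map_smul]
      simp only [smul_smul, tgt, map_mul, mul_inv, Units.val_mul]
      congr 1
      ring
    | case3 y l h y' m ih1 ih2 =>
      rw [map_add, map_smul, twist_snoc, twist_snoc, ih1, ih2, map_smul, map_smul, smul_add]
      simp only [smul_smul, tgt, map_mul, mul_inv, Units.val_mul]
      congr 2 <;> ring
  exact LinearMap.congr_fun₂ this z z'

end Shuffle

/-! ### Naturality of bilinear maps on tensor products -/

section TensorLemmas

variable {k : Type u} [Field k] {M N P M' N' P' : Type*} [AddCommGroup M] [Module k M]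
  [AddCommGroup N] [Module k N] [AddCommGroup P] [Module k P] [AddCommGroup M'] [Module k M']
  [AddCommGroup N'] [Module k N'] [AddCommGroup P'] [Module k P']

theorem bilin_tensor_ext {f f' : M ⊗[k] M' →ₗ[k] N ⊗[k] N' →ₗ[k] P}
    (h : ∀ a a' b b', f (a ⊗ₜ a') (b ⊗ₜ b') = f' (a ⊗ₜ a') (b ⊗ₜ b')) : f = f' :=
  TensorProduct.ext' fun a a' => TensorProduct.ext' fun b b' => h a a' b b'

theorem map_map₂ {P₁ P₁' : Type*} [AddCommGroup P₁] [Module k P₁] [AddCommGroup P₁'] [Module k P₁']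
    (p : M →ₗ[k] N →ₗ[k] P) (q : M' →ₗ[k] N' →ₗ[k] P')
    (f : P →ₗ[k] P₁) (f' : P' →ₗ[k] P₁') (A : M ⊗[k] M') (B : N ⊗[k] N') :
    TensorProduct.map f f' (TensorProduct.map₂ p q A B) =
      TensorProduct.map₂ (p.compr₂ f) (q.compr₂ f') A B := by
  have : (TensorProduct.map₂ p q).compr₂ (TensorProduct.map f f') =
      TensorProduct.map₂ (p.compr₂ f) (q.compr₂ f') := bilin_tensor_ext fun a a' b b' => by simp
  exact LinearMap.congr_fun₂ this A B

theorem map₂_map_map {M₁ M₁' N₁ N₁' : Type*} [AddCommGroup M₁] [Module k M₁] [AddCommGroup M₁']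
    [Module k M₁'] [AddCommGroup N₁] [Module k N₁] [AddCommGroup N₁'] [Module k N₁']
    (p : M →ₗ[k] N →ₗ[k] P) (q : M' →ₗ[k] N' →ₗ[k] P')
    (f : M₁ →ₗ[k] M) (f' : M₁' →ₗ[k] M') (g : N₁ →ₗ[k] N) (g' : N₁' →ₗ[k] N')
    (A : M₁ ⊗[k] M₁') (B : N₁ ⊗[k] N₁') :
    TensorProduct.map₂ p q (TensorProduct.map f f' A) (TensorProduct.map g g' B) =
      TensorProduct.map₂ (p.compl₁₂ f g) (q.compl₁₂ f' g') A B := by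
  have : (TensorProduct.map₂ p q).compl₁₂ (TensorProduct.map f f') (TensorProduct.map g g') =
      TensorProduct.map₂ (p.compl₁₂ f g) (q.compl₁₂ f' g') :=
    bilin_tensor_ext fun a a' b b' => by simp
  exact LinearMap.congr_fun₂ this A B

theorem map₂_add_left (p p' : M →ₗ[k] N →ₗ[k] P) (q : M' →ₗ[k] N' →ₗ[k] P') (A : M ⊗[k] M')
    (B : N ⊗[k] N') : TensorProduct.map₂ (p + p') q A B =
      TensorProduct.map₂ p q A B + TensorProduct.map₂ p' q A B := by
  have : TensorProduct.map₂ (p + p') q = TensorProduct.map₂ p q + TensorProduct.map₂ p' q :=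
    bilin_tensor_ext fun a a' b b' => by simp [TensorProduct.add_tmul]
  exact LinearMap.congr_fun₂ this A B

theorem map_lift_comm (p : M →ₗ[k] N →ₗ[k] P) (q : M' →ₗ[k] N' →ₗ[k] P')
    (A : M ⊗[k] M') (B : N ⊗[k] N') :
    TensorProduct.map (TensorProduct.lift p) (TensorProduct.lift q)
      (TensorProduct.tensorTensorTensorComm k M M' N N' (A ⊗ₜ[k] B)) =
      TensorProduct.map₂ p q A B := by
  have : (TensorProduct.mk k _ _).compr₂ (TensorProduct.map (TensorProduct.lift p)
      (TensorProduct.lift q) ∘ₗ (TensorProduct.tensorTensorTensorComm k M M' N N').toLinearMap) =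
      TensorProduct.map₂ p q := bilin_tensor_ext fun a a' b b' => by simp
  exact LinearMap.congr_fun₂ this A B

end TensorLemmas

/-! ### The quantum shuffle bialgebra: coproduct and associativity -/

section ShuffleBialgebra

variable {G : Type v} {X : Type w} [CommGroup G] (c : X → G) {k : Type u} [Field k]
  (χ : G →* G →* kˣ)

variable (k) in
/-- The projection onto the span of the vertices. -/
noncomputable def vertexPart : PathCoalgebra k (Cayley c) →ₗ[k] PathCoalgebra k (Cayley c) :=
  wordLift fun g l => match l with
    | [] => word c k g []
    | _ :: _ => 0

@[simp]
theorem vertexPart_nil (g : G) : vertexPart c k (word c k g []) = word c k g [] :=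
  wordLift_word _ _ _

@[simp]
theorem vertexPart_cons (g : G) (x : X) (l : List X) : vertexPart c k (word c k g (x :: l)) = 0 :=
  wordLift_word _ _ _

theorem vertexPart_snoc (x : X) (z : PathCoalgebra k (Cayley c)) :
    vertexPart c k (snoc c k x z) = 0 := by
  have : vertexPart c k ∘ₗ snoc c k x = 0 := word_hom_ext fun g l => by simp
  exact LinearMap.congr_fun this z

theorem vertexPart_shuffleMul (z z' : PathCoalgebra k (Cayley c)) :
    vertexPart c k (shuffleMul c χ z z') =
      shuffleMul c χ (vertexPart c k z) (vertexPart c k z') := by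
  have : (shuffleMul c χ).compr₂ (vertexPart c k) =
      (shuffleMul c χ).compl₁₂ (vertexPart c k) (vertexPart c k) := by
    refine word_hom_ext fun g l => word_hom_ext fun h m => ?_
    simp only [LinearMap.compr₂_apply, LinearMap.compl₁₂_apply]
    cases l with
    | nil => cases m <;> simp [shuffleMul_vertex_word]
    | cons x l => cases m <;>
        simp [shuffleMul_word_vertex, shuffleMul_word_word, vertexPart_snoc]
  exact LinearMap.congr_fun₂ this z z'

theorem coef_vertexPart (g : G) (z : PathCoalgebra k (Cayley c)) :
    coef c k g [] (vertexPart c k z) = coef c k g [] z := by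
  classical
  have : (coef c k g []).ofConv ∘ₗ vertexPart c k = (coef c k g []).ofConv :=
    word_hom_ext fun h l => by
      cases l with
      | nil => simp
      | cons x l =>
        rw [LinearMap.comp_apply, vertexPart_cons, map_zero]
        exact ((coef_word g [] h (x :: l)).trans (if_neg (by simp))).symm
  exact LinearMap.congr_fun this z

theorem coef_unsnoc (g : G) (x : X) (l : List X) (z : PathCoalgebra k (Cayley c)) :
    coef c k g l (unsnoc c k x z) = coef c k g (x :: l) z := by
  classical
  have : (coef c k g l).ofConv ∘ₗ unsnoc c k x = (coef c k g (x :: l)).ofConv :=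
    word_hom_ext fun h m => by
      refine Eq.trans ?_ (coef_word g (x :: l) h m).symm
      cases m with
      | nil => simp [unsnoc_nil]
      | cons y m =>
        rw [LinearMap.comp_apply, unsnoc_cons]
        split_ifs with h1 h2 h2
        · exact (coef_word g l h m).trans (if_pos ⟨h2.1, (List.cons.inj h2.2).2⟩)
        · refine (coef_word g l h m).trans (if_neg fun h3 => h2 ⟨h3.1, by rw [h1, h3.2]⟩)
        · exact absurd (List.cons.inj h2.2).1 h1
        · exact map_zero _
  exact LinearMap.congr_fun this z

theorem tensor_eq_of_coef_eq {Z Z' : PathCoalgebra k (Cayley c) ⊗[k] PathCoalgebra k (Cayley c)}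
    (h : ∀ g l h m, TensorProduct.map (coef c k g l).ofConv (coef c k h m).ofConv Z =
      TensorProduct.map (coef c k g l).ofConv (coef c k h m).ofConv Z') : Z = Z' := by
  refine ((wordBasis c k).tensorProduct (wordBasis c k)).ext_elem fun p => ?_
  have key : ∀ Z : PathCoalgebra k (Cayley c) ⊗[k] PathCoalgebra k (Cayley c),
      ((wordBasis c k).tensorProduct (wordBasis c k)).repr Z p = LinearMap.mul' k k
        (TensorProduct.map (coef c k p.1.1 p.1.2).ofConv (coef c k p.2.1 p.2.2).ofConv Z) := by
    intro Z
    induction Z with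
    | zero => simp
    | add x y hx hy => simp only [map_add, Finsupp.add_apply, hx, hy]
    | tmul x y =>
      rw [Module.Basis.tensorProduct_repr_tmul_apply]
      simp [coef, mul_comm]
  rw [key, key, h]

/-- The coefficients of the left factor at vertices are seen by `vertexPart`, and those at longer
paths become visible after removing the last arrow. The left factor is the one to use, as the
coproduct puts the final parts there. -/
theorem tensor_eq_of_unsnoc_eq {Z Z' : PathCoalgebra k (Cayley c) ⊗[k] PathCoalgebra k (Cayley c)}
    (h : (vertexPart c k).rTensor _ Z = (vertexPart c k).rTensor _ Z')
    (h' : ∀ x, (unsnoc c k x).rTensor _ Z = (unsnoc c k x).rTensor _ Z') : Z = Z' := by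
  refine tensor_eq_of_coef_eq c fun g l h₁ m => ?_
  cases l with
  | nil =>
    have e : (coef c k g []).ofConv = (coef c k g []).ofConv ∘ₗ vertexPart c k :=
      LinearMap.ext fun z => (coef_vertexPart c g z).symm
    rw [e, ← LinearMap.comp_id (coef c k h₁ m).ofConv, TensorProduct.map_comp,
      LinearMap.comp_apply, LinearMap.comp_apply]
    exact congrArg _ h
  | cons x l =>
    have e : (coef c k g (x :: l)).ofConv = (coef c k g l).ofConv ∘ₗ unsnoc c k x :=
      LinearMap.ext fun z => (coef_unsnoc c g x l z).symm
    rw [e, ← LinearMap.comp_id (coef c k h₁ m).ofConv, TensorProduct.map_comp,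
      LinearMap.comp_apply, LinearMap.comp_apply]
    exact congrArg _ (h' x)

/-- A path shares its last arrow with each of its nontrivial final parts, and the cut with a trivial
final part is killed. -/
theorem rTensor_unsnoc_comul (x : X) (z : PathCoalgebra k (Cayley c)) :
    (unsnoc c k x).rTensor _ (comul (R := k) z) = comul (R := k) (unsnoc c k x z) := by
  classical
  have : (unsnoc c k x).rTensor _ ∘ₗ comul (R := k) = comul (R := k) ∘ₗ unsnoc c k x := by
    refine word_hom_ext fun g l => ?_
    simp only [LinearMap.comp_apply]
    cases l with
    | nil => rw [comul_word_nil, LinearMap.rTensor_tmul, unsnoc_nil, map_zero,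
        TensorProduct.zero_tmul]
    | cons y l =>
      have e : unsnoc c k x ∘ₗ snoc c k y = if x = y then LinearMap.id else 0 :=
        LinearMap.ext fun z => (unsnoc_snoc c x y z).trans (by split_ifs <;> rfl)
      rw [comul_word_cons, map_add, LinearMap.rTensor_tmul, unsnoc_nil, TensorProduct.zero_tmul,
        zero_add, ← LinearMap.comp_apply, ← LinearMap.rTensor_comp, e, unsnoc_cons]
      split_ifs
      · rw [LinearMap.rTensor_id, LinearMap.id_apply]
      · rw [LinearMap.rTensor_zero, LinearMap.zero_apply, map_zero]
  exact LinearMap.congr_fun this z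

/-- A path and all its final parts have the same end point, the only thing on which the factor in
`twist` depends. -/
theorem rTensor_twist_comul (x : X) (z : PathCoalgebra k (Cayley c)) :
    (twist c χ x).rTensor _ (comul (R := k) z) = comul (R := k) (twist c χ x z) := by
  have : (twist c χ x).rTensor _ ∘ₗ comul (R := k) = comul (R := k) ∘ₗ twist c χ x := by
    refine word_hom_ext fun g l => ?_
    simp only [LinearMap.comp_apply]
    induction l with
    | nil => rw [comul_word_nil, LinearMap.rTensor_tmul, twist_word, map_smul, comul_word_nil,
        TensorProduct.smul_tmul']
    | cons y l ih =>
      have e : twist c χ x ∘ₗ snoc c k y =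
          ((χ (c x) (c y))⁻¹ : kˣ).1 • (snoc c k y ∘ₗ twist c χ x) :=
        LinearMap.ext fun z => twist_snoc c χ x y z
      rw [comul_word_cons, map_add, LinearMap.rTensor_tmul, ← LinearMap.comp_apply,
        ← LinearMap.rTensor_comp, e, LinearMap.rTensor_smul, LinearMap.rTensor_comp,
        LinearMap.smul_apply, LinearMap.comp_apply, ih, twist_word, twist_word, twist_word,
        map_smul, map_smul, map_smul, comul_word_cons, smul_add, TensorProduct.smul_tmul',
        smul_smul]
      simp only [tgt, map_mul, mul_inv, Units.val_mul]
      rw [mul_comm (((χ (c x)) (c y))⁻¹ : kˣ).1]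
  exact LinearMap.congr_fun this z

theorem rTensor_vertexPart_comul_word (g : G) (l : List X) :
    (vertexPart c k).rTensor _ (comul (R := k) (word c k g l)) =
      word c k (tgt c g l) [] ⊗ₜ[k] word c k g l := by
  rw [LinearMap.rTensor, map_comul_of_left (vertexPart_cons c), vertexPart_nil, LinearMap.id_apply]

/-- All paths which occur in the shuffle of two paths end at the product of the two end points, and
the projection to vertices keeps only the cut at the end of each of them. -/
theorem rTensor_vertexPart_comul_shuffle (g : G) (l : List X) (h : G) (m : List X) :
    (vertexPart c k).rTensor _ (comul (R := k) (shuffle c χ g l h m)) =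
      word c k (tgt c g l * tgt c h m) [] ⊗ₜ[k] shuffle c χ g l h m := by
  have key : ∀ (x : X) (s : G) (z : PathCoalgebra k (Cayley c)),
      (vertexPart c k).rTensor _ (comul (R := k) z) = word c k s [] ⊗ₜ[k] z →
      (vertexPart c k).rTensor _ (comul (R := k) (snoc c k x z)) =
        word c k (s * c x) [] ⊗ₜ[k] snoc c k x z := by
    intro x s z hz
    have e : (vertexPart c k).rTensor _ ∘ₗ comul (R := k) ∘ₗ snoc c k x =
        TensorProduct.map (wordLift fun g l => word c k (g * c x) l) (snoc c k x) ∘ₗ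
          (vertexPart c k).rTensor _ ∘ₗ comul (R := k) :=
      word_hom_ext fun g l => by
        simp only [LinearMap.comp_apply, snoc_word, rTensor_vertexPart_comul_word,
          TensorProduct.map_tmul, wordLift_word, tgt]
    have := LinearMap.congr_fun e z
    simp only [LinearMap.comp_apply, hz, TensorProduct.map_tmul, wordLift_word] at this
    exact this
  fun_induction shuffle c χ g l h m with
  | case1 h m => rw [rTensor_vertexPart_comul_word, tgt_mul, tgt]
  | case2 x l h ih =>
    rw [map_smul, map_smul, key x _ _ ih, TensorProduct.tmul_smul, tgt, tgt, mul_right_comm]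
  | case3 x l h y m ih1 ih2 =>
    rw [map_add, map_add, map_smul, map_smul, key x _ _ ih1, key y _ _ ih2, TensorProduct.tmul_add,
      TensorProduct.tmul_smul, tgt, tgt, mul_right_comm, mul_assoc (tgt c g l * c x)]

/-- Induction on the total length. By `tensor_eq_of_unsnoc_eq` the two sides may be compared after
projecting the left tensor factors to vertices and after removing a last arrow from them. The skew
Leibniz rule turns the second comparison into the same statement for shorter words. -/
theorem comul_shuffleMul (z z' : PathCoalgebra k (Cayley c)) :
    comul (R := k) (shuffleMul c χ z z') =
      TensorProduct.map₂ (shuffleMul c χ) (shuffleMul c χ) (comul (R := k) z)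
        (comul (R := k) z') := by
  have key : ∀ n g l h m, l.length + m.length = n →
      comul (R := k) (shuffleMul c χ (word c k g l) (word c k h m)) =
      TensorProduct.map₂ (shuffleMul c χ) (shuffleMul c χ) (comul (R := k) (word c k g l))
        (comul (R := k) (word c k h m)) := by
    classical
    intro n
    induction n using Nat.strong_induction_on with
    | _ n ih =>
      intro g l h m hn
      refine tensor_eq_of_unsnoc_eq c ?_ fun x => ?_
      · have e : (shuffleMul c χ).compr₂ (vertexPart c k) =
            (shuffleMul c χ).compl₁₂ (vertexPart c k) (vertexPart c k) :=
          LinearMap.ext₂ (vertexPart_shuffleMul c χ)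
        have e' : (shuffleMul c χ).compr₂ LinearMap.id = (shuffleMul c χ).compl₁₂
            LinearMap.id LinearMap.id := rfl
        rw [LinearMap.rTensor, map_map₂, e, e', ← map₂_map_map, ← LinearMap.rTensor,
          rTensor_vertexPart_comul_word, rTensor_vertexPart_comul_word, TensorProduct.map₂_apply_tmul,
          TensorProduct.map_tmul, shuffleMul_vertex_word, shuffleMul_word, rTensor_vertexPart_comul_shuffle]
      · have e : (shuffleMul c χ).compr₂ (unsnoc c k x) =
            (shuffleMul c χ).compl₁₂ (unsnoc c k x) (twist c χ x) +
            (shuffleMul c χ).compl₁₂ LinearMap.id (unsnoc c k x) :=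
          LinearMap.ext₂ (unsnoc_shuffleMul c χ x)
        have e' : (shuffleMul c χ).compr₂ LinearMap.id = (shuffleMul c χ).compl₁₂
            LinearMap.id LinearMap.id := rfl
        rw [rTensor_unsnoc_comul, LinearMap.rTensor, map_map₂, e, e', map₂_add_left,
          ← map₂_map_map, ← map₂_map_map, ← LinearMap.rTensor, ← LinearMap.rTensor,
          ← LinearMap.rTensor, rTensor_unsnoc_comul, rTensor_unsnoc_comul, rTensor_twist_comul,
          LinearMap.rTensor_id, LinearMap.id_apply, unsnoc_shuffleMul, map_add, twist_word]
        congr 1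
        -- `twist` only rescales the second word, so the induction hypothesis for the shortened
        -- first word applies.
        · rw [map_smul, map_smul, map_smul, map_smul]
          congr 1
          cases l with
          | nil => rw [unsnoc_nil]; simp
          | cons y l =>
            rw [unsnoc_cons]
            split_ifs
            · exact ih _ (by simp at hn; omega) g l h m rfl
            · simp
        · cases m with
          | nil => rw [unsnoc_nil]; simp
          | cons y m =>
            rw [unsnoc_cons]
            split_ifs
            · exact ih _ (by simp at hn; omega) g l h m rfl
            · simp
  have : (shuffleMul c χ).compr₂ (comul (R := k)) =
      (TensorProduct.map₂ (shuffleMul c χ) (shuffleMul c χ)).compl₁₂ (comul (R := k))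
        (comul (R := k)) :=
    word_hom_ext fun g l => word_hom_ext fun h m => key _ g l h m rfl
  exact LinearMap.congr_fun₂ this z z'

theorem counit_snoc (x : X) (z : PathCoalgebra k (Cayley c)) :
    counit (R := k) (snoc c k x z) = 0 := by
  have : counit (R := k) ∘ₗ snoc c k x = 0 := word_hom_ext fun g l => by
    rw [LinearMap.comp_apply, snoc_word, counit_word, if_neg (by simp), LinearMap.zero_apply]
  exact LinearMap.congr_fun this z

theorem counit_shuffleMul (z z' : PathCoalgebra k (Cayley c)) :
    counit (R := k) (shuffleMul c χ z z') = counit (R := k) z * counit (R := k) z' := by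
  have : (shuffleMul c χ).compr₂ (counit (R := k)) =
      (LinearMap.mul k k).compl₁₂ (counit (R := k)) (counit (R := k)) := by
    refine word_hom_ext fun g l => word_hom_ext fun h m => ?_
    simp only [LinearMap.compr₂_apply, LinearMap.compl₁₂_apply, LinearMap.mul_apply']
    cases l with
    | nil => rw [shuffleMul_vertex_word, counit_word, counit_word, counit_word, if_pos rfl, one_mul]
    | cons x l => cases m <;>
        simp [shuffleMul_word_vertex, shuffleMul_word_word, counit_snoc, counit_word]
  exact LinearMap.congr_fun₂ this z z'

/-- The shuffle product, as a coalgebra map. -/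
noncomputable def shuffleCoalgHom :
    PathCoalgebra k (Cayley c) ⊗[k] PathCoalgebra k (Cayley c) →ₗc[k] PathCoalgebra k (Cayley c) where
  __ := TensorProduct.lift (shuffleMul c χ)
  counit_comp := TensorProduct.ext' fun z z' => by
    simp [counit_shuffleMul, mul_comm]
  map_comp_comul := TensorProduct.ext' fun z z' => by
    refine (map_lift_comm _ _ _ _).trans ?_
    simp [comul_shuffleMul]

/-- Both triple products are coalgebra maps from the threefold tensor product, so by `coalgHom_ext`
only the coefficients of vertices and arrows matter. For vertices the claim is associativity in `G`,
and the skew Leibniz rule reduces arrows to vertices. -/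
theorem shuffleMul_assoc (a b d : PathCoalgebra k (Cayley c)) :
    shuffleMul c χ (shuffleMul c χ a b) d = shuffleMul c χ a (shuffleMul c χ b d) := by
  have h0 : ∀ (g : G) (a b d : PathCoalgebra k (Cayley c)),
      coef c k g [] (shuffleMul c χ (shuffleMul c χ a b) d) =
        coef c k g [] (shuffleMul c χ a (shuffleMul c χ b d)) := by
    intro g a b d
    rw [← coef_vertexPart, ← coef_vertexPart c g (shuffleMul c χ a _)]
    congr 1
    simp only [vertexPart_shuffleMul]
    have : (((shuffleMul c χ).compl₁₂ (vertexPart c k) (vertexPart c k))).compr₂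
        ((shuffleMul c χ).compl₂ (vertexPart c k)) =
        ((LinearMap.llcomp k _ _ _) ∘ₗ (shuffleMul c χ) ∘ₗ vertexPart c k).compl₂
          ((shuffleMul c χ).compl₁₂ (vertexPart c k) (vertexPart c k)) := by
      refine word_hom_ext fun g l => word_hom_ext fun g' l' => word_hom_ext fun g'' l'' => ?_
      simp only [LinearMap.compr₂_apply, LinearMap.compl₁₂_apply, LinearMap.compl₂_apply,
        LinearMap.comp_apply, LinearMap.llcomp_apply]
      cases l <;> cases l' <;> cases l'' <;> simp [shuffleMul_vertex_word, mul_assoc]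
    exact LinearMap.congr_fun (LinearMap.congr_fun₂ this a b) d
  have h := coalgHom_ext
    (F := (shuffleCoalgHom c χ).comp
      (Coalgebra.TensorProduct.map (shuffleCoalgHom c χ) (CoalgHom.id k _)))
    (F' := ((shuffleCoalgHom c χ).comp
      (Coalgebra.TensorProduct.map (CoalgHom.id k _) (shuffleCoalgHom c χ))).comp
      (Coalgebra.TensorProduct.assoc k k _ _ _).toCoalgHom) fun g l hl => by
    refine TensorProduct.ext_threefold fun a b d => ?_
    change coef c k g l (shuffleMul c χ (shuffleMul c χ a b) d) =
      coef c k g l (shuffleMul c χ a (shuffleMul c χ b d))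
    match l, hl with
    | [], _ => exact h0 g a b d
    | [x], _ =>
      rw [← coef_unsnoc, ← coef_unsnoc]
      -- Each side becomes a sum of three terms, according to the factor which loses its arrow; they
      -- match one by one through `h0`.
      simp only [unsnoc_shuffleMul, twist_shuffleMul, map_add, LinearMap.add_apply]
      rw [h0, h0, h0, add_assoc]
  exact DFunLike.congr_fun h ((a ⊗ₜ[k] b) ⊗ₜ[k] d)

theorem one_shuffleMul (z : PathCoalgebra k (Cayley c)) :
    shuffleMul c χ (word c k 1 []) z = z := by
  have : shuffleMul c χ (word c k 1 []) = LinearMap.id := word_hom_ext fun g l => by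
    rw [shuffleMul_vertex_word, one_mul, LinearMap.id_apply]
  exact LinearMap.congr_fun this z

theorem shuffleMul_one (z : PathCoalgebra k (Cayley c)) :
    shuffleMul c χ z (word c k 1 []) = z := by
  have : (shuffleMul c χ).flip (word c k 1 []) = LinearMap.id := word_hom_ext fun g l => by
    rw [LinearMap.flip_apply, LinearMap.id_apply]
    induction l with
    | nil => rw [shuffleMul_vertex_word, mul_one]
    | cons x l ih => rw [shuffleMul_word_vertex, ih, map_one, inv_one, Units.val_one, one_smul,
        snoc_word]
  exact LinearMap.congr_fun this z

end ShuffleBialgebra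

/-! ### The coproduct preserves total length -/

section GradedTensor

variable {G : Type v} {X : Type w} [CommGroup G] (c : X → G) (k : Type u) [Field k]

/-- The homogeneous component of degree `n` of `kQ ⊗ kQ`. -/
noncomputable def wordTens (n : ℕ) : Submodule k (PathCoalgebra k (Cayley c) ⊗[k] PathCoalgebra k (Cayley c)) :=
  Submodule.span k {z | ∃ g l h m, l.length + m.length = n ∧ z = word c k g l ⊗ₜ[k] word c k h m}

variable {c k}

theorem tmul_mem_wordTens (g : G) (l : List X) (h : G) (m : List X) :
    word c k g l ⊗ₜ[k] word c k h m ∈ wordTens c k (l.length + m.length) :=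
  Submodule.subset_span ⟨g, l, h, m, rfl, rfl⟩

theorem wordTens_le {n : ℕ}
    {P : Submodule k (PathCoalgebra k (Cayley c) ⊗[k] PathCoalgebra k (Cayley c))}
    (H : ∀ g l h m, l.length + m.length = n → word c k g l ⊗ₜ[k] word c k h m ∈ P) :
    wordTens c k n ≤ P := by
  refine Submodule.span_le.2 ?_
  rintro _ ⟨g, l, h, m, hn, rfl⟩
  exact H g l h m hn

theorem comul_word_mem (g : G) (l : List X) :
    comul (R := k) (word c k g l) ∈ wordTens c k l.length := by
  induction l with
  | nil => rw [comul_word_nil]; exact tmul_mem_wordTens g [] g []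
  | cons x l ih =>
    rw [comul_word_cons]
    refine add_mem ?_ ?_
    · have := tmul_mem_wordTens (c := c) (k := k) (tgt c g (x :: l)) [] g (x :: l)
      rwa [List.length_nil, zero_add] at this
    · refine wordTens_le (P := (wordTens c k (l.length + 1)).comap ((snoc c k x).rTensor _))
        (fun h m h' m' hn => ?_) ih
      rw [Submodule.mem_comap, LinearMap.rTensor_tmul, snoc_word, ← hn, add_right_comm]
      exact tmul_mem_wordTens h (x :: m) h' m'

end GradedTensor

/-! ### The antipode of the quantum shuffle bialgebra -/

section ShuffleHopf

variable {G : Type v} {X : Type w} [CommGroup G] (c : X → G) {k : Type u} [Field k]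
  (χ : G →* G →* kˣ)

/-- The path coalgebra of `Cayley c`, regarded as a bialgebra with the quantum shuffle product. -/
def QShuffle (_χ : G →* G →* kˣ) : Type (max u v w) := PathCoalgebra k (Cayley c)

namespace QShuffle

noncomputable instance : AddCommGroup (QShuffle c χ) :=
  inferInstanceAs (AddCommGroup (PathCoalgebra k (Cayley c)))

noncomputable instance : Module k (QShuffle c χ) :=
  inferInstanceAs (Module k (PathCoalgebra k (Cayley c)))

noncomputable instance : Coalgebra k (QShuffle c χ) :=
  inferInstanceAs (Coalgebra k (PathCoalgebra k (Cayley c)))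

/-- The quantum shuffle product. -/
noncomputable def mulMap : QShuffle c χ →ₗ[k] QShuffle c χ →ₗ[k] QShuffle c χ := shuffleMul c χ

noncomputable instance : Ring (QShuffle c χ) where
  __ := (inferInstance : AddCommGroup (QShuffle c χ))
  mul x y := mulMap c χ x y
  one := word c k 1 []
  one_mul := one_shuffleMul c χ
  mul_one := shuffleMul_one c χ
  mul_assoc := shuffleMul_assoc c χ
  zero_mul x := LinearMap.map_zero₂ (mulMap c χ) x
  mul_zero x := (mulMap c χ x).map_zero
  left_distrib x y z := (mulMap c χ x).map_add y z
  right_distrib x y z := LinearMap.map_add₂ (mulMap c χ) x y z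

noncomputable instance : Algebra k (QShuffle c χ) :=
  Algebra.ofModule (fun r x y => LinearMap.map_smul₂ (mulMap c χ) r x y)
    (fun r x y => (mulMap c χ x).map_smul r y)

/-- A path, as an element of the quantum shuffle algebra. -/
noncomputable def wd (g : G) (l : List X) : QShuffle c χ := word c k g l

variable {c χ}

theorem hom_ext {M : Type*} [AddCommGroup M] [Module k M] {f f' : QShuffle c χ →ₗ[k] M}
    (h : ∀ g l, f (wd c χ g l) = f' (wd c χ g l)) : f = f' :=
  word_hom_ext h

/-- The linear map with given values on paths. -/
noncomputable def lift {M : Type*} [AddCommGroup M] [Module k M] (f : G → List X → M) :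
    QShuffle c χ →ₗ[k] M :=
  wordLift (c := c) f

theorem lift_wd {M : Type*} [AddCommGroup M] [Module k M] (f : G → List X → M) (g : G)
    (l : List X) : lift f (wd c χ g l) = f g l :=
  wordLift_word (c := c) f g l

/-- A linear map which preserves the length of paths. -/
def IsHomogeneousMap (f : WithConv (QShuffle c χ →ₗ[k] QShuffle c χ)) : Prop :=
  ∀ g l, (show PathCoalgebra k (Cayley c) from f (wd c χ g l)) ∈
    PathCoalgebra.homogeneous k (Cayley c) l.length

/-- Since the coproduct preserves total length, a convolution product at a path only involves pairs
of paths whose lengths add up to its length. This allows an infinite series to be replaced by a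
finite sum, depending on the path. -/
theorem conv_apply_eq {f f' h h' : WithConv (QShuffle c χ →ₗ[k] QShuffle c χ)} {g : G} {l : List X}
    (H : ∀ g₁ l₁ g₂ l₂, l₁.length + l₂.length = l.length →
      f (wd c χ g₁ l₁) * h (wd c χ g₂ l₂) = f' (wd c χ g₁ l₁) * h' (wd c χ g₂ l₂)) :
    (f * h) (wd c χ g l) = (f' * h') (wd c χ g l) := by
  have := wordTens_le (P := LinearMap.eqLocus
    (LinearMap.mul' k (QShuffle c χ) ∘ₗ TensorProduct.map f.ofConv h.ofConv)
    (LinearMap.mul' k (QShuffle c χ) ∘ₗ TensorProduct.map f'.ofConv h'.ofConv)) H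
    (comul_word_mem (c := c) (k := k) g l)
  exact this

theorem IsHomogeneousMap.mul {f f' : WithConv (QShuffle c χ →ₗ[k] QShuffle c χ)}
    (hf : IsHomogeneousMap f) (hf' : IsHomogeneousMap f') : IsHomogeneousMap (f * f') := by
  intro g l
  refine wordTens_le (P := (PathCoalgebra.homogeneous k (Cayley c) l.length).comap
    (LinearMap.mul' k (QShuffle c χ) ∘ₗ TensorProduct.map f.ofConv f'.ofConv))
    (fun g₁ l₁ g₂ l₂ hl => ?_) (comul_word_mem (c := c) (k := k) g l)
  rw [← hl]
  exact shuffleMul_mem_homogeneous c χ (hf g₁ l₁) (hf' g₂ l₂)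

theorem IsHomogeneousMap.sub {f f' : WithConv (QShuffle c χ →ₗ[k] QShuffle c χ)}
    (hf : IsHomogeneousMap f) (hf' : IsHomogeneousMap f') : IsHomogeneousMap (f - f') :=
  fun g l => sub_mem (hf g l) (hf' g l)

theorem isHomogeneousMap_one :
    IsHomogeneousMap (1 : WithConv (QShuffle c χ →ₗ[k] QShuffle c χ)) := by
  intro g l
  rw [LinearMap.convOne_apply]
  have h : counit (R := k) (wd c χ g l) = if l = [] then 1 else 0 := counit_word g l
  rw [h]
  split_ifs with hl
  · rw [map_one, hl]
    exact word_mem_homogeneous (1 : G) []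
  · rw [map_zero]
    exact zero_mem _

theorem IsHomogeneousMap.pow {f : WithConv (QShuffle c χ →ₗ[k] QShuffle c χ)}
    (hf : IsHomogeneousMap f) (n : ℕ) : IsHomogeneousMap (f ^ n) := by
  induction n with
  | zero => rw [pow_zero]; exact isHomogeneousMap_one
  | succ n ih => rw [pow_succ]; exact ih.mul hf

/-- Each factor of the convolution power has to consume at least one arrow, as `f` vanishes on
vertices. -/
theorem pow_apply_eq_zero {f : WithConv (QShuffle c χ →ₗ[k] QShuffle c χ)}
    (hf : ∀ g, f (wd c χ g []) = 0) {n : ℕ} {g : G} {l : List X} (hl : l.length < n) :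
    (f ^ n) (wd c χ g l) = 0 := by
  induction n generalizing g l with
  | zero => omega
  | succ n ih =>
    rw [pow_succ']
    refine (conv_apply_eq (f' := 0) (h' := 0) fun g₁ l₁ g₂ l₂ h => ?_).trans
      (by rw [mul_zero]; rfl)
    cases l₁ with
    | nil => rw [hf, zero_mul]; exact (zero_mul _).symm
    | cons x l₁ =>
      rw [ih (by simp at h; omega), mul_zero]
      exact (zero_mul _).symm

/-- The geometric series of a linear endomorphism which vanishes on vertices. -/
noncomputable def geomSeries (f : WithConv (QShuffle c χ →ₗ[k] QShuffle c χ)) :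
    WithConv (QShuffle c χ →ₗ[k] QShuffle c χ) :=
  WithConv.toConv (lift fun g l => ∑ i ∈ Finset.range (l.length + 1), (f ^ i) (wd c χ g l))

theorem geomSeries_wd (f : WithConv (QShuffle c χ →ₗ[k] QShuffle c χ)) (g : G) (l : List X) :
    geomSeries f (wd c χ g l) = ∑ i ∈ Finset.range (l.length + 1), (f ^ i) (wd c χ g l) := by
  rw [geomSeries, WithConv.ofConv_toConv, lift_wd]

/-- A linear endomorphism of the form `1 - f`, where `f` vanishes on vertices, is convolution
invertible. -/
theorem exists_inverse_one_sub {f : WithConv (QShuffle c χ →ₗ[k] QShuffle c χ)}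
    (hf : ∀ g, f (wd c χ g []) = 0) (hf' : IsHomogeneousMap f) :
    ∃ p, IsHomogeneousMap p ∧ p * (1 - f) = 1 ∧ (1 - f) * p = 1 := by
  -- On paths of length at most `n` the series coincides with one fixed partial sum, to which the
  -- formula for finite geometric sums in a ring applies.
  have hp : ∀ n g l, l.length ≤ n →
      geomSeries f (wd c χ g l) = (∑ i ∈ Finset.range (n + 1), f ^ i) (wd c χ g l) := by
    intro n g l hl
    have h2 : (∑ i ∈ Finset.range (n + 1), f ^ i) (wd c χ g l) =
        ∑ i ∈ Finset.range (n + 1), (f ^ i) (wd c χ g l) := by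
      rw [WithConv.ofConv_sum, LinearMap.sum_apply]
    rw [geomSeries_wd, h2]
    refine Finset.sum_subset (Finset.range_mono (by omega)) fun i _ hi => ?_
    exact pow_apply_eq_zero hf (by simpa using hi)
  refine ⟨geomSeries f, fun g l => ?_, WithConv.ext (hom_ext fun g l => ?_),
    WithConv.ext (hom_ext fun g l => ?_)⟩
  · rw [geomSeries_wd]
    exact sum_mem fun i _ => hf'.pow i g l
  · refine (conv_apply_eq (f' := ∑ i ∈ Finset.range (l.length + 1), f ^ i) (h' := 1 - f)
      fun g₁ l₁ g₂ l₂ h => ?_).trans ?_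
    · rw [hp l.length g₁ l₁ (by omega)]
    · rw [geom_sum_mul_neg]
      change (1 : WithConv (QShuffle c χ →ₗ[k] QShuffle c χ)) (wd c χ g l) -
        (f ^ (l.length + 1)) (wd c χ g l) = _
      rw [pow_apply_eq_zero hf (Nat.lt_succ_self _), sub_zero]
  · refine (conv_apply_eq (f' := 1 - f) (h' := ∑ i ∈ Finset.range (l.length + 1), f ^ i)
      fun g₁ l₁ g₂ l₂ h => ?_).trans ?_
    · rw [hp l.length g₂ l₂ (by omega)]
    · rw [mul_neg_geom_sum]
      change (1 : WithConv (QShuffle c χ →ₗ[k] QShuffle c χ)) (wd c χ g l) -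
        (f ^ (l.length + 1)) (wd c χ g l) = _
      rw [pow_apply_eq_zero hf (Nat.lt_succ_self _), sub_zero]

variable (c χ) in
/-- The linear map which inverts the vertices, and vanishes on paths of positive length. -/
noncomputable def vertexInv : WithConv (QShuffle c χ →ₗ[k] QShuffle c χ) :=
  WithConv.toConv (lift fun g l => match l with
    | [] => wd c χ g⁻¹ []
    | _ :: _ => 0)

theorem vertexInv_nil (g : G) : vertexInv c χ (wd c χ g []) = wd c χ g⁻¹ [] := by
  rw [vertexInv, WithConv.ofConv_toConv, lift_wd]

theorem vertexInv_cons (g : G) (x : X) (l : List X) : vertexInv c χ (wd c χ g (x :: l)) = 0 := by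
  rw [vertexInv, WithConv.ofConv_toConv, lift_wd]

theorem isHomogeneousMap_vertexInv : IsHomogeneousMap (vertexInv c χ) := by
  intro g l
  cases l with
  | nil => rw [vertexInv_nil]; exact word_mem_homogeneous (g⁻¹ : G) []
  | cons x l => rw [vertexInv_cons]; exact zero_mem _

theorem wd_nil_mul (g h : G) (l : List X) : wd c χ g [] * wd c χ h l = wd c χ (g * h) l :=
  shuffleMul_vertex_word c χ g h l

theorem conv_one_apply (x : QShuffle c χ) :
    (1 : WithConv (QShuffle c χ →ₗ[k] QShuffle c χ)) x = counit (R := k) x • 1 := by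
  rw [LinearMap.convOne_apply, Algebra.algebraMap_eq_smul_one]

theorem one_apply_nil (g : G) :
    (1 : WithConv (QShuffle c χ →ₗ[k] QShuffle c χ)) (wd c χ g []) = wd c χ 1 [] := by
  rw [LinearMap.convOne_apply]
  have h : counit (R := k) (wd c χ g []) = 1 := (counit_word g []).trans (if_pos rfl)
  rw [h, map_one]
  rfl

theorem conv_apply_nil (f h : WithConv (QShuffle c χ →ₗ[k] QShuffle c χ)) (g : G) :
    (f * h) (wd c χ g []) = f (wd c χ g []) * h (wd c χ g []) := by
  rw [LinearMap.convMul_apply]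
  have : comul (R := k) (wd c χ g []) = wd c χ g [] ⊗ₜ[k] wd c χ g [] := comul_word_nil g
  rw [this, TensorProduct.map_tmul, LinearMap.mul'_apply]

-- On vertices `vertexInv` inverts the identity on both sides. So its two convolution products with
-- the identity differ from the unit by maps which vanish on vertices, and are invertible by
-- `exists_inverse_one_sub`. This gives a left and a right inverse of the identity, which have to
-- coincide.
variable (c χ) in
theorem exists_antipode : ∃ s : WithConv (QShuffle c χ →ₗ[k] QShuffle c χ), IsHomogeneousMap s ∧
    s * WithConv.toConv LinearMap.id = 1 ∧ WithConv.toConv LinearMap.id * s = 1 := by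
  have hid : IsHomogeneousMap (c := c) (χ := χ) (WithConv.toConv LinearMap.id) :=
    fun g l => word_mem_homogeneous g l
  have h1 : ∀ g, (1 - vertexInv c χ * WithConv.toConv LinearMap.id :
      WithConv (QShuffle c χ →ₗ[k] QShuffle c χ)) (wd c χ g []) = 0 := by
    intro g
    rw [WithConv.ofConv_sub, LinearMap.sub_apply, one_apply_nil, conv_apply_nil, vertexInv_nil]
    change _ - wd c χ g⁻¹ [] * wd c χ g [] = 0
    rw [wd_nil_mul, inv_mul_cancel, sub_self]
  have h2 : ∀ g, (1 - WithConv.toConv LinearMap.id * vertexInv c χ :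
      WithConv (QShuffle c χ →ₗ[k] QShuffle c χ)) (wd c χ g []) = 0 := by
    intro g
    rw [WithConv.ofConv_sub, LinearMap.sub_apply, one_apply_nil, conv_apply_nil, vertexInv_nil]
    change _ - wd c χ g [] * wd c χ g⁻¹ [] = 0
    rw [wd_nil_mul, mul_inv_cancel, sub_self]
  obtain ⟨p, hp, hp1, -⟩ := exists_inverse_one_sub h1
    (isHomogeneousMap_one.sub (isHomogeneousMap_vertexInv.mul hid))
  obtain ⟨q, -, -, hq1⟩ := exists_inverse_one_sub h2
    (isHomogeneousMap_one.sub (hid.mul isHomogeneousMap_vertexInv))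
  rw [sub_sub_cancel, ← mul_assoc] at hp1
  rw [sub_sub_cancel, mul_assoc] at hq1
  -- The left inverse is a product of homogeneous maps; this is why the antipode is graded.
  refine ⟨p * vertexInv c χ, hp.mul isHomogeneousMap_vertexInv, hp1, ?_⟩
  rw [left_inv_eq_right_inv hp1 hq1, hq1]

variable (c χ) in
/-- The antipode of the quantum shuffle algebra. -/
noncomputable def antipode : PathCoalgebra k (Cayley c) →ₗ[k] PathCoalgebra k (Cayley c) :=
  (exists_antipode c χ).choose.ofConv

variable (c χ) in
theorem antipode_left (x : PathCoalgebra k (Cayley c)) :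
    TensorProduct.lift (shuffleMul c χ) ((antipode c χ).rTensor _ (comul (R := k) x)) =
      counit (R := k) x • word c k 1 [] := by
  exact (LinearMap.congr_fun (congrArg WithConv.ofConv (exists_antipode c χ).choose_spec.2.1)
    x).trans (conv_one_apply x)

variable (c χ) in
theorem antipode_right (x : PathCoalgebra k (Cayley c)) :
    TensorProduct.lift (shuffleMul c χ) ((antipode c χ).lTensor _ (comul (R := k) x)) =
      counit (R := k) x • word c k 1 [] := by
  exact (LinearMap.congr_fun (congrArg WithConv.ofConv (exists_antipode c χ).choose_spec.2.2)
    x).trans (conv_one_apply x)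

variable (c χ) in
theorem antipode_mem {n : ℕ} {x : PathCoalgebra k (Cayley c)}
    (hx : x ∈ PathCoalgebra.homogeneous k (Cayley c) n) :
    antipode c χ x ∈ PathCoalgebra.homogeneous k (Cayley c) n := by
  refine homogeneous_le (P := (PathCoalgebra.homogeneous k (Cayley c) n).comap (antipode c χ))
    (fun g l hl => ?_) hx
  subst hl
  exact (exists_antipode c χ).choose_spec.1 g l

end QShuffle

/-- The graded Hopf algebra structure on the path coalgebra of `Cayley c` given by the quantum
shuffle product. -/
noncomputable def shuffleHopf : GradedHopfStructure k (Cayley c) where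
  mul := shuffleMul c χ
  one := word c k 1 []
  antipode := QShuffle.antipode c χ
  one_mul := one_shuffleMul c χ
  mul_one := shuffleMul_one c χ
  mul_assoc := shuffleMul_assoc c χ
  counit_one := (counit_word 1 []).trans (if_pos rfl)
  counit_mul := counit_shuffleMul c χ
  comul_one := comul_word_nil 1
  comul_mul := comul_shuffleMul c χ
  antipode_left := QShuffle.antipode_left c χ
  antipode_right := QShuffle.antipode_right c χ
  one_mem := word_mem_homogeneous 1 []
  mul_mem := shuffleMul_mem_homogeneous c χ
  antipode_mem := QShuffle.antipode_mem c χ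

end ShuffleHopf

/-! ### Group-like elements of the path coalgebra of an arbitrary quiver -/

section GroupLike

variable {k : Type u} [Field k] {V : Type v} [Quiver.{w} V]

theorem length_add_length_of_mem_pathCuts {a b : V} {p : Quiver.Path a b}
    {y : Σ c : V, Quiver.Path a c × Quiver.Path c b} (hy : y ∈ pathCuts p) :
    y.2.1.length + y.2.2.length = p.length := by
  induction p with
  | nil =>
    rw [pathCuts, List.mem_singleton] at hy
    subst hy
    rfl
  | cons p e ih =>
    rw [pathCuts, List.mem_cons, List.mem_map] at hy
    rcases hy with rfl | ⟨z, hz, rfl⟩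
    · rfl
    · exact congrArg (· + 1) (ih hz)

variable (k) in
/-- The coefficient of a path, as an element of the convolution algebra of linear forms. -/
noncomputable def pathCoef {a b : V} (p : Quiver.Path a b) :
    WithConv (PathCoalgebra k V →ₗ[k] k) :=
  WithConv.toConv ((PathCoalgebra.basis k V).coord ⟨a, b, p⟩)

open Classical in
theorem pathCoef_path {a b c d : V} (p : Quiver.Path a b) (q : Quiver.Path c d) :
    pathCoef k p (PathCoalgebra.path k q) =
      if (⟨c, d, q⟩ : Σ a b : V, Quiver.Path a b) = ⟨a, b, p⟩ then 1 else 0 := by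
  change (PathCoalgebra.basis k V).coord ⟨a, b, p⟩ (PathCoalgebra.basis k V ⟨c, d, q⟩) = _
  rw [Module.Basis.coord_apply, Module.Basis.repr_self, Finsupp.single_apply]

theorem pathCoef_eq_zero {a b c d : V} {p : Quiver.Path a b} {q : Quiver.Path c d}
    (h : q.length ≠ p.length) : pathCoef k p (PathCoalgebra.path k q) = 0 := by
  classical
  rw [pathCoef_path, if_neg]
  intro h'
  exact h (congrArg (fun y : Σ a b : V, Quiver.Path a b => y.2.2.length) h')

theorem conv_path (f f' : WithConv (PathCoalgebra k V →ₗ[k] k)) {a b : V} (p : Quiver.Path a b) :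
    (f * f') (PathCoalgebra.path k p) = ((pathCuts p).map fun y =>
      f (PathCoalgebra.path k y.2.2) * f' (PathCoalgebra.path k y.2.1)).sum := by
  rw [LinearMap.convMul_apply, PathCoalgebra.comul_path, map_list_sum, map_list_sum, List.map_map,
    List.map_map]
  rfl

theorem pathCoef_mul_pathCoef_eq_zero {a b c d e e' : V} {p : Quiver.Path a b}
    {q : Quiver.Path c d} {r : Quiver.Path e e'} (h : r.length ≠ p.length + q.length) :
    (pathCoef k p * pathCoef k q) (PathCoalgebra.path k r) = 0 := by
  rw [conv_path]
  refine List.sum_eq_zero fun z hz => ?_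
  obtain ⟨y, hy, rfl⟩ := List.mem_map.1 hz
  have := length_add_length_of_mem_pathCuts hy
  by_cases h1 : y.2.2.length = p.length
  · rw [pathCoef_eq_zero (q := y.2.1) (p := q) (by omega), mul_zero]
  · rw [pathCoef_eq_zero h1, zero_mul]

/-- The analogue of `coef_cons` for arbitrary quivers. The uniqueness statement needs it, as the
second quiver is not given in the form `Cayley c`. -/
theorem pathCoef_cons {a b c : V} (q : Quiver.Path a b) (e : b ⟶ c) :
    pathCoef k (q.cons e) = pathCoef k e.toPath * pathCoef k q := by
  classical
  refine WithConv.ext (PathCoalgebra.hom_ext fun a' c' r => ?_)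
  change pathCoef k (q.cons e) (PathCoalgebra.path k r) =
    (pathCoef k e.toPath * pathCoef k q) (PathCoalgebra.path k r)
  cases r with
  | nil =>
    rw [pathCoef_eq_zero (by simp), pathCoef_mul_pathCoef_eq_zero]
    simp only [Quiver.Path.length_nil, Quiver.Path.length_toPath]
    omega
  | @cons b' _ r' e' =>
    rw [conv_path, pathCuts, List.map_cons, List.sum_cons, pathCoef_eq_zero (p := e.toPath) (by simp),
      zero_mul, zero_add, List.map_map, Function.comp_def]
    have h1 : ∀ y : Σ d : V, Quiver.Path a' d × Quiver.Path d b',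
        pathCoef k e.toPath (PathCoalgebra.path k (y.2.2.cons e')) *
          pathCoef k q (PathCoalgebra.path k y.2.1) =
        if y.2.2.length = 0 then pathCoef k e.toPath (PathCoalgebra.path k (y.2.2.cons e')) *
          pathCoef k q (PathCoalgebra.path k y.2.1) else 0 := by
      intro y
      split_ifs with hy
      · rfl
      · rw [pathCoef_eq_zero (p := e.toPath) (by simpa using hy), zero_mul]
    rw [List.map_congr_left fun y _ => h1 y]
    rw [PathCoalgebra.sum_cuts_left r' fun d s t =>
      pathCoef k e.toPath (PathCoalgebra.path k (t.cons e')) * pathCoef k q (PathCoalgebra.path k s)]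
    rw [pathCoef_path, pathCoef_path, pathCoef_path]
    by_cases h : (⟨a', b', r'⟩ : Σ a b : V, Quiver.Path a b) = ⟨a, b, q⟩
    · cases h
      rw [if_pos rfl, mul_one]
      congr 1
      refine propext ⟨fun h => ?_, fun h => ?_⟩
      · cases h; rfl
      · cases h; rfl
    · rw [if_neg h, mul_zero, if_neg]
      intro h'
      cases h'
      exact h rfl

-- A vertex coefficient in the right factor meets only the cut with a trivial initial part, so
-- convolution with it selects the paths which start at that vertex. In the left factor it selects
-- the end point.
open Classical in
theorem conv_pathCoef_nil (f : WithConv (PathCoalgebra k V →ₗ[k] k)) {a b c : V}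
    (p : Quiver.Path a b) : (f * pathCoef k (Quiver.Path.nil : Quiver.Path c c))
      (PathCoalgebra.path k p) = if a = c then f (PathCoalgebra.path k p) else 0 := by
  rw [conv_path]
  have h1 : ∀ y : Σ d : V, Quiver.Path a d × Quiver.Path d b,
      f (PathCoalgebra.path k y.2.2) * pathCoef k (Quiver.Path.nil : Quiver.Path c c)
        (PathCoalgebra.path k y.2.1) =
      if y.2.1.length = 0 then f (PathCoalgebra.path k y.2.2) *
        pathCoef k (Quiver.Path.nil : Quiver.Path c c) (PathCoalgebra.path k y.2.1) else 0 := by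
    intro y
    split_ifs with hy
    · rfl
    · rw [pathCoef_eq_zero (q := y.2.1) (p := Quiver.Path.nil) (by simpa using hy), mul_zero]
  rw [List.map_congr_left fun y _ => h1 y, PathCoalgebra.sum_cuts_right p fun d s t =>
      f (PathCoalgebra.path k t) *
        pathCoef k (Quiver.Path.nil : Quiver.Path c c) (PathCoalgebra.path k s), pathCoef_path]
  by_cases h : a = c
  · subst h
    rw [if_pos rfl, if_pos rfl, mul_one]
  · rw [if_neg h, if_neg, mul_zero]
    intro h'
    exact h (congrArg Sigma.fst h')

open Classical in
theorem pathCoef_nil_conv (f : WithConv (PathCoalgebra k V →ₗ[k] k)) {a b c : V}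
    (p : Quiver.Path a b) : (pathCoef k (Quiver.Path.nil : Quiver.Path c c) * f)
      (PathCoalgebra.path k p) = if b = c then f (PathCoalgebra.path k p) else 0 := by
  rw [conv_path]
  have h1 : ∀ y : Σ d : V, Quiver.Path a d × Quiver.Path d b,
      pathCoef k (Quiver.Path.nil : Quiver.Path c c) (PathCoalgebra.path k y.2.2) *
        f (PathCoalgebra.path k y.2.1) =
      if y.2.2.length = 0 then pathCoef k (Quiver.Path.nil : Quiver.Path c c)
        (PathCoalgebra.path k y.2.2) * f (PathCoalgebra.path k y.2.1) else 0 := by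
    intro y
    split_ifs with hy
    · rfl
    · rw [pathCoef_eq_zero (q := y.2.2) (p := Quiver.Path.nil) (by simpa using hy), zero_mul]
  rw [List.map_congr_left fun y _ => h1 y, PathCoalgebra.sum_cuts_left p fun d s t =>
      pathCoef k (Quiver.Path.nil : Quiver.Path c c) (PathCoalgebra.path k t) *
        f (PathCoalgebra.path k s), pathCoef_path]
  by_cases h : b = c
  · subst h
    rw [if_pos rfl, if_pos rfl, one_mul]
  · rw [if_neg h, if_neg, zero_mul]
    intro h'
    exact h (congrArg (fun y : Σ a b : V, Quiver.Path a b => y.1) h')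

open Classical in
theorem pathCoef_mul_nil {a b c : V} (p : Quiver.Path a b) :
    pathCoef k p * pathCoef k (Quiver.Path.nil : Quiver.Path c c) =
      if a = c then pathCoef k p else 0 := by
  refine WithConv.ext (PathCoalgebra.hom_ext fun a' b' r => ?_)
  refine (conv_pathCoef_nil _ r).trans ?_
  by_cases h : a' = a
  · subst h
    split_ifs <;> rfl
  · have h0 : pathCoef k p (PathCoalgebra.path k r) = 0 := by
      rw [pathCoef_path, if_neg fun h' => h (congrArg Sigma.fst h')]
    split_ifs
    · rfl
    · exact h0
    · exact h0.symm
    · rfl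

open Classical in
theorem nil_mul_pathCoef {a b c : V} (p : Quiver.Path a b) :
    pathCoef k (Quiver.Path.nil : Quiver.Path c c) * pathCoef k p =
      if b = c then pathCoef k p else 0 := by
  refine WithConv.ext (PathCoalgebra.hom_ext fun a' b' r => ?_)
  refine (pathCoef_nil_conv _ r).trans ?_
  by_cases h : b' = b
  · subst h
    split_ifs <;> rfl
  · have h0 : pathCoef k p (PathCoalgebra.path k r) = 0 := by
      rw [pathCoef_path, if_neg fun h' =>
        h (congrArg (fun y : Σ a b : V, Quiver.Path a b => y.2.1) h')]
    split_ifs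
    · rfl
    · exact h0
    · exact h0.symm
    · rfl

theorem eq_of_pathCoef_eq {x y : PathCoalgebra k V}
    (h : ∀ (a b : V) (p : Quiver.Path a b), pathCoef k p x = pathCoef k p y) : x = y :=
  (PathCoalgebra.basis k V).ext_elem fun p => h p.1 p.2.1 p.2.2

/-- A linear form which vanishes on the paths in the support of an element vanishes on it. -/
theorem apply_eq_zero_of_support {M : Type*} [AddCommGroup M] [Module k M]
    {f : PathCoalgebra k V →ₗ[k] M} {x : PathCoalgebra k V}
    (h : ∀ (a b : V) (p : Quiver.Path a b), pathCoef k p x ≠ 0 → f (PathCoalgebra.path k p) = 0) :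
    f x = 0 := by
  rw [← (PathCoalgebra.basis k V).linearCombination_repr x, Finsupp.linearCombination_apply,
    Finsupp.sum, map_sum]
  refine Finset.sum_eq_zero fun p hp => ?_
  rw [map_smul]
  refine (congrArg _ (h p.1 p.2.1 p.2.2 ?_)).trans (smul_zero _)
  exact Finsupp.mem_support_iff.1 hp

theorem conv_apply_of_isGroupLikeElem {C : Type*} [AddCommGroup C] [Module k C] [Coalgebra k C]
    {x : C} (hx : IsGroupLikeElem k x) (f f' : WithConv (C →ₗ[k] k)) :
    (f * f') x = f x * f' x := by
  rw [LinearMap.convMul_apply, hx.comul_eq_tmul_self, TensorProduct.map_tmul, LinearMap.mul'_apply]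

/-- Suppose that a longest path `q` in the support has positive length. As convolution is pointwise
at a group-like element, the square of the coefficient of `q` is the value of `pathCoef k q *
pathCoef k q`, which only detects paths twice as long as `q`. None of those lie in the support. -/
theorem pathCoef_eq_zero_of_isGroupLikeElem {x : PathCoalgebra k V} (hx : IsGroupLikeElem k x)
    {a b : V} {p : Quiver.Path a b} (hp : p.length ≠ 0) : pathCoef k p x = 0 := by
  by_contra h
  let s := ((PathCoalgebra.basis k V).repr x).support
  have hs : ∀ (c d : V) (q : Quiver.Path c d), pathCoef k q x ≠ 0 →
      (⟨c, d, q⟩ : Σ a b : V, Quiver.Path a b) ∈ s := fun c d q hq => Finsupp.mem_support_iff.2 hq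
  obtain ⟨⟨c, d, q⟩, hq, hmax⟩ := s.exists_max_image (fun y => y.2.2.length) ⟨_, hs a b p h⟩
  have hq0 : pathCoef k q x ≠ 0 := Finsupp.mem_support_iff.1 hq
  have hpq : p.length ≤ q.length := hmax _ (hs a b p h)
  refine hq0 (mul_self_eq_zero.1 ?_)
  rw [← conv_apply_of_isGroupLikeElem hx]
  refine apply_eq_zero_of_support fun c' d' r hr => pathCoef_mul_pathCoef_eq_zero ?_
  have : r.length ≤ q.length := hmax _ (hs c' d' r hr)
  omega

/-- The group-like elements of a path coalgebra are the vertices. -/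
theorem exists_eq_vertex_of_isGroupLikeElem {x : PathCoalgebra k V} (hx : IsGroupLikeElem k x) :
    ∃ a, x = PathCoalgebra.vertex k a := by
  classical
  obtain ⟨a, ha⟩ : ∃ a : V, pathCoef k (Quiver.Path.nil : Quiver.Path a a) x ≠ 0 := by
    by_contra! h
    refine hx.ne_zero (eq_of_pathCoef_eq fun a b p => ?_)
    refine Eq.trans ?_ (map_zero _).symm
    cases p with
    | nil => exact h a
    | cons p e => exact pathCoef_eq_zero_of_isGroupLikeElem hx (by simp)
  -- The vertex coefficients are orthogonal idempotents for convolution, which is pointwise at `x`.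
  -- So a nonzero value equals `1` and forces the others to vanish.
  have h1 : ∀ b : V, pathCoef k (Quiver.Path.nil : Quiver.Path b b) x =
      if a = b then 1 else 0 := by
    intro b
    have h2 := conv_apply_of_isGroupLikeElem hx (pathCoef k (Quiver.Path.nil : Quiver.Path a a))
      (pathCoef k (Quiver.Path.nil : Quiver.Path b b))
    rw [pathCoef_mul_nil] at h2
    split_ifs with h
    · subst h
      rw [if_pos rfl] at h2
      exact mul_left_cancel₀ ha (by rw [← h2, mul_one])
    · rw [if_neg h] at h2
      exact (mul_eq_zero.1 h2.symm).resolve_left ha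
  refine ⟨a, eq_of_pathCoef_eq fun b c p => ?_⟩
  rw [PathCoalgebra.vertex, pathCoef_path]
  cases p with
  | nil =>
    rw [h1]
    congr 1
    refine propext ⟨fun h => by rw [h], fun h => congrArg Sigma.fst h⟩
  | cons p e =>
    rw [pathCoef_eq_zero_of_isGroupLikeElem hx (by simp), if_neg]
    intro h
    have := congrArg (fun y : Σ a b : V, Quiver.Path a b => y.2.2.length) h
    simp at this

variable (k) in
theorem vertex_injective : Function.Injective (PathCoalgebra.vertex k : V → PathCoalgebra k V) := by
  intro a b h
  exact congrArg Sigma.fst ((PathCoalgebra.basis k V).injective h)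

end GroupLike

/-! ### The trivial extension of a bicharacter is a coquasitriangular structure -/

section TrivialExtension

variable {G : Type v} {X : Type w} [CommGroup G] (c : X → G) {k : Type u} [Field k]
  (χ : G →* G →* kˣ)

/-- If `χ` is symmetric on the labels, the quantum shuffle product is commutative up to the
values of `χ` at the end points. -/
theorem shuffle_comm (hχ : ∀ x h, χ (c x) h * χ h (c x) = 1) (g : G) (l : List X) (h : G)
    (m : List X) : shuffle c χ h m g l =
      ((χ g h)⁻¹ * χ (tgt c g l) (tgt c h m) : kˣ).1 • shuffle c χ g l h m := by
  have hχ' : ∀ x h, (χ (c x) h)⁻¹ = χ h (c x) := fun x h => inv_eq_of_mul_eq_one_right (hχ x h)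
  fun_induction shuffle c χ g l h m with
  | case1 h m =>
    induction m with
    | nil => rw [shuffle, tgt, tgt, inv_mul_cancel, Units.val_one, one_smul, mul_comm]
    | cons y m ih =>
      rw [shuffle, ih, map_smul, snoc_word, smul_smul, ← Units.val_mul, hχ']
      congr 2
      simp only [tgt, map_mul]
      ac_rfl
  | case2 x l h ih =>
    rw [shuffle] at ih ⊢
    rw [← snoc_word, ih, map_smul, smul_smul, ← Units.val_mul]
    congr 2
    simp only [tgt, map_mul, MonoidHom.mul_apply]
    rw [mul_assoc, mul_inv_cancel_right]
  | case3 x l h y m ih1 ih2 =>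
    -- Exchanging the factors interchanges the two summands of the recursion. The scalars of one
    -- pair agree by multiplicativity of `χ` alone, those of the other pair need the symmetry `hχ'`.
    rw [shuffle, ih1, ih2, map_smul, map_smul, smul_add, smul_smul, smul_smul, add_comm,
      ← Units.val_mul, ← Units.val_mul]
    congr 3
    · simp only [tgt, map_mul, MonoidHom.mul_apply]
      rw [mul_mul_mul_comm, mul_assoc (χ g h)⁻¹, mul_inv_cancel_right]
    · rw [hχ']
      simp only [tgt, map_mul, MonoidHom.mul_apply]
      ac_rfl

namespace ShuffleHopf

/-- A path, as an element of the Hopf algebra `kQ`. -/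
noncomputable def wd (g : G) (l : List X) : (shuffleHopf c χ).Carrier := word c k g l

variable {c χ}

theorem wd_mul_wd (g : G) (l : List X) (h : G) (m : List X) :
    wd c χ g l * wd c χ h m = shuffle c χ g l h m := shuffleMul_word c χ g l h m

theorem wd_nil_mul (g h : G) (l : List X) : wd c χ g [] * wd c χ h l = wd c χ (g * h) l :=
  shuffleMul_vertex_word c χ g h l

theorem hom_ext {M : Type*} [AddCommGroup M] [Module k M]
    {f f' : (shuffleHopf c χ).Carrier →ₗ[k] M} (h : ∀ g l, f (wd c χ g l) = f' (wd c χ g l)) :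
    f = f' :=
  word_hom_ext h

theorem induction_on {P : (shuffleHopf c χ).Carrier → Prop} (x : (shuffleHopf c χ).Carrier)
    (h : ∀ g l, P (wd c χ g l)) (h_add : ∀ x y, P x → P y → P (x + y))
    (h_smul : ∀ (r : k) x, P x → P (r • x)) : P x := by
  have hx : x ∈ Submodule.span k (Set.range (wordBasis c k)) :=
    (wordBasis c k).span_eq.symm ▸ Submodule.mem_top (R := k) (M := PathCoalgebra k (Cayley c))
  refine Submodule.span_induction (p := fun x _ => P x) ?_ ?_ (fun x y _ _ => h_add x y)
    (fun r x _ => h_smul r x) hx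
  · rintro _ ⟨p, rfl⟩
    exact h p.1 p.2
  · have := h_smul 0 _ (h 1 [])
    rwa [zero_smul] at this

theorem comul_wd_left {M N : Type*} [AddCommGroup M] [Module k M] [AddCommGroup N] [Module k N]
    {ζ : (shuffleHopf c χ).Carrier →ₗ[k] M} (hζ : ∀ g x l, ζ (wd c χ g (x :: l)) = 0)
    (ψ : (shuffleHopf c χ).Carrier →ₗ[k] N) (g : G) (l : List X) :
    TensorProduct.map ζ ψ (comul (R := k) (wd c χ g l)) =
      ζ (wd c χ (tgt c g l) []) ⊗ₜ[k] ψ (wd c χ g l) :=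
  map_comul_of_left hζ ψ g l

theorem comul_wd_right {M N : Type*} [AddCommGroup M] [Module k M] [AddCommGroup N] [Module k N]
    (ψ : (shuffleHopf c χ).Carrier →ₗ[k] M) {ζ : (shuffleHopf c χ).Carrier →ₗ[k] N}
    (hζ : ∀ g x l, ζ (wd c χ g (x :: l)) = 0) (g : G) (l : List X) :
    TensorProduct.map ψ ζ (comul (R := k) (wd c χ g l)) =
      ψ (wd c χ g l) ⊗ₜ[k] ζ (wd c χ g []) :=
  map_comul_of_right ψ hζ g l

theorem counit_wd (g : G) (l : List X) : counit (R := k) (wd c χ g l) = if l = [] then 1 else 0 :=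
  counit_word g l

theorem isGroupLikeElem_wd (g : G) : IsGroupLikeElem k (wd c χ g []) where
  counit_eq_one := (counit_wd g []).trans (if_pos rfl)
  comul_eq_tmul_self := comul_word_nil g

variable (c χ) in
/-- The vertices form the group of group-like elements. -/
noncomputable def vertexEquiv : G ≃* GroupLike k (shuffleHopf c χ).Carrier :=
  MulEquiv.ofBijective
    ({ toFun := fun g => ⟨wd c χ g [], isGroupLikeElem_wd g⟩
       map_one' := rfl
       map_mul' := fun g h => GroupLike.val_injective (wd_nil_mul g h []).symm } :
      G →* GroupLike k (shuffleHopf c χ).Carrier) <| by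
    refine ⟨fun g h hgh => ?_, fun x => ?_⟩
    · exact congrArg Prod.fst ((wordBasis c k).injective (congrArg GroupLike.val hgh))
    · obtain ⟨⟨g⟩, hg⟩ := exists_eq_vertex_of_isGroupLikeElem (k := k) (V := Cayley c) (x := x.val)
        ⟨x.2.counit_eq_one, x.2.comul_eq_tmul_self⟩
      exact ⟨g, GroupLike.val_injective ((vertex_eq_word (⟨g⟩ : Cayley c)).symm.trans hg.symm)⟩

theorem vertexEquiv_eq (g : G) :
    vertexEquiv c χ g = (shuffleHopf c χ).vertexGroupLike (⟨g⟩ : Cayley c) :=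
  GroupLike.val_injective (vertex_eq_word (⟨g⟩ : Cayley c)).symm

variable (c χ) in
/-- A bicharacter of `G`, as a bicharacter of the group of group-like elements. -/
noncomputable def bichar (ψ : G →* G →* kˣ) : GroupLike k (shuffleHopf c χ).Carrier →*
    GroupLike k (shuffleHopf c χ).Carrier →* kˣ where
  toFun a := (ψ ((vertexEquiv c χ).symm a)).comp (vertexEquiv c χ).symm.toMonoidHom
  map_one' := by ext; simp
  map_mul' a b := by ext; simp

theorem bichar_vertexGroupLike (ψ : G →* G →* kˣ) (a b : Cayley c) :
    bichar c χ ψ ((shuffleHopf c χ).vertexGroupLike a) ((shuffleHopf c χ).vertexGroupLike b) =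
      ψ a.pt b.pt := by
  rw [← vertexEquiv_eq, ← vertexEquiv_eq]
  simp [bichar]

variable (c χ) in
/-- The trivial extension of a bicharacter of `G`. -/
noncomputable abbrev trivExt (ψ : G →* G →* kˣ) :
    (shuffleHopf c χ).Carrier ⊗[k] (shuffleHopf c χ).Carrier →ₗ[k] k :=
  (shuffleHopf c χ).trivialExtension (bichar c χ ψ)

theorem trivExt_wd (ψ : G →* G →* kˣ) (g : G) (l : List X) (h : G) (m : List X) :
    trivExt c χ ψ (wd c χ g l ⊗ₜ[k] wd c χ h m) = if l = [] ∧ m = [] then (ψ g h : k) else 0 := by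
  have h1 : trivExt c χ ψ (wd c χ g l ⊗ₜ[k] wd c χ h m) =
      (shuffleHopf c χ).trivialExtensionBilin (bichar c χ ψ) (word c k g l) (word c k h m) := rfl
  rw [h1, word_eq_path, word_eq_path, GradedHopfStructure.trivialExtensionBilin, PathCoalgebra.path,
    PathCoalgebra.path, Module.Basis.constr_basis, Module.Basis.constr_basis]
  change (if (wordPath c g l).length = 0 ∧ (wordPath c h m).length = 0 then
    (bichar c χ ψ ((shuffleHopf c χ).vertexGroupLike ⟨g⟩)
      ((shuffleHopf c χ).vertexGroupLike ⟨h⟩) : k) else 0) = _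
  simp only [length_wordPath, List.length_eq_zero_iff, bichar_vertexGroupLike]

theorem trivExt_cons_left (ψ : G →* G →* kˣ) (g : G) (x : X) (l : List X)
    (y : (shuffleHopf c χ).Carrier) : trivExt c χ ψ (wd c χ g (x :: l) ⊗ₜ[k] y) = 0 := by
  have : trivExt c χ ψ ∘ₗ TensorProduct.mk k _ _ (wd c χ g (x :: l)) = 0 := hom_ext fun h m => by
    rw [LinearMap.comp_apply, TensorProduct.mk_apply, trivExt_wd, if_neg (by simp)]
    rfl
  exact LinearMap.congr_fun this y

theorem trivExt_cons_right (ψ : G →* G →* kˣ) (g : G) (x : X) (l : List X)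
    (y : (shuffleHopf c χ).Carrier) : trivExt c χ ψ (y ⊗ₜ[k] wd c χ g (x :: l)) = 0 := by
  have : trivExt c χ ψ ∘ₗ (TensorProduct.mk k _ _).flip (wd c χ g (x :: l)) = 0 :=
    hom_ext fun h m => by
      rw [LinearMap.comp_apply, LinearMap.flip_apply, TensorProduct.mk_apply, trivExt_wd,
        if_neg (by simp)]
      rfl
  exact LinearMap.congr_fun this y

variable (c χ) in
/-- The projection onto the span of the vertices. -/
noncomputable def proj : (shuffleHopf c χ).Carrier →ₗ[k] (shuffleHopf c χ).Carrier :=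
  vertexPart c k

theorem proj_nil (g : G) : proj c χ (wd c χ g []) = wd c χ g [] := vertexPart_nil c g

theorem proj_cons (g : G) (x : X) (l : List X) : proj c χ (wd c χ g (x :: l)) = 0 :=
  vertexPart_cons c g x l

theorem proj_mul (x y : (shuffleHopf c χ).Carrier) :
    proj c χ (x * y) = proj c χ x * proj c χ y := vertexPart_shuffleMul c χ x y

/-- The form sees only vertices. In a convolution this collapses the coproduct of each path to a
single cut. -/
theorem trivExt_proj (ψ : G →* G →* kˣ) :
    trivExt c χ ψ ∘ₗ TensorProduct.map (proj c χ) (proj c χ) = trivExt c χ ψ := by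
  refine TensorProduct.ext (hom_ext fun g l => hom_ext fun h m => ?_)
  change trivExt c χ ψ (proj c χ (wd c χ g l) ⊗ₜ[k] proj c χ (wd c χ h m)) =
    trivExt c χ ψ (wd c χ g l ⊗ₜ[k] wd c χ h m)
  cases l with
  | nil =>
    cases m with
    | nil => rw [proj_nil, proj_nil]
    | cons y m => rw [proj_cons, TensorProduct.tmul_zero, map_zero, trivExt_cons_right]
  | cons x l => rw [proj_cons, TensorProduct.zero_tmul, map_zero, trivExt_cons_left]

theorem map_map_tensorComm {A B A' B' C D M N : Type*} [AddCommGroup A] [Module k A]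
    [AddCommGroup B] [Module k B] [AddCommGroup A'] [Module k A'] [AddCommGroup B'] [Module k B']
    [AddCommGroup C] [Module k C] [AddCommGroup D] [Module k D]
    [AddCommGroup M] [Module k M] [AddCommGroup N] [Module k N]
    (f : A →ₗ[k] C) (f' : A' →ₗ[k] D) (ζ : C ⊗[k] D →ₗ[k] M) (Φ : B ⊗[k] B' →ₗ[k] N)
    (z : A ⊗[k] B) (z' : A' ⊗[k] B') :
    TensorProduct.map (ζ ∘ₗ TensorProduct.map f f') Φ
      (TensorProduct.tensorTensorTensorComm k A B A' B' (z ⊗ₜ[k] z')) =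
    TensorProduct.map ζ Φ (TensorProduct.tensorTensorTensorComm k C B D B'
      (f.rTensor B z ⊗ₜ[k] f'.rTensor B' z')) := by
  induction z with
  | zero => simp
  | add x y hx hy => simp only [map_add, TensorProduct.add_tmul, hx, hy]
  | tmul a b =>
    induction z' with
    | zero => simp
    | add x y hx hy => simp only [map_add, TensorProduct.tmul_add, hx, hy]
    | tmul a' b' => simp

theorem map_map_tensorComm' {A B A' B' C D M N : Type*} [AddCommGroup A] [Module k A]
    [AddCommGroup B] [Module k B] [AddCommGroup A'] [Module k A'] [AddCommGroup B'] [Module k B']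
    [AddCommGroup C] [Module k C] [AddCommGroup D] [Module k D]
    [AddCommGroup M] [Module k M] [AddCommGroup N] [Module k N]
    (f : B →ₗ[k] C) (f' : B' →ₗ[k] D) (ζ : C ⊗[k] D →ₗ[k] M) (Φ : A ⊗[k] A' →ₗ[k] N)
    (z : A ⊗[k] B) (z' : A' ⊗[k] B') :
    TensorProduct.map Φ (ζ ∘ₗ TensorProduct.map f f')
      (TensorProduct.tensorTensorTensorComm k A B A' B' (z ⊗ₜ[k] z')) =
    TensorProduct.map Φ ζ (TensorProduct.tensorTensorTensorComm k A C A' D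
      (f.lTensor A z ⊗ₜ[k] f'.lTensor A' z')) := by
  induction z with
  | zero => simp
  | add x y hx hy => simp only [map_add, TensorProduct.add_tmul, hx, hy]
  | tmul a b =>
    induction z' with
    | zero => simp
    | add x y hx hy => simp only [map_add, TensorProduct.tmul_add, hx, hy]
    | tmul a' b' => simp

/-- Applied to the left tensor factors, the form leaves only the cuts with trivial final parts, so
it is evaluated at the end points. Applied to the right factors, as in `map_comul_trivExt`, it is
evaluated at the start points. -/
theorem map_trivExt_comul {N : Type*} [AddCommGroup N] [Module k N] (ψ : G →* G →* kˣ)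
    (Φ : (shuffleHopf c χ).Carrier ⊗[k] (shuffleHopf c χ).Carrier →ₗ[k] N) (g : G) (l : List X)
    (h : G) (m : List X) :
    TensorProduct.map (trivExt c χ ψ) Φ (comul (R := k) (wd c χ g l ⊗ₜ[k] wd c χ h m)) =
      (ψ (tgt c g l) (tgt c h m) : k) ⊗ₜ[k] Φ (wd c χ g l ⊗ₜ[k] wd c χ h m) := by
  rw [← trivExt_proj]
  refine (map_map_tensorComm _ _ _ _ _ _).trans ?_
  rw [LinearMap.rTensor, comul_wd_left proj_cons, comul_wd_left proj_cons, proj_nil, proj_nil,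
    TensorProduct.tensorTensorTensorComm_tmul, TensorProduct.map_tmul, trivExt_wd, if_pos ⟨rfl, rfl⟩]
  rfl

theorem map_comul_trivExt {N : Type*} [AddCommGroup N] [Module k N] (ψ : G →* G →* kˣ)
    (Φ : (shuffleHopf c χ).Carrier ⊗[k] (shuffleHopf c χ).Carrier →ₗ[k] N) (g : G) (l : List X)
    (h : G) (m : List X) :
    TensorProduct.map Φ (trivExt c χ ψ) (comul (R := k) (wd c χ g l ⊗ₜ[k] wd c χ h m)) =
      Φ (wd c χ g l ⊗ₜ[k] wd c χ h m) ⊗ₜ[k] (ψ g h : k) := by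
  rw [← trivExt_proj]
  refine (map_map_tensorComm' _ _ _ _ _ _).trans ?_
  rw [LinearMap.lTensor, comul_wd_right _ proj_cons, comul_wd_right _ proj_cons, proj_nil, proj_nil,
    TensorProduct.tensorTensorTensorComm_tmul, TensorProduct.map_tmul, trivExt_wd, if_pos ⟨rfl, rfl⟩]
  rfl

/-- Together with `trivExt_one` this makes the trivial extension of `χ⁻¹` the convolution inverse of
that of `χ`. -/
theorem trivExt_mul_trivExt (ψ ψ' : G →* G →* kˣ) :
    WithConv.toConv (trivExt c χ ψ) * WithConv.toConv (trivExt c χ ψ') =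
      WithConv.toConv (trivExt c χ (ψ * ψ')) := by
  refine WithConv.ext (TensorProduct.ext (hom_ext fun g l => hom_ext fun h m => ?_))
  change LinearMap.mul' k k (TensorProduct.map (trivExt c χ ψ) (trivExt c χ ψ')
    (comul (R := k) (wd c χ g l ⊗ₜ[k] wd c χ h m))) =
      trivExt c χ (ψ * ψ') (wd c χ g l ⊗ₜ[k] wd c χ h m)
  rw [map_trivExt_comul, LinearMap.mul'_apply, trivExt_wd, trivExt_wd]
  split_ifs with hlm
  · obtain ⟨rfl, rfl⟩ := hlm
    rw [tgt, tgt, ← Units.val_mul]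
    rfl
  · rw [mul_zero]

theorem trivExt_one : WithConv.toConv (trivExt c χ 1) = 1 := by
  refine WithConv.ext (TensorProduct.ext (hom_ext fun g l => hom_ext fun h m => ?_))
  change trivExt c χ 1 (wd c χ g l ⊗ₜ[k] wd c χ h m) =
    counit (R := k) (wd c χ g l ⊗ₜ[k] wd c χ h m)
  rw [trivExt_wd, TensorProduct.counit_tmul, counit_wd, counit_wd]
  cases l <;> cases m <;> simp

/-- As `proj` is multiplicative, both sides vanish on paths unless all three are vertices; there the
claim is multiplicativity of `ψ` in the first variable. -/
theorem trivExt_mul_left (ψ : G →* G →* kˣ) (a b d : (shuffleHopf c χ).Carrier) :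
    trivExt c χ ψ ((a * b) ⊗ₜ[k] d) =
      LinearMap.mul' k k (TensorProduct.map (trivExt c χ ψ ∘ₗ TensorProduct.mk k _ _ a)
        (trivExt c χ ψ ∘ₗ TensorProduct.mk k _ _ b) (comul (R := k) d)) := by
  induction a using induction_on with
  | h_add x y hx hy => simp only [add_mul, TensorProduct.add_tmul, map_add, hx, hy, LinearMap.comp_add,
      TensorProduct.map_add_left, LinearMap.add_apply]
  | h_smul r x hx => simp only [smul_mul_assoc, ← TensorProduct.smul_tmul', map_smul, hx,
      LinearMap.comp_smul, TensorProduct.map_smul_left, LinearMap.smul_apply]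
  | h g l =>
  induction b using induction_on with
  | h_add x y hx hy => simp only [mul_add, TensorProduct.add_tmul, map_add, hx, hy, LinearMap.comp_add,
      TensorProduct.map_add_right, LinearMap.add_apply]
  | h_smul r x hx => simp only [mul_smul_comm, ← TensorProduct.smul_tmul', map_smul, hx,
      LinearMap.comp_smul, TensorProduct.map_smul_right, LinearMap.smul_apply]
  | h h m =>
  induction d using induction_on with
  | h_add x y hx hy => simp only [TensorProduct.tmul_add, map_add, hx, hy]
  | h_smul r x hx => simp only [TensorProduct.tmul_smul, map_smul, hx]
  | h s n =>
  rw [comul_wd_left (fun g' x l' => trivExt_cons_right ψ g' x l' _), LinearMap.mul'_apply]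
  simp only [LinearMap.comp_apply, TensorProduct.mk_apply]
  have hp : ∀ z y, trivExt c χ ψ (z ⊗ₜ[k] y) = trivExt c χ ψ (proj c χ z ⊗ₜ[k] proj c χ y) :=
    fun z y => (LinearMap.congr_fun (trivExt_proj ψ) (z ⊗ₜ[k] y)).symm
  rw [hp, proj_mul]
  cases n with
  | cons x n => rw [proj_cons, TensorProduct.tmul_zero, map_zero, trivExt_cons_right, mul_zero]
  | nil =>
  cases l with
  | cons x l => rw [proj_cons, zero_mul, TensorProduct.zero_tmul, map_zero, trivExt_cons_left,
      zero_mul]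
  | nil =>
  cases m with
  | cons x m => rw [proj_cons, mul_zero, TensorProduct.zero_tmul, map_zero, trivExt_cons_left,
      mul_zero]
  | nil =>
  simp only [proj_nil, wd_nil_mul, trivExt_wd, and_self, if_true, tgt, map_mul, MonoidHom.mul_apply,
    Units.val_mul]

theorem trivExt_mul_right (ψ : G →* G →* kˣ) (a b d : (shuffleHopf c χ).Carrier) :
    trivExt c χ ψ (a ⊗ₜ[k] (b * d)) =
      LinearMap.mul' k k (TensorProduct.map (trivExt c χ ψ ∘ₗ (TensorProduct.mk k _ _).flip d)
        (trivExt c χ ψ ∘ₗ (TensorProduct.mk k _ _).flip b) (comul (R := k) a)) := by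
  induction b using induction_on with
  | h_add x y hx hy => simp only [add_mul, TensorProduct.tmul_add, map_add, hx, hy,
      LinearMap.comp_add, TensorProduct.map_add_right, LinearMap.add_apply]
  | h_smul r x hx => simp only [smul_mul_assoc, TensorProduct.tmul_smul, map_smul, hx,
      LinearMap.comp_smul, TensorProduct.map_smul_right, LinearMap.smul_apply]
  | h h m =>
  induction d using induction_on with
  | h_add x y hx hy => simp only [mul_add, TensorProduct.tmul_add, map_add, hx, hy,
      LinearMap.comp_add, TensorProduct.map_add_left, LinearMap.add_apply]
  | h_smul r x hx => simp only [mul_smul_comm, TensorProduct.tmul_smul, map_smul, hx,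
      LinearMap.comp_smul, TensorProduct.map_smul_left, LinearMap.smul_apply]
  | h s n =>
  induction a using induction_on with
  | h_add x y hx hy => simp only [TensorProduct.add_tmul, map_add, hx, hy]
  | h_smul r x hx => simp only [← TensorProduct.smul_tmul', map_smul, hx]
  | h g l =>
  rw [comul_wd_left (fun g' x l' => trivExt_cons_left ψ g' x l' _), LinearMap.mul'_apply]
  simp only [LinearMap.comp_apply, LinearMap.flip_apply, TensorProduct.mk_apply]
  have hp : ∀ z y, trivExt c χ ψ (z ⊗ₜ[k] y) = trivExt c χ ψ (proj c χ z ⊗ₜ[k] proj c χ y) :=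
    fun z y => (LinearMap.congr_fun (trivExt_proj ψ) (z ⊗ₜ[k] y)).symm
  rw [hp, proj_mul]
  cases l with
  | cons x n => rw [proj_cons, TensorProduct.zero_tmul, map_zero, trivExt_cons_left, mul_zero]
  | nil =>
  cases m with
  | cons x l => rw [proj_cons, zero_mul, TensorProduct.tmul_zero, map_zero,
      trivExt_cons_right ψ h, mul_zero]
  | nil =>
  cases n with
  | cons x m => rw [proj_cons, mul_zero, TensorProduct.tmul_zero, map_zero,
      trivExt_cons_right ψ s, zero_mul]
  | nil =>
  simp only [proj_nil, wd_nil_mul, trivExt_wd, and_self, if_true, tgt, map_mul, Units.val_mul]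
  rw [mul_comm]

/-- If `χ` is symmetric on the labels, then its trivial extension is a coquasitriangular structure
on the Hopf algebra of paths. -/
theorem isCoquasitriangular_trivExt (hχ : ∀ x h, χ (c x) h * χ h (c x) = 1) :
    IsCoquasitriangular (trivExt c χ χ) where
  isUnit := by
    refine ⟨⟨_, WithConv.toConv (trivExt c χ χ⁻¹), ?_, ?_⟩, rfl⟩
    · rw [trivExt_mul_trivExt, mul_inv_cancel, trivExt_one]
    · rw [trivExt_mul_trivExt, inv_mul_cancel, trivExt_one]
  mul_left := trivExt_mul_left χ
  mul_right := trivExt_mul_right χ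
  comm a b := by
    induction a using induction_on with
    | h_add x y hx hy => simp only [TensorProduct.add_tmul, map_add, hx, hy]
    | h_smul r x hx => simp only [← TensorProduct.smul_tmul', map_smul, hx]
    | h g l =>
    induction b using induction_on with
    | h_add x y hx hy => simp only [TensorProduct.tmul_add, map_add, hx, hy]
    | h_smul r x hx => simp only [TensorProduct.tmul_smul, map_smul, hx]
    | h h m =>
    -- The form is taken at the start points on the left-hand side and at the end points on the
    -- right-hand side, so the axiom is the content of `shuffle_comm`.
    rw [map_comul_trivExt, map_trivExt_comul, TensorProduct.rid_tmul, TensorProduct.lid_tmul]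
    simp only [LinearMap.comp_apply, LinearEquiv.coe_coe, TensorProduct.comm_tmul,
      LinearMap.mul'_apply]
    rw [wd_mul_wd, wd_mul_wd]
    refine (congrArg _ (shuffle_comm c χ hχ g l h m)).trans ?_
    refine (smul_smul (χ g h : k) _ (shuffle c χ g l h m)).trans ?_
    have : (χ g h * ((χ g h)⁻¹ * χ (tgt c g l) (tgt c h m)) : kˣ) = _ := mul_inv_cancel_left _ _
    rw [← Units.val_mul, this]
    rfl

end ShuffleHopf

end TrivialExtension

/-! ### The universal property of the path coalgebra -/

section Universal

variable {G : Type v} {X : Type w} [CommGroup G] {c : X → G} {k : Type u} [Field k]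

theorem tgt_append (c : X → G) (g : G) (m l : List X) : tgt c g (m ++ l) = tgt c (tgt c g l) m := by
  induction m with
  | nil => rfl
  | cons y m ih => rw [List.cons_append, tgt, tgt, ih]

theorem coef_nil_mul (h g : G) (l : List X) [Decidable (h = tgt c g l)] :
    coef c k h [] * coef c k g l = if h = tgt c g l then coef c k g l else 0 := by
  classical
  refine WithConv.ext (word_hom_ext fun s m => ?_)
  change LinearMap.mul' k k (TensorProduct.map (coef c k h []).ofConv (coef c k g l).ofConv
    (comul (R := k) (word c k s m))) = _
  rw [map_comul_of_left (ζ := (coef c k h []).ofConv) (fun g' y l => by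
    change coef c k _ [] (word c k g' (y :: l)) = 0
    rw [coef_word, if_neg (by simp)]), LinearMap.mul'_apply]
  change coef c k h [] (word c k (tgt c s m) []) * coef c k g l (word c k s m) = _
  split_ifs with hh
  · change _ = coef c k g l (word c k s m)
    rw [coef_word, coef_word]
    by_cases h' : g = s ∧ l = m
    · obtain ⟨rfl, rfl⟩ := h'
      simp [hh]
    · simp [h']
  · change _ = (0 : k)
    rw [coef_word, coef_word]
    by_cases h' : g = s ∧ l = m
    · obtain ⟨rfl, rfl⟩ := h'
      simp [hh]
    · simp [h']

variable {C : Type w'} [AddCommGroup C] [Module k C] [Coalgebra k C]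

variable (c) in
/-- The convolution product of forms prescribed on the vertices and on the arrows, along a path. -/
noncomputable def wordForm (e : G → WithConv (C →ₗ[k] k)) (f : G → X → WithConv (C →ₗ[k] k))
    (g : G) : List X → WithConv (C →ₗ[k] k)
  | [] => e g
  | x :: l => f (tgt c g l) x * wordForm e f g l

variable {e : G → WithConv (C →ₗ[k] k)} {f : G → X → WithConv (C →ₗ[k] k)}

-- The hypotheses are orthogonality of the vertex forms and absorption of the vertex form at the end
-- point of an arrow. The start point needs no condition, because the form of every path has `e g`
-- as its rightmost factor.
open Classical in
theorem wordForm_mul_wordForm (he : ∀ g h, e g * e h = if g = h then e g else 0)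
    (hf : ∀ g x, e (g * c x) * f g x = f g x)
    (h : G) (m : List X) (g : G) (l : List X) :
    wordForm c e f h m * wordForm c e f g l =
      if h = tgt c g l then wordForm c e f g (m ++ l) else 0 := by
  induction m with
  | nil =>
    cases l with
    | nil =>
      simp only [wordForm, he, tgt, List.append_nil]
      split_ifs with hh
      · rw [hh]
      · rfl
    | cons x l =>
      simp only [wordForm, tgt, List.nil_append]
      rw [← hf, ← mul_assoc, ← mul_assoc, he]
      split_ifs with hh
      · rw [hh]
      · rw [zero_mul, zero_mul]
  | cons y m ih =>
    simp only [wordForm, List.cons_append]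
    rw [mul_assoc, ih]
    split_ifs with hh
    · rw [hh, tgt_append]
    · rw [mul_zero]

theorem coef_eq_wordForm (g : G) (l : List X) :
    coef c k g l = wordForm c (fun g => coef c k g []) (fun g x => coef c k g [x]) g l := by
  induction l with
  | nil => rfl
  | cons x l ih => rw [coef_cons, ih]; rfl

open Classical in
theorem coef_mul_coef (h : G) (m : List X) (g : G) (l : List X) :
    coef c k h m * coef c k g l = if h = tgt c g l then coef c k g (m ++ l) else 0 := by
  rw [coef_eq_wordForm, coef_eq_wordForm, wordForm_mul_wordForm, ← coef_eq_wordForm]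
  · intro g h
    rw [coef_nil_mul]
    by_cases hh : g = h
    · simp [hh, tgt]
    · simp [hh, tgt]
  · intro g x
    rw [coef_nil_mul, if_pos]
    rfl

/-- The coproduct of `y` is a finite sum. Each of its terms meets finitely many arrow forms and, by
induction, finitely many forms of words shorter by one arrow. -/
theorem finite_wordForm (he : ∀ y, {g | e g y ≠ 0}.Finite)
    (hf : ∀ y, {p : G × X | f p.1 p.2 y ≠ 0}.Finite) (n : ℕ) (y : C) :
    {p : G × List X | p.2.length = n ∧ wordForm c e f p.1 p.2 y ≠ 0}.Finite := by
  induction n generalizing y with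
  | zero =>
    refine ((he y).image fun g => (g, ([] : List X))).subset ?_
    rintro ⟨g, l⟩ ⟨hl, h⟩
    obtain rfl := List.length_eq_zero_iff.1 hl
    exact ⟨g, h, rfl⟩
  | succ n ih =>
    obtain ⟨s, hs⟩ := TensorProduct.exists_finset (R := k) (comul (R := k) y)
    refine Set.Finite.subset (Set.Finite.biUnion s.finite_toSet fun i _ =>
      (hf i.1).image2 (fun a b => (b.1, a.2 :: b.2)) (ih i.2)) ?_
    rintro ⟨g, _ | ⟨x, l⟩⟩ ⟨hl, h⟩
    · cases hl
    have h' : LinearMap.mul' k k (TensorProduct.map (f (tgt c g l) x).ofConv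
      (wordForm c e f g l).ofConv (comul (R := k) y)) ≠ 0 := h
    rw [hs, map_sum, map_sum] at h'
    obtain ⟨i, hi, hne⟩ := Finset.exists_ne_zero_of_sum_ne_zero h'
    rw [TensorProduct.map_tmul, LinearMap.mul'_apply] at hne
    refine Set.mem_biUnion (Finset.mem_coe.2 hi) ⟨(tgt c g l, x), ?_, (g, l), ⟨?_, ?_⟩, rfl⟩
    · exact left_ne_zero_of_mul hne
    · exact Nat.succ.inj hl
    · exact right_ne_zero_of_mul hne

/-- The components of an element along the vertices. -/
noncomputable def vertexCoef (c : X → G) (k : Type u) [Field k] :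
    PathCoalgebra k (Cayley c) →ₗ[k] G →₀ k :=
  wordLift fun g l => if l.length = 0 then Finsupp.single g 1 else 0

theorem vertexCoef_apply (z : PathCoalgebra k (Cayley c)) (g : G) :
    vertexCoef c k z g = coef c k g [] z := by
  classical
  have : Finsupp.lapply g ∘ₗ vertexCoef c k = (coef c k g []).ofConv := word_hom_ext fun h l => by
    refine Eq.trans ?_ (coef_word g [] h l).symm
    rw [LinearMap.comp_apply, vertexCoef, wordLift_word]
    cases l <;> simp [Finsupp.single_apply, eq_comm]
  exact LinearMap.congr_fun this z

theorem counit_eq_vertexCoef (z : PathCoalgebra k (Cayley c)) :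
    counit (R := k) z = Finsupp.linearCombination k (fun _ : G => (1 : k)) (vertexCoef c k z) := by
  have : counit (R := k) = Finsupp.linearCombination k (fun _ : G => (1 : k)) ∘ₗ vertexCoef c k :=
    word_hom_ext fun h l => by
      rw [LinearMap.comp_apply, vertexCoef, wordLift_word, counit_word]
      cases l <;> simp
  exact LinearMap.congr_fun this z

/-- The universal property of the path coalgebra: forms on the vertices and on the arrows which
satisfy the obvious relations come from a morphism of coalgebras. -/
theorem exists_coalgHom (E : C →ₗ[k] G →₀ k) (hE : ∀ g y, e g y = E y g)
    (hcounit : ∀ y, counit (R := k) y = Finsupp.linearCombination k (fun _ : G => (1 : k)) (E y))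
    (he : ∀ g, e g * e g = e g) (he' : ∀ g h, g ≠ h → e g * e h = 0)
    (hf : ∀ g x, e (g * c x) * f g x = f g x)
    (hfin : ∀ y, {p : G × X | f p.1 p.2 y ≠ 0}.Finite)
    (hnil : ∀ y, ∃ N, ∀ g l, N ≤ l.length → wordForm c e f g l y = 0) :
    ∃ F : C →ₗc[k] PathCoalgebra k (Cayley c),
      ∀ g l y, coef c k g l (F y) = wordForm c e f g l y := by
  classical
  have hefin : ∀ y, {g | e g y ≠ 0}.Finite := fun y => by
    refine (E y).support.finite_toSet.subset fun g hg => ?_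
    rw [Finset.mem_coe, Finsupp.mem_support_iff, ← hE]
    exact hg
  -- The image of `y` must have finite support: `hnil` bounds the lengths, and each length
  -- contributes finitely many words.
  have hsupp : ∀ y, {p : G × List X | wordForm c e f p.1 p.2 y ≠ 0}.Finite := by
    intro y
    obtain ⟨N, hN⟩ := hnil y
    refine Set.Finite.subset (Set.Finite.biUnion (Finset.range N).finite_toSet fun n _ =>
      finite_wordForm (c := c) hefin hfin n y) fun p hp => ?_
    refine Set.mem_biUnion (x := p.2.length) ?_ ⟨rfl, hp⟩
    rw [Finset.mem_coe, Finset.mem_range]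
    by_contra h
    exact hp (hN _ _ (not_lt.1 h))
  let F₀ : C → PathCoalgebra k (Cayley c) := fun y => (wordBasis c k).repr.symm
    (Finsupp.onFinset (hsupp y).toFinset (fun p => wordForm c e f p.1 p.2 y)
      (fun p hp => (hsupp y).mem_toFinset.2 hp))
  have hF₀ : ∀ g l y, coef c k g l (F₀ y) = wordForm c e f g l y := by
    intro g l y
    change (wordBasis c k).repr (F₀ y) (g, l) = _
    rw [LinearEquiv.apply_symm_apply]
    rfl
  let F : C →ₗ[k] PathCoalgebra k (Cayley c) :=
    { toFun := F₀
      map_add' := fun y z => eq_of_coef_eq fun g l => by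
        refine ((hF₀ g l _).trans ?_).trans (map_add (coef c k g l).ofConv _ _).symm
        refine ((wordForm c e f g l).ofConv.map_add y z).trans ?_
        exact congrArg₂ _ (hF₀ g l y).symm (hF₀ g l z).symm
      map_smul' := fun r y => eq_of_coef_eq fun g l => by
        refine ((hF₀ g l _).trans ?_).trans (map_smul (coef c k g l).ofConv _ _).symm
        refine ((wordForm c e f g l).ofConv.map_smul r y).trans ?_
        exact congrArg _ (hF₀ g l y).symm }
  have hF : ∀ g l, (coef c k g l).ofConv ∘ₗ F = (wordForm c e f g l).ofConv :=
    fun g l => LinearMap.ext fun y => hF₀ g l y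
  have hee : ∀ g h, e g * e h = if g = h then e g else 0 := fun g h => by
    split_ifs with hh
    · rw [← hh, he]
    · exact he' g h hh
  refine ⟨{ F with
    counit_comp := LinearMap.ext fun y => ?_
    map_comp_comul := LinearMap.ext fun y => ?_ }, fun g l y => hF₀ g l y⟩
  · change counit (R := k) (F y) = counit (R := k) y
    rw [counit_eq_vertexCoef, hcounit]
    congr 1
    ext g
    rw [vertexCoef_apply, ← hE]
    exact hF₀ g [] y
  · change TensorProduct.map F F (comul (R := k) y) = comul (R := k) (F y)
    -- Tested on pairs of coefficients, compatibility with the coproduct says that the forms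
    -- `wordForm` multiply under convolution by the same rule as the coefficients `coef`.
    refine tensor_eq_of_coef_eq c fun h m g l => (TensorProduct.lid k k).injective ?_
    have h1 : LinearMap.mul' k k (TensorProduct.map (coef c k h m).ofConv (coef c k g l).ofConv
        (comul (R := k) (F y))) = (coef c k h m * coef c k g l) (F y) := rfl
    have h2 : LinearMap.mul' k k (TensorProduct.map (coef c k h m).ofConv (coef c k g l).ofConv
        (TensorProduct.map F F (comul (R := k) y))) =
        (wordForm c e f h m * wordForm c e f g l) y := by
      rw [TensorProduct.map_map, hF, hF]
      rfl
    refine h2.trans (Eq.trans ?_ h1.symm)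
    rw [wordForm_mul_wordForm hee hf, coef_mul_coef]
    split_ifs
    · exact (hF₀ _ _ y).symm
    · rfl

end Universal

/-! ### The actions of linear forms on a coalgebra -/

section Action

variable {k : Type u} {C : Type v} [Field k] [AddCommGroup C] [Module k C] [Coalgebra k C]

/-- The operator `y ↦ φ(y₂) y₁`. -/
noncomputable def actR (φ : WithConv (C →ₗ[k] k)) : C →ₗ[k] C :=
  (TensorProduct.rid k C).toLinearMap ∘ₗ TensorProduct.map LinearMap.id φ.ofConv ∘ₗ comul

/-- The operator `y ↦ φ(y₁) y₂`. -/
noncomputable def actL (φ : WithConv (C →ₗ[k] k)) : C →ₗ[k] C :=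
  (TensorProduct.lid k C).toLinearMap ∘ₗ TensorProduct.map φ.ofConv LinearMap.id ∘ₗ comul

theorem apply_actR (ψ φ : WithConv (C →ₗ[k] k)) (y : C) : ψ (actR φ y) = (ψ * φ) y := by
  change ψ.ofConv (actR φ y) = LinearMap.mul' k k (TensorProduct.map ψ.ofConv φ.ofConv
    (comul (R := k) y))
  simp only [actR, LinearMap.comp_apply, LinearEquiv.coe_coe]
  induction comul (R := k) y with
  | zero => simp
  | add x y hx hy => simp only [map_add, hx, hy]
  | tmul a b => simp [mul_comm]

theorem apply_actL (ψ φ : WithConv (C →ₗ[k] k)) (y : C) : ψ (actL φ y) = (φ * ψ) y := by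
  change ψ.ofConv (actL φ y) = LinearMap.mul' k k (TensorProduct.map φ.ofConv ψ.ofConv
    (comul (R := k) y))
  simp only [actL, LinearMap.comp_apply, LinearEquiv.coe_coe]
  induction comul (R := k) y with
  | zero => simp
  | add x y hx hy => simp only [map_add, hx, hy]
  | tmul a b => simp

/-- Coassociativity: contracting the right end of the coproduct leaves the left tensor factor
untouched. -/
theorem comul_actR (φ : WithConv (C →ₗ[k] k)) (y : C) :
    comul (R := k) (actR φ y) = (actR φ).lTensor C (comul (R := k) y) := by
  have h1 : comul (R := k) ∘ₗ (TensorProduct.rid k C).toLinearMap ∘ₗ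
      TensorProduct.map LinearMap.id φ.ofConv = ((TensorProduct.rid k (C ⊗[k] C)).toLinearMap ∘ₗ
        TensorProduct.map LinearMap.id φ.ofConv) ∘ₗ (comul (R := k)).rTensor C :=
    TensorProduct.ext' fun a b => by simp
  have h2 : ((TensorProduct.rid k (C ⊗[k] C)).toLinearMap ∘ₗ
        TensorProduct.map LinearMap.id φ.ofConv) ∘ₗ (TensorProduct.assoc k C C C).symm.toLinearMap =
      ((TensorProduct.rid k C).toLinearMap ∘ₗ
        TensorProduct.map LinearMap.id φ.ofConv).lTensor C :=
    TensorProduct.ext' fun a b => by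
      induction b with
      | zero => simp
      | add x y hx hy => simp only [TensorProduct.tmul_add, map_add, hx, hy]
      | tmul b d => simp
  have h3 := LinearMap.congr_fun h1 (comul (R := k) y)
  have h4 := LinearMap.congr_fun h2 ((comul (R := k)).lTensor C (comul (R := k) y))
  simp only [LinearMap.comp_apply, LinearEquiv.coe_coe, coassoc_symm_apply] at h3 h4
  change comul (R := k) (TensorProduct.rid k C _) = _
  refine h3.trans (h4.trans ?_)
  rw [← LinearMap.comp_apply, ← LinearMap.lTensor_comp]
  rfl

theorem comul_actL (φ : WithConv (C →ₗ[k] k)) (y : C) :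
    comul (R := k) (actL φ y) = (actL φ).rTensor C (comul (R := k) y) := by
  have h1 : comul (R := k) ∘ₗ (TensorProduct.lid k C).toLinearMap ∘ₗ
      TensorProduct.map φ.ofConv LinearMap.id = ((TensorProduct.lid k (C ⊗[k] C)).toLinearMap ∘ₗ
        TensorProduct.map φ.ofConv LinearMap.id) ∘ₗ (comul (R := k)).lTensor C :=
    TensorProduct.ext' fun a b => by simp
  have h2 : ((TensorProduct.lid k (C ⊗[k] C)).toLinearMap ∘ₗ
        TensorProduct.map φ.ofConv LinearMap.id) ∘ₗ (TensorProduct.assoc k C C C).toLinearMap =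
      ((TensorProduct.lid k C).toLinearMap ∘ₗ
        TensorProduct.map φ.ofConv LinearMap.id).rTensor C :=
    TensorProduct.ext' fun b a => by
      induction b with
      | zero => simp
      | add x y hx hy => simp only [TensorProduct.add_tmul, map_add, hx, hy]
      | tmul b d => simp [TensorProduct.smul_tmul']
  have h3 := LinearMap.congr_fun h1 (comul (R := k) y)
  have h4 := LinearMap.congr_fun h2 ((comul (R := k)).rTensor C (comul (R := k) y))
  simp only [LinearMap.comp_apply, LinearEquiv.coe_coe, coassoc_apply] at h3 h4
  change comul (R := k) (TensorProduct.lid k C _) = _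
  refine h3.trans (h4.trans ?_)
  rw [← LinearMap.comp_apply, ← LinearMap.rTensor_comp]
  rfl

theorem actR_actR (φ ψ : WithConv (C →ₗ[k] k)) (y : C) :
    actR φ (actR ψ y) = actR (φ * ψ) y := by
  change TensorProduct.rid k C (TensorProduct.map LinearMap.id φ.ofConv (comul (R := k) _)) = _
  rw [comul_actR, LinearMap.lTensor, TensorProduct.map_map, LinearMap.comp_id,
    show φ.ofConv ∘ₗ actR ψ = (φ * ψ).ofConv from LinearMap.ext (apply_actR φ ψ)]
  rfl

theorem actL_actL (φ ψ : WithConv (C →ₗ[k] k)) (y : C) :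
    actL φ (actL ψ y) = actL (ψ * φ) y := by
  change TensorProduct.lid k C (TensorProduct.map φ.ofConv LinearMap.id (comul (R := k) _)) = _
  rw [comul_actL, LinearMap.rTensor, TensorProduct.map_map, LinearMap.comp_id,
    show φ.ofConv ∘ₗ actL ψ = (ψ * φ).ofConv from LinearMap.ext (apply_actL φ ψ)]
  rfl

theorem actL_actR (φ ψ : WithConv (C →ₗ[k] k)) (y : C) :
    actL φ (actR ψ y) = actR ψ (actL φ y) := by
  change TensorProduct.lid k C (TensorProduct.map φ.ofConv LinearMap.id (comul (R := k) _)) =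
    actR ψ (TensorProduct.lid k C (TensorProduct.map φ.ofConv LinearMap.id (comul (R := k) y)))
  rw [comul_actR]
  induction comul (R := k) y with
  | zero => simp
  | add x y hx hy => simp only [map_add, hx, hy]
  | tmul a b => simp

end Action

namespace Gr

/-! ### The grading of the associated graded coalgebra -/

section Grading

variable {k : Type u} {C : Type v} [Field k] [AddCommGroup C] [Module k C] [Coalgebra k C]

theorem induction_on {P : Gr k C → Prop} (y : Gr k C)
    (symb : ∀ n, ∀ x ∈ coradFiltration k C n, P (symb k C n x))
    (add : ∀ x y, P x → P y → P (x + y)) : P y := by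
  refine DirectSum.induction_on (β := fun n => GrPiece k C n) (motive := P) y ?_ ?_ add
  · have := symb 0 0 (zero_mem _)
    rwa [map_zero] at this
  · intro n x
    obtain ⟨x, rfl⟩ := Submodule.Quotient.mk_surjective _ x
    have := symb n x.1 x.2
    rw [symb_eq_cls x.2] at this
    exact this

variable (k C) in
/-- The projection onto the component of degree `n`. -/
noncomputable def proj (n : ℕ) : Gr k C →ₗ[k] Gr k C :=
  lift (fun m => if m = n then cls k C m else 0) <| by
    intro m x hx
    split_ifs with h
    · exact (symb_eq_cls x.2).symm.trans (symb_eq_zero hx)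
    · rfl

theorem proj_symb_self {n : ℕ} {x : C} (hx : x ∈ coradFiltration k C n) :
    proj k C n (symb k C n x) = symb k C n x :=
  (lift_symb _ _ hx).trans (by rw [if_pos rfl, symb_eq_cls hx])

theorem proj_symb_of_ne {m n : ℕ} (h : m ≠ n) {x : C} (hx : x ∈ coradFiltration k C m) :
    proj k C n (symb k C m x) = 0 :=
  (lift_symb _ _ hx).trans (by rw [if_neg h]; rfl)

theorem exists_eq_symb (n : ℕ) (y : Gr k C) :
    ∃ x ∈ coradFiltration k C n, proj k C n y = symb k C n x := by
  induction y using induction_on with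
  | symb m x hx =>
    by_cases h : m = n
    · subst h
      exact ⟨x, hx, proj_symb_self hx⟩
    · exact ⟨0, zero_mem _, by rw [proj_symb_of_ne h hx, map_zero]⟩
  | add y y' hy hy' =>
    obtain ⟨x, hx, h⟩ := hy
    obtain ⟨x', hx', h'⟩ := hy'
    exact ⟨x + x', add_mem hx hx', by rw [map_add, map_add, h, h']⟩

theorem proj_proj (n : ℕ) (y : Gr k C) : proj k C n (proj k C n y) = proj k C n y := by
  obtain ⟨x, hx, h⟩ := exists_eq_symb n y
  rw [h, proj_symb_self hx]

theorem exists_sum_proj (y : Gr k C) : ∃ N, ∀ M ≥ N, y = ∑ n ∈ Finset.range M, proj k C n y := by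
  induction y using induction_on with
  | symb m x hx =>
    refine ⟨m + 1, fun M hM => ?_⟩
    rw [Finset.sum_eq_single m, proj_symb_self hx]
    · exact fun n _ hn => proj_symb_of_ne hn.symm hx
    · intro h
      exact absurd (Finset.mem_range.2 hM) h
  | add y y' hy hy' =>
    obtain ⟨N, h⟩ := hy
    obtain ⟨N', h'⟩ := hy'
    refine ⟨max N N', fun M hM => ?_⟩
    simp only [map_add, Finset.sum_add_distrib]
    rw [← h M (le_of_max_le_left hM), ← h' M (le_of_max_le_right hM)]

theorem eq_zero_of_proj_eq_zero {y : Gr k C} (h : ∀ n, proj k C n y = 0) : y = 0 := by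
  obtain ⟨N, hN⟩ := exists_sum_proj y
  rw [hN N le_rfl]
  exact Finset.sum_eq_zero fun n _ => h n

/-- A linear map on `gr C` which vanishes on the components of degree different from `n`. -/
def HasDegree {M : Type*} [AddCommGroup M] [Module k M] (n : ℕ) (φ : Gr k C →ₗ[k] M) : Prop :=
  ∀ m, m ≠ n → ∀ x ∈ coradFiltration k C m, φ (symb k C m x) = 0

theorem HasDegree.apply_proj {M : Type*} [AddCommGroup M] [Module k M] {n : ℕ}
    {φ : Gr k C →ₗ[k] M} (h : HasDegree n φ) (y : Gr k C) : φ (proj k C n y) = φ y := by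
  have : φ ∘ₗ proj k C n = φ := hom_ext fun m x hx => by
    rw [LinearMap.comp_apply]
    by_cases hm : m = n
    · subst hm
      rw [proj_symb_self hx]
    · rw [proj_symb_of_ne hm hx, map_zero, h m hm x hx]
  exact LinearMap.congr_fun this y

theorem HasDegree.mul {m n : ℕ} {φ ψ : WithConv (Gr k C →ₗ[k] k)} (hφ : HasDegree m φ.ofConv)
    (hψ : HasDegree n ψ.ofConv) : HasDegree (m + n) (φ * ψ).ofConv := by
  intro p hp x hx
  change LinearMap.mul' k k (TensorProduct.map φ.ofConv ψ.ofConv (comul (R := k) _)) = 0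
  rw [comul_symb hx]
  refine tensFiltration_ext (f := LinearMap.mul' k k ∘ₗ TensorProduct.map φ.ofConv ψ.ofConv ∘ₗ
    symb₂ k C p) (g := 0) (fun i j hij a ha b hb => ?_) (comul_mem_tensFiltration hx)
  subst hij
  simp only [LinearMap.comp_apply, symb₂_tmul ha hb, TensorProduct.map_tmul, LinearMap.mul'_apply,
    LinearMap.zero_apply]
  by_cases hi : i = m
  · rw [hψ j (by omega) b hb, mul_zero]
  · rw [hφ i hi a ha, zero_mul]

/-- A form of degree zero pairs only with the degree zero part of the second tensor factor, so the
first factor keeps the full degree. -/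
theorem proj_actR {φ : WithConv (Gr k C →ₗ[k] k)} (hφ : HasDegree 0 φ.ofConv) (n : ℕ)
    (y : Gr k C) : proj k C n (actR φ y) = actR φ (proj k C n y) := by
  have key : ∀ m, ∀ x ∈ coradFiltration k C m,
      proj k C m (actR φ (symb k C m x)) = actR φ (symb k C m x) := by
    intro m x hx
    simp only [actR, LinearMap.comp_apply, comul_symb hx]
    refine tensFiltration_ext (f := proj k C m ∘ₗ (TensorProduct.rid k (Gr k C)).toLinearMap ∘ₗ
      TensorProduct.map LinearMap.id φ.ofConv ∘ₗ symb₂ k C m)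
      (g := (TensorProduct.rid k (Gr k C)).toLinearMap ∘ₗ
      TensorProduct.map LinearMap.id φ.ofConv ∘ₗ symb₂ k C m) (fun i j hij a ha b hb => ?_)
      (comul_mem_tensFiltration hx)
    subst hij
    simp only [LinearMap.comp_apply, symb₂_tmul ha hb, TensorProduct.map_tmul, LinearMap.id_apply,
      LinearEquiv.coe_coe, TensorProduct.rid_tmul, map_smul]
    by_cases hj : j = 0
    · subst hj
      rw [add_zero, proj_symb_self ha]
    · rw [hφ j hj b hb, zero_smul, zero_smul]
  have : proj k C n ∘ₗ actR φ = actR φ ∘ₗ proj k C n := hom_ext fun m x hx => by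
    simp only [LinearMap.comp_apply]
    by_cases hm : m = n
    · subst hm
      rw [key m x hx, proj_symb_self hx]
    · obtain ⟨x', hx', h⟩ := exists_eq_symb m (actR φ (symb k C m x))
      rw [← key m x hx, h, proj_symb_of_ne hm hx', proj_symb_of_ne hm hx, map_zero]
  exact LinearMap.congr_fun this y

theorem proj_actL {φ : WithConv (Gr k C →ₗ[k] k)} (hφ : HasDegree 0 φ.ofConv) (n : ℕ)
    (y : Gr k C) : proj k C n (actL φ y) = actL φ (proj k C n y) := by
  have key : ∀ m, ∀ x ∈ coradFiltration k C m,
      proj k C m (actL φ (symb k C m x)) = actL φ (symb k C m x) := by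
    intro m x hx
    simp only [actL, LinearMap.comp_apply, comul_symb hx]
    refine tensFiltration_ext (f := proj k C m ∘ₗ (TensorProduct.lid k (Gr k C)).toLinearMap ∘ₗ
      TensorProduct.map φ.ofConv LinearMap.id ∘ₗ symb₂ k C m)
      (g := (TensorProduct.lid k (Gr k C)).toLinearMap ∘ₗ
      TensorProduct.map φ.ofConv LinearMap.id ∘ₗ symb₂ k C m) (fun i j hij a ha b hb => ?_)
      (comul_mem_tensFiltration hx)
    subst hij
    simp only [LinearMap.comp_apply, symb₂_tmul ha hb, TensorProduct.map_tmul, LinearMap.id_apply,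
      LinearEquiv.coe_coe, TensorProduct.lid_tmul, map_smul]
    by_cases hi : i = 0
    · subst hi
      rw [zero_add, proj_symb_self hb]
    · rw [hφ i hi a ha, zero_smul, zero_smul]
  have : proj k C n ∘ₗ actL φ = actL φ ∘ₗ proj k C n := hom_ext fun m x hx => by
    simp only [LinearMap.comp_apply]
    by_cases hm : m = n
    · subst hm
      rw [key m x hx, proj_symb_self hx]
    · obtain ⟨x', hx', h⟩ := exists_eq_symb m (actL φ (symb k C m x))
      rw [← key m x hx, h, proj_symb_of_ne hm hx', proj_symb_of_ne hm hx, map_zero]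
  exact LinearMap.congr_fun this y

/-- The map `gr C → C / C_{n-1}` which is the canonical one in degree `n` and zero in the other
degrees. -/
noncomputable def toQuotient (n : ℕ) : Gr k C →ₗ[k] C ⧸ coradBelow k C n :=
  lift (fun m => if m = n then (coradBelow k C n).mkQ ∘ₗ (coradFiltration k C m).subtype else 0) <| by
    intro m x hx
    split_ifs with h
    · subst h
      exact (Submodule.Quotient.mk_eq_zero _).2 hx
    · rfl

theorem toQuotient_symb_self {n : ℕ} {x : C} (hx : x ∈ coradFiltration k C n) :
    toQuotient n (symb k C n x) = (coradBelow k C n).mkQ x :=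
  (lift_symb _ _ hx).trans (by rw [if_pos rfl]; rfl)

theorem hasDegree_toQuotient (n : ℕ) : HasDegree n (toQuotient (k := k) (C := C) n) :=
  fun m hm x hx => (lift_symb _ _ hx).trans (by rw [if_neg hm]; rfl)

/-- With quotients of all of `C` as targets, the coproduct of `gr C` can be compared directly with
that of `C`: in every bidegree of total `1 + n` other than `(1, n)`, one tensor factor dies in its
quotient. -/
theorem map_toQuotient_comul {n : ℕ} {x : C} (hx : x ∈ coradFiltration k C (1 + n)) :
    TensorProduct.map (toQuotient 1) (toQuotient n) (comul (R := k) (symb k C (1 + n) x)) =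
      TensorProduct.map (coradBelow k C 1).mkQ (coradBelow k C n).mkQ (comul (R := k) x) := by
  rw [comul_symb hx]
  refine tensFiltration_ext (f := TensorProduct.map (toQuotient 1) (toQuotient n) ∘ₗ
    symb₂ k C (1 + n)) (fun i j hij a ha b hb => ?_) (comul_mem_tensFiltration hx)
  rw [LinearMap.comp_apply, ← hij, symb₂_tmul ha hb, TensorProduct.map_tmul, TensorProduct.map_tmul]
  rcases lt_trichotomy i 1 with hi | rfl | hi
  · obtain rfl : i = 0 := by omega
    rw [hasDegree_toQuotient 1 0 zero_ne_one a ha, TensorProduct.zero_tmul,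
      Submodule.mkQ_apply (coradBelow k C 1), (Submodule.Quotient.mk_eq_zero (coradBelow k C 1)).2 ha,
      TensorProduct.zero_tmul]
  · obtain rfl : j = n := by omega
    rw [toQuotient_symb_self ha, toQuotient_symb_self hb]
  · rw [hasDegree_toQuotient 1 i hi.ne' a ha, TensorProduct.zero_tmul,
      Submodule.mkQ_apply (coradBelow k C n), (Submodule.Quotient.mk_eq_zero (coradBelow k C n)).2
        (coradBelow_mono (show j + 1 ≤ n by omega) hb), TensorProduct.tmul_zero]

/-- The component of bidegree `(1, n)` of the coproduct is injective in degree `1 + n`, because `C_n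
= C_0 ∧ C_{n-1}`. The injectivity of the embedding into the path coalgebra rests on this. -/
theorem symb_eq_zero_of_map_toQuotient {n : ℕ} {x : C} (hx : x ∈ coradFiltration k C (1 + n))
    (h : TensorProduct.map (toQuotient 1) (toQuotient n)
      (comul (R := k) (symb k C (1 + n) x)) = 0) : symb k C (1 + n) x = 0 := by
  rw [map_toQuotient_comul hx, ← mem_tens_sup_iff, ← mem_wedge, ← coradBelow_add] at h
  exact symb_eq_zero h

end Grading

end Gr

namespace Gr

/-! ### Degrees zero and one of the associated graded Hopf algebra -/

section DegreeOne

variable {k : Type u} {H : Type v} [Field k] [Ring H] [HopfAlgebra k H]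
  {G : Type w} [CommGroup G] (ι : G ≃* GroupLike k H)

theorem degreeZero_symb {x : H} (hx : x ∈ coradFiltration k H 0) :
    degreeZero k (symb k H 0 x) = x :=
  (lift_symb _ _ hx).trans (by simp)

theorem hasDegree_degreeZero : HasDegree 0 (degreeZero k (H := H)) :=
  fun m hm x hx => (lift_symb _ _ hx).trans (by simp [hm])

theorem groupLike_mem (a : GroupLike k H) : a.val ∈ coradFiltration k H 0 :=
  mem_coradical_of_isGroupLikeElem a.2

/-- The class of a group-like element in degree zero. -/
noncomputable def gl (g : G) : Gr k H := symb k H 0 (ι g).val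

theorem isGroupLikeElem_gl (g : G) : IsGroupLikeElem k (gl ι g) where
  counit_eq_one := (counit_symb_zero (groupLike_mem (ι g))).trans (ι g).2.counit_eq_one
  comul_eq_tmul_self := by
    rw [gl, comul_symb (groupLike_mem (ι g)), (ι g).2.comul_eq_tmul_self]
    exact symb₂_tmul (i := 0) (j := 0) (groupLike_mem (ι g)) (groupLike_mem (ι g))

theorem proj_gl (g : G) : proj k H 0 (gl ι g) = gl ι g := proj_symb_self (groupLike_mem (ι g))

theorem conv_gl (φ ψ : WithConv (Gr k H →ₗ[k] k)) (g : G) :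
    (φ * ψ) (gl ι g) = φ (gl ι g) * ψ (gl ι g) := by
  change LinearMap.mul' k k (TensorProduct.map φ.ofConv ψ.ofConv (comul (R := k) _)) = _
  rw [(isGroupLikeElem_gl ι g).comul_eq_tmul_self, TensorProduct.map_tmul, LinearMap.mul'_apply]

theorem linearIndependent_groupLike : LinearIndependent k fun g : G => (ι g).val :=
  (linearIndep_groupLikeVal (R := k) (A := H)).comp ι ι.injective

/-- The coordinates of the degree zero part with respect to the group-like elements. -/
noncomputable def coord : Gr k H →ₗ[k] G →₀ k :=
  -- The extension beyond the span of the group-like elements is arbitrary. For pointed `H` it does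
  -- not matter, as `degreeZero` takes its values in the coradical.
  (LinearMap.exists_extend (linearIndependent_groupLike ι).repr).choose ∘ₗ degreeZero k

theorem hasDegree_coord : HasDegree 0 (coord ι) := fun m hm x hx => by
  rw [coord, LinearMap.comp_apply, hasDegree_degreeZero m hm x hx, map_zero]

theorem coord_gl (g : G) : coord ι (gl ι g) = Finsupp.single g 1 := by
  rw [coord, LinearMap.comp_apply, gl, degreeZero_symb (groupLike_mem (ι g))]
  have h := LinearMap.congr_fun
    (LinearMap.exists_extend (linearIndependent_groupLike ι).repr).choose_spec
    ⟨(ι g).val, Submodule.subset_span ⟨g, rfl⟩⟩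
  refine h.trans ?_
  exact (linearIndependent_groupLike ι).repr_eq_single g _ rfl

/-- The coordinate of a group-like element, as an element of the convolution algebra. -/
noncomputable def ev (g : G) : WithConv (Gr k H →ₗ[k] k) :=
  WithConv.toConv (Finsupp.lapply g ∘ₗ coord ι)

theorem ev_apply (g : G) (y : Gr k H) : ev ι g y = coord ι y g := rfl

theorem hasDegree_ev (g : G) : HasDegree 0 (ev ι g).ofConv := fun m hm x hx => by
  change coord ι (symb k H m x) g = 0
  rw [hasDegree_coord ι m hm x hx, Finsupp.coe_zero, Pi.zero_apply]

open Classical in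
theorem ev_gl (g h : G) : ev ι g (gl ι h) = if g = h then 1 else 0 := by
  rw [ev_apply, coord_gl, Finsupp.single_apply]
  simp only [eq_comm]

theorem hasDegree_counit : HasDegree 0 (counit (R := k) (A := Gr k H)) :=
  fun _ hm _ hx => counit_symb_pos hm hx

/-- In total degree one the only bidegrees are `(1, 0)` and `(0, 1)`. -/
theorem comul_eq_of_proj_one {y : Gr k H} (hy : proj k H 1 y = y) :
    comul (R := k) y = (proj k H 0).lTensor _ (comul (R := k) y) +
      (proj k H 0).rTensor _ (comul (R := k) y) := by
  obtain ⟨x, hx, h⟩ := exists_eq_symb 1 y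
  rw [← hy, h, comul_symb hx, ← LinearMap.add_apply]
  refine tensFiltration_ext (f := symb₂ k H 1)
    (g := ((proj k H 0).lTensor _ + (proj k H 0).rTensor _) ∘ₗ symb₂ k H 1)
    (fun i j hij a ha b hb => ?_) (comul_mem_tensFiltration hx)
  rw [LinearMap.comp_apply, ← hij, symb₂_tmul ha hb, LinearMap.add_apply, LinearMap.lTensor_tmul,
    LinearMap.rTensor_tmul]
  rcases Nat.eq_zero_or_pos i with rfl | hi
  · rw [proj_symb_self ha, proj_symb_of_ne (by omega) hb, TensorProduct.tmul_zero, zero_add]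
  · obtain rfl : j = 0 := by omega
    rw [proj_symb_self hb, proj_symb_of_ne hi.ne' ha, TensorProduct.zero_tmul, add_zero]

variable [IsPointed k H]

/-- Pointedness: the coradical is spanned by the group-like elements, so they have coordinates for
all of degree zero. -/
theorem proj_zero_eq (y : Gr k H) :
    proj k H 0 y = Finsupp.linearCombination k (gl ι) (coord ι y) := by
  have : proj k H 0 = Finsupp.linearCombination k (gl ι) ∘ₗ coord ι := hom_ext fun n x hx => by
    rw [LinearMap.comp_apply]
    by_cases hn : n = 0
    · subst hn
      have hx' : x ∈ coradical k H := hx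
      rw [coradical_eq_span] at hx'
      rw [proj_symb_self hx]
      clear hx
      induction hx' using Submodule.span_induction with
      | zero => simp
      | add x y _ _ hx hy => rw [map_add, map_add, map_add, ← hx, ← hy]
      | smul r x _ hx => rw [map_smul, map_smul, map_smul, ← hx]
      | mem x hx =>
        obtain ⟨g, hg⟩ := ι.surjective ⟨x, hx⟩
        have : symb k H 0 x = gl ι g := by rw [gl, hg]
        rw [this, coord_gl, Finsupp.linearCombination_single, one_smul]
    · rw [proj_symb_of_ne hn hx, hasDegree_coord ι n hn x hx, map_zero]
  exact LinearMap.congr_fun this y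

theorem hom_ext_zero {M : Type*} [AddCommGroup M] [Module k M] {φ ψ : Gr k H →ₗ[k] M}
    (hφ : HasDegree 0 φ) (hψ : HasDegree 0 ψ) (h : ∀ g, φ (gl ι g) = ψ (gl ι g)) : φ = ψ := by
  refine LinearMap.ext fun y => ?_
  rw [← hφ.apply_proj, ← hψ.apply_proj, proj_zero_eq ι]
  refine LinearMap.congr_fun (f := φ ∘ₗ Finsupp.linearCombination k (gl ι))
    (g := ψ ∘ₗ Finsupp.linearCombination k (gl ι)) (Finsupp.lhom_ext fun g r => ?_) (coord ι y)
  rw [LinearMap.comp_apply, LinearMap.comp_apply, Finsupp.linearCombination_single, map_smul,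
    map_smul, h]

theorem counit_eq (y : Gr k H) :
    counit (R := k) y = Finsupp.linearCombination k (fun _ : G => (1 : k)) (coord ι y) := by
  have : counit (R := k) = Finsupp.linearCombination k (fun _ : G => (1 : k)) ∘ₗ coord ι :=
    hom_ext_zero ι hasDegree_counit
      (fun m hm x hx => by rw [LinearMap.comp_apply, hasDegree_coord ι m hm x hx, map_zero])
      fun g => by
        rw [LinearMap.comp_apply, coord_gl, (isGroupLikeElem_gl ι g).counit_eq_one]
        simp
  exact LinearMap.congr_fun this y

theorem ev_mul_self (g : G) : ev ι g * ev ι g = ev ι g := by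
  classical
  refine WithConv.ext (hom_ext_zero ι ((hasDegree_ev ι g).mul (hasDegree_ev ι g))
    (hasDegree_ev ι g) fun s => ?_)
  change (ev ι g * ev ι g) (gl ι s) = ev ι g (gl ι s)
  rw [conv_gl, ev_gl]
  split_ifs <;> simp

theorem ev_mul_of_ne {g h : G} (hgh : g ≠ h) : ev ι g * ev ι h = 0 := by
  classical
  refine WithConv.ext (hom_ext_zero ι ((hasDegree_ev ι g).mul (hasDegree_ev ι h))
    (fun _ _ _ _ => rfl) fun s => ?_)
  change (ev ι g * ev ι h) (gl ι s) = 0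
  rw [conv_gl, ev_gl, ev_gl]
  split_ifs with h1 h2
  · exact absurd (h1.trans h2.symm) hgh
  all_goals simp

/-- The forms `ev ι h` sum up to the counit, and only finitely many of them meet the finitely many
terms of a given coproduct. -/
theorem exists_sum_actL (y : Gr k H) : ∃ s : Finset G, (∀ h ∉ s, actL (ev ι h) y = 0) ∧
    y = ∑ h ∈ s, actL (ev ι h) y := by
  classical
  obtain ⟨t, ht⟩ := TensorProduct.exists_finset (R := k) (comul (R := k) y)
  have key : ∀ φ : WithConv (Gr k H →ₗ[k] k), actL φ y = ∑ i ∈ t, φ i.1 • i.2 := by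
    intro φ
    rw [actL, LinearMap.comp_apply, LinearMap.comp_apply, ht]
    simp only [map_sum, TensorProduct.map_tmul, LinearEquiv.coe_coe, TensorProduct.lid_tmul,
      LinearMap.id_apply]
  refine ⟨t.biUnion fun i => (coord ι i.1).support, fun h hh => ?_, ?_⟩
  · rw [key]
    refine Finset.sum_eq_zero fun i hi => ?_
    rw [ev_apply, Finsupp.notMem_support_iff.1 fun h' => hh (Finset.mem_biUnion.2 ⟨i, hi, h'⟩),
      zero_smul]
  · have h1 : y = actL (WithConv.toConv (counit (R := k))) y := by
      change y = TensorProduct.lid k _ ((counit (R := k)).rTensor _ (comul (R := k) y))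
      rw [rTensor_counit_comul, TensorProduct.lid_tmul, one_smul]
    refine h1.trans ?_
    simp only [key]
    rw [Finset.sum_comm]
    refine Finset.sum_congr rfl fun i hi => ?_
    rw [← Finset.sum_smul]
    congr 1
    refine (counit_eq ι i.1).trans ?_
    rw [Finsupp.linearCombination_apply, Finsupp.sum_of_support_subset _
      (Finset.subset_biUnion_of_mem (fun i : Gr k H × Gr k H => (coord ι i.1).support) hi) _
      (by simp)]
    simp [ev_apply]

theorem exists_sum_actR (y : Gr k H) : ∃ s : Finset G, (∀ h ∉ s, actR (ev ι h) y = 0) ∧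
    y = ∑ h ∈ s, actR (ev ι h) y := by
  classical
  obtain ⟨t, ht⟩ := TensorProduct.exists_finset (R := k) (comul (R := k) y)
  have key : ∀ φ : WithConv (Gr k H →ₗ[k] k), actR φ y = ∑ i ∈ t, φ i.2 • i.1 := by
    intro φ
    rw [actR, LinearMap.comp_apply, LinearMap.comp_apply, ht]
    simp only [map_sum, TensorProduct.map_tmul, LinearEquiv.coe_coe, TensorProduct.rid_tmul,
      LinearMap.id_apply]
  refine ⟨t.biUnion fun i => (coord ι i.2).support, fun h hh => ?_, ?_⟩
  · rw [key]
    refine Finset.sum_eq_zero fun i hi => ?_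
    rw [ev_apply, Finsupp.notMem_support_iff.1 fun h' => hh (Finset.mem_biUnion.2 ⟨i, hi, h'⟩),
      zero_smul]
  · have h1 : y = actR (WithConv.toConv (counit (R := k))) y := by
      change y = TensorProduct.rid k _ ((counit (R := k)).lTensor _ (comul (R := k) y))
      rw [lTensor_counit_comul, TensorProduct.rid_tmul, one_smul]
    refine h1.trans ?_
    simp only [key]
    rw [Finset.sum_comm]
    refine Finset.sum_congr rfl fun i hi => ?_
    rw [← Finset.sum_smul]
    congr 1
    refine (counit_eq ι i.2).trans ?_
    rw [Finsupp.linearCombination_apply, Finsupp.sum_of_support_subset _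
      (Finset.subset_biUnion_of_mem (fun i : Gr k H × Gr k H => (coord ι i.2).support) hi) _
      (by simp)]
    simp [ev_apply]

theorem gl_mul (g h : G) : gl ι (g * h) = gl ι g * gl ι h := by
  rw [gl, gl, gl, symb_mul_symb (groupLike_mem _) (groupLike_mem _), map_mul, GroupLike.val_mul]

theorem gl_one : gl ι 1 = 1 := by
  rw [gl, map_one, GroupLike.val_one, one_eq_symb]

theorem gl_inv_mul_cancel_left (g : G) (y : Gr k H) : gl ι g⁻¹ * (gl ι g * y) = y := by
  rw [← mul_assoc, ← gl_mul, inv_mul_cancel, gl_one, one_mul]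

theorem gl_mul_inv_cancel_left (g : G) (y : Gr k H) : gl ι g * (gl ι g⁻¹ * y) = y := by
  rw [← mul_assoc, ← gl_mul, mul_inv_cancel, gl_one, one_mul]

theorem proj_gl_mul (n : ℕ) (g : G) (y : Gr k H) :
    proj k H n (gl ι g * y) = gl ι g * proj k H n y := by
  have : proj k H n ∘ₗ LinearMap.mulLeft k (gl ι g) = LinearMap.mulLeft k (gl ι g) ∘ₗ proj k H n :=
    hom_ext fun m x hx => by
      have hm : (ι g).val * x ∈ coradFiltration k H m := by
        have := mul_mem_coradFiltration (groupLike_mem (ι g)) hx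
        rwa [zero_add] at this
      have e : gl ι g * symb k H m x = symb k H m ((ι g).val * x) := by
        rw [gl, symb_mul_symb (groupLike_mem _) hx, zero_add]
      simp only [LinearMap.comp_apply, LinearMap.mulLeft_apply]
      rw [e]
      by_cases h : m = n
      · subst h
        rw [proj_symb_self hm, proj_symb_self hx, e]
      · rw [proj_symb_of_ne h hm, proj_symb_of_ne h hx, mul_zero]
  exact LinearMap.congr_fun this y

theorem proj_zero_actR (g : G) (y : Gr k H) :
    proj k H 0 (actR (ev ι g) y) = ev ι g y • gl ι g := by
  rw [proj_zero_eq ι]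
  have : coord ι (actR (ev ι g) y) = Finsupp.single g (ev ι g y) := by
    classical
    ext h
    rw [← ev_apply, apply_actR, Finsupp.single_apply]
    split_ifs with hh
    · rw [← hh, ev_mul_self]
    · rw [ev_mul_of_ne ι (Ne.symm hh)]
      rfl
  rw [this, Finsupp.linearCombination_single]

theorem proj_zero_actL (g : G) (y : Gr k H) :
    proj k H 0 (actL (ev ι g) y) = ev ι g y • gl ι g := by
  rw [proj_zero_eq ι]
  have : coord ι (actL (ev ι g) y) = Finsupp.single g (ev ι g y) := by
    classical
    ext h
    rw [← ev_apply, apply_actL, Finsupp.single_apply]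
    split_ifs with hh
    · rw [← hh, ev_mul_self]
    · rw [ev_mul_of_ne ι hh]
      rfl
  rw [this, Finsupp.linearCombination_single]

/-- Contracting with `ev ι g` on the right turns the degree zero right factors of the coproduct into
multiples of `gl ι g`, and similarly on the left. In degree one there are no further terms, so the
component becomes skew primitive. -/
theorem comul_actL_actR {y : Gr k H} (hy : proj k H 1 y = y) (g h : G) :
    comul (R := k) (actL (ev ι h) (actR (ev ι g) y)) =
      actL (ev ι h) (actR (ev ι g) y) ⊗ₜ[k] gl ι g +
        gl ι h ⊗ₜ[k] actL (ev ι h) (actR (ev ι g) y) := by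
  have h1 : ∀ w : Gr k H, (proj k H 0).lTensor _ (comul (R := k) (actR (ev ι g) w)) =
      actR (ev ι g) w ⊗ₜ[k] gl ι g := by
    intro w
    rw [comul_actR, ← LinearMap.comp_apply, ← LinearMap.lTensor_comp,
      show proj k H 0 ∘ₗ actR (ev ι g) = LinearMap.toSpanSingleton k _ (gl ι g) ∘ₗ (ev ι g).ofConv
        from LinearMap.ext (proj_zero_actR ι g), actR, LinearMap.comp_apply, LinearMap.comp_apply]
    induction comul (R := k) w with
    | zero => simp
    | add x y hx hy => simp only [map_add, hx, hy, TensorProduct.add_tmul]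
    | tmul a b => simp [TensorProduct.smul_tmul]
  have h2 : ∀ w : Gr k H, (proj k H 0).rTensor _ (comul (R := k) (actL (ev ι h) w)) =
      gl ι h ⊗ₜ[k] actL (ev ι h) w := by
    intro w
    rw [comul_actL, ← LinearMap.comp_apply, ← LinearMap.rTensor_comp,
      show proj k H 0 ∘ₗ actL (ev ι h) = LinearMap.toSpanSingleton k _ (gl ι h) ∘ₗ (ev ι h).ofConv
        from LinearMap.ext (proj_zero_actL ι h), actL, LinearMap.comp_apply, LinearMap.comp_apply]
    induction comul (R := k) w with
    | zero => simp
    | add x y hx hy => simp only [map_add, hx, hy, TensorProduct.tmul_add]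
    | tmul a b => simp [TensorProduct.smul_tmul]
  rw [comul_eq_of_proj_one, h2, actL_actR, h1]
  rw [proj_actL (hasDegree_ev ι h), proj_actR (hasDegree_ev ι g), hy]

/-- The elements `z` of degree one with `Δ(z) = z ⊗ 1 + d ⊗ z`. -/
noncomputable def skew (d : G) : Submodule k (Gr k H) :=
  LinearMap.eqLocus (proj k H 1) LinearMap.id ⊓
    LinearMap.eqLocus comul ((TensorProduct.mk k _ _).flip 1 + TensorProduct.mk k _ _ (gl ι d))

theorem mem_skew {d : G} {z : Gr k H} : z ∈ skew ι d ↔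
    proj k H 1 z = z ∧ comul (R := k) z = z ⊗ₜ[k] 1 + gl ι d ⊗ₜ[k] z := Iff.rfl

theorem comul_gl_mul {d : G} {z : Gr k H} (hz : z ∈ skew ι d) (g : G) :
    comul (R := k) (gl ι g * z) = (gl ι g * z) ⊗ₜ[k] gl ι g + gl ι (g * d) ⊗ₜ[k] (gl ι g * z) := by
  rw [Bialgebra.comul_mul, (isGroupLikeElem_gl ι g).comul_eq_tmul_self, (mem_skew ι).1 hz |>.2,
    mul_add, Algebra.TensorProduct.tmul_mul_tmul, Algebra.TensorProduct.tmul_mul_tmul, mul_one,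
    gl_mul]

/-- The component of an element in `skew d`, translated from the group-like elements `g`
and `g d`. -/
noncomputable def skewPart (g d : G) : Gr k H →ₗ[k] skew ι d :=
  LinearMap.codRestrict _ (LinearMap.mulLeft k (gl ι g⁻¹) ∘ₗ actL (ev ι (g * d)) ∘ₗ
    actR (ev ι g) ∘ₗ proj k H 1) fun y => by
      simp only [LinearMap.comp_apply, LinearMap.mulLeft_apply]
      refine (mem_skew ι).2 ⟨?_, ?_⟩
      · rw [proj_gl_mul, proj_actL (hasDegree_ev ι _), proj_actR (hasDegree_ev ι g), proj_proj]
      · rw [Bialgebra.comul_mul, comul_actL_actR ι (proj_proj 1 y),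
          (isGroupLikeElem_gl ι _).comul_eq_tmul_self, mul_add,
          Algebra.TensorProduct.tmul_mul_tmul, Algebra.TensorProduct.tmul_mul_tmul, ← gl_mul,
          ← gl_mul, inv_mul_cancel, inv_mul_cancel_left, gl_one]

theorem skewPart_apply (g d : G) (y : Gr k H) : (skewPart ι g d y : Gr k H) =
    gl ι g⁻¹ * actL (ev ι (g * d)) (actR (ev ι g) (proj k H 1 y)) := rfl

theorem skewPart_actL (g d : G) (y : Gr k H) :
    skewPart ι g d (actL (ev ι (g * d)) y) = skewPart ι g d y := by
  refine Subtype.ext ?_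
  rw [skewPart_apply, skewPart_apply, proj_actL (hasDegree_ev ι _), ← actL_actR, actL_actL,
    ev_mul_self]

theorem skewPart_actR (g d : G) (y : Gr k H) :
    skewPart ι g d (actR (ev ι g) y) = skewPart ι g d y := by
  refine Subtype.ext ?_
  rw [skewPart_apply, skewPart_apply, proj_actR (hasDegree_ev ι _), actR_actR, ev_mul_self]

theorem hasDegree_skewPart (g d : G) : HasDegree 1 (skewPart ι g d) := fun m hm x hx => by
  refine Subtype.ext ?_
  rw [skewPart_apply, proj_symb_of_ne hm hx, map_zero, map_zero, mul_zero]
  rfl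

theorem ev_eq_zero {y : Gr k H} (hy : proj k H 1 y = y) (g : G) : ev ι g y = 0 := by
  have h : ev ι g (proj k H 0 y) = ev ι g y := (hasDegree_ev ι g).apply_proj y
  obtain ⟨x, hx, h'⟩ := exists_eq_symb 1 y
  rw [← h, ← hy, h', proj_symb_of_ne one_ne_zero hx]
  exact map_zero (ev ι g).ofConv

-- The maps `skewPart` are the coordinates for the decomposition of degree one into the translates
-- of the spaces `skew ι d`: they recover one summand and vanish on the others. That the translates
-- exhaust degree one is `proj_one_induction`.
open Classical in
theorem skewPart_gl_mul (g d s d' : G) {z : Gr k H} (hz : z ∈ skew ι d') :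
    (skewPart ι g d (gl ι s * z) : Gr k H) = if s = g ∧ d' = d then z else 0 := by
  have hz1 : proj k H 1 (gl ι s * z) = gl ι s * z := by rw [proj_gl_mul, ((mem_skew ι).1 hz).1]
  have h1 : ∀ h, actR (ev ι h) (gl ι s * z) = if h = s then gl ι s * z else 0 := fun h => by
    change TensorProduct.rid k _ (TensorProduct.map _ _ (comul (R := k) _)) = _
    rw [comul_gl_mul ι hz, map_add, TensorProduct.map_tmul, TensorProduct.map_tmul, map_add,
      TensorProduct.rid_tmul, TensorProduct.rid_tmul]
    change ev ι h (gl ι s) • (gl ι s * z) + ev ι h (gl ι s * z) • _ = _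
    rw [ev_eq_zero ι hz1, zero_smul, add_zero, ev_gl, ite_smul, one_smul, zero_smul]
  have h2 : ∀ h, actL (ev ι h) (gl ι s * z) = if h = s * d' then gl ι s * z else 0 := fun h => by
    change TensorProduct.lid k _ (TensorProduct.map _ _ (comul (R := k) _)) = _
    rw [comul_gl_mul ι hz, map_add, TensorProduct.map_tmul, TensorProduct.map_tmul, map_add,
      TensorProduct.lid_tmul, TensorProduct.lid_tmul]
    change ev ι h (gl ι s * z) • _ + ev ι h (gl ι (s * d')) • (gl ι s * z) = _
    rw [ev_eq_zero ι hz1, zero_smul, zero_add, ev_gl, ite_smul, one_smul, zero_smul]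
  rw [skewPart_apply, hz1, h1]
  by_cases hs : s = g
  · subst hs
    rw [if_pos rfl, h2]
    by_cases hd : d' = d
    · subst hd
      rw [if_pos rfl, if_pos ⟨rfl, rfl⟩, gl_inv_mul_cancel_left]
    · rw [if_neg (fun h => hd (mul_left_cancel h).symm), if_neg (fun h => hd h.2), mul_zero]
  · rw [if_neg (Ne.symm hs), if_neg (fun h => hs h.1), map_zero, mul_zero]

theorem actL_actR_eq_gl_mul (g h : G) (y : Gr k H) :
    actL (ev ι h) (actR (ev ι g) (proj k H 1 y)) = gl ι g * skewPart ι g (g⁻¹ * h) y := by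
  rw [skewPart_apply, gl_mul_inv_cancel_left, mul_inv_cancel_left]

theorem proj_one_induction {P : Submodule k (Gr k H)} {y : Gr k H}
    (h : ∀ g d, gl ι g * skewPart ι g d y ∈ P) : proj k H 1 y ∈ P := by
  obtain ⟨s, -, hs⟩ := exists_sum_actR ι (proj k H 1 y)
  rw [hs]
  refine sum_mem fun g _ => ?_
  obtain ⟨t, -, ht⟩ := exists_sum_actL ι (actR (ev ι g) (proj k H 1 y))
  rw [ht]
  refine sum_mem fun h' _ => ?_
  rw [actL_actR_eq_gl_mul]
  exact h g _

/-- Finitely many `g` have a nonzero right component, and for each of them finitely many `g * d`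
have a nonzero left component. -/
theorem finite_skewPart (y : Gr k H) : {p : G × G | skewPart ι p.1 p.2 y ≠ 0}.Finite := by
  obtain ⟨s, hs, -⟩ := exists_sum_actR ι (proj k H 1 y)
  choose t ht _ using fun g => exists_sum_actL ι (actR (ev ι g) (proj k H 1 y))
  refine Set.Finite.subset (Set.Finite.biUnion s.finite_toSet fun g _ =>
    (t g).finite_toSet.image fun h => (g, g⁻¹ * h)) ?_
  rintro ⟨g, d⟩ hgd
  have hne : actL (ev ι (g * d)) (actR (ev ι g) (proj k H 1 y)) ≠ 0 := fun h => hgd <| by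
    refine Subtype.ext ?_
    rw [skewPart_apply, h, mul_zero]
    rfl
  refine Set.mem_biUnion (x := g) ?_ ⟨g * d, ?_, by simp⟩
  · by_contra h
    exact hne (by rw [hs g h, map_zero])
  · by_contra h
    exact hne (ht g _ h)

end DegreeOne

end Gr

/-! ### The bicharacter of a coquasitriangular structure -/

section Bicharacter

variable {k : Type u} {H : Type v} [Field k] [Ring H] [HopfAlgebra k H]
  {R : H ⊗[k] H →ₗ[k] k}

theorem comul_groupLike_tmul (a b : GroupLike k H) :
    comul (R := k) (a.val ⊗ₜ[k] b.val) = (a.val ⊗ₜ[k] b.val) ⊗ₜ[k] (a.val ⊗ₜ[k] b.val) := by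
  rw [TensorProduct.comul_tmul, a.2.comul_eq_tmul_self, b.2.comul_eq_tmul_self]
  rfl

/-- Convolution is pointwise at group-like elements, where the counit is `1`; so the convolution
inverse provides an inverse of the value. -/
theorem IsCoquasitriangular.apply_ne_zero (hR : IsCoquasitriangular R) (a b : GroupLike k H) :
    R (a.val ⊗ₜ[k] b.val) ≠ 0 := by
  obtain ⟨φ, hφ⟩ := hR.isUnit.exists_right_inv
  have h : LinearMap.mul' k k (TensorProduct.map R φ.ofConv (comul (R := k)
      (a.val ⊗ₜ[k] b.val))) = counit (R := k) (a.val ⊗ₜ[k] b.val) :=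
    LinearMap.congr_fun (congrArg WithConv.ofConv hφ) (a.val ⊗ₜ[k] b.val)
  rw [comul_groupLike_tmul, TensorProduct.map_tmul, LinearMap.mul'_apply,
    TensorProduct.counit_tmul, a.2.counit_eq_one, b.2.counit_eq_one, one_smul] at h
  exact left_ne_zero_of_mul (h ▸ one_ne_zero)

/-- The group-like elements of a coquasitriangular Hopf algebra commute. -/
theorem IsCoquasitriangular.groupLike_mul_comm (hR : IsCoquasitriangular R) (a b : GroupLike k H) :
    a * b = b * a := by
  have h := hR.comm a.val b.val
  rw [comul_groupLike_tmul, TensorProduct.map_tmul, TensorProduct.map_tmul, TensorProduct.rid_tmul,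
    TensorProduct.lid_tmul, LinearMap.comp_apply, LinearEquiv.coe_coe, TensorProduct.comm_tmul,
    LinearMap.mul'_apply, LinearMap.mul'_apply] at h
  exact GroupLike.val_injective (smul_right_injective H (hR.apply_ne_zero a b) h).symm

variable {G : Type w} [CommGroup G] (ι : G ≃* GroupLike k H)

/-- The restriction of a coquasitriangular structure to the group-like elements. -/
noncomputable def IsCoquasitriangular.bichar (hR : IsCoquasitriangular R) : G →* G →* kˣ :=
  MonoidHom.mk' (fun g => MonoidHom.mk' (fun h => Units.mk0 _ (hR.apply_ne_zero (ι g) (ι h)))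
    fun h h' => by
      ext
      simp only [map_mul, GroupLike.val_mul, Units.val_mul, Units.val_mk0]
      rw [hR.mul_right, (ι g).2.comul_eq_tmul_self, TensorProduct.map_tmul, LinearMap.mul'_apply,
        mul_comm]
      rfl) fun g g' => by
    ext h
    simp only [map_mul, GroupLike.val_mul, Units.val_mul, MonoidHom.mul_apply, MonoidHom.mk'_apply,
      Units.val_mk0]
    rw [hR.mul_left, (ι h).2.comul_eq_tmul_self, TensorProduct.map_tmul, LinearMap.mul'_apply]
    rfl

theorem IsCoquasitriangular.bichar_apply (hR : IsCoquasitriangular R) (g h : G) :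
    (hR.bichar ι g h : k) = R ((ι g).val ⊗ₜ[k] (ι h).val) := rfl

theorem map_tensorComm_right {A B M N : Type*} [AddCommGroup A] [Module k A]
    [AddCommGroup B] [Module k B] [AddCommGroup M] [Module k M] [AddCommGroup N] [Module k N]
    (φ : A ⊗[k] B →ₗ[k] M) (ψ : A ⊗[k] B →ₗ[k] N) (z : A ⊗[k] A) (b : B) :
    TensorProduct.map φ ψ (TensorProduct.tensorTensorTensorComm k A A B B (z ⊗ₜ[k] (b ⊗ₜ[k] b))) =
      TensorProduct.map (φ ∘ₗ (TensorProduct.mk k A B).flip b) (ψ ∘ₗ (TensorProduct.mk k A B).flip b)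
        z := by
  induction z with
  | zero => simp
  | add x y hx hy => simp only [map_add, TensorProduct.add_tmul, hx, hy]
  | tmul x y => simp

theorem map_tensorComm_left {A B M N : Type*} [AddCommGroup A] [Module k A]
    [AddCommGroup B] [Module k B] [AddCommGroup M] [Module k M] [AddCommGroup N] [Module k N]
    (φ : A ⊗[k] B →ₗ[k] M) (ψ : A ⊗[k] B →ₗ[k] N) (a : A) (z : B ⊗[k] B) :
    TensorProduct.map φ ψ (TensorProduct.tensorTensorTensorComm k A A B B ((a ⊗ₜ[k] a) ⊗ₜ[k] z)) =
      TensorProduct.map (φ ∘ₗ TensorProduct.mk k A B a) (ψ ∘ₗ TensorProduct.mk k A B a) z := by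
  induction z with
  | zero => simp
  | add x y hx hy => simp only [map_add, TensorProduct.tmul_add, hx, hy]
  | tmul x y => simp

/-- The coproduct of a group-like element is a diagonal tensor, so the commutation axiom becomes an
identity between operators in the one variable `x`. -/
theorem IsCoquasitriangular.comm_groupLike_right (hR : IsCoquasitriangular R) (a : GroupLike k H)
    (x : H) :
    TensorProduct.rid k H (TensorProduct.map (LinearMap.mulLeft k a.val)
      (R ∘ₗ (TensorProduct.mk k H H).flip a.val) (comul (R := k) x)) =
    TensorProduct.lid k H (TensorProduct.map (R ∘ₗ (TensorProduct.mk k H H).flip a.val)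
      (LinearMap.mulRight k a.val) (comul (R := k) x)) := by
  have h := hR.comm x a.val
  rw [TensorProduct.comul_tmul, a.2.comul_eq_tmul_self] at h
  exact ((congrArg _ (map_tensorComm_right _ _ _ _)).symm.trans h).trans
    (congrArg _ (map_tensorComm_right _ _ _ _))

theorem IsCoquasitriangular.comm_groupLike_left (hR : IsCoquasitriangular R) (a : GroupLike k H)
    (x : H) :
    TensorProduct.rid k H (TensorProduct.map (LinearMap.mulRight k a.val)
      (R ∘ₗ TensorProduct.mk k H H a.val) (comul (R := k) x)) =
    TensorProduct.lid k H (TensorProduct.map (R ∘ₗ TensorProduct.mk k H H a.val)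
      (LinearMap.mulLeft k a.val) (comul (R := k) x)) := by
  have h := hR.comm a.val x
  rw [TensorProduct.comul_tmul, a.2.comul_eq_tmul_self] at h
  exact ((congrArg _ (map_tensorComm_left _ _ _ _)).symm.trans h).trans
    (congrArg _ (map_tensorComm_left _ _ _ _))

end Bicharacter

namespace Gr

/-! ### Commutation of group-like and skew primitive elements -/

section Commutation

variable {k : Type u} {H : Type v} [Field k] [Ring H] [HopfAlgebra k H]

/-- An identity in which a form `r` is contracted with the coproduct passes from `H` to `gr H`, with
`r` replaced by its part in degree zero. Where `r` meets a factor of positive degree, the other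
factor lies in a lower step of the filtration, and its symbol in the total degree is zero. -/
theorem rid_map_comul_eq {A A' : H →ₗ[k] H} {B B' : Gr k H →ₗ[k] Gr k H} {r : H →ₗ[k] k}
    (hA : ∀ n, ∀ x ∈ coradFiltration k H n, A x ∈ coradFiltration k H n ∧
      B (symb k H n x) = symb k H n (A x))
    (hA' : ∀ n, ∀ x ∈ coradFiltration k H n, A' x ∈ coradFiltration k H n ∧
      B' (symb k H n x) = symb k H n (A' x))
    (h : ∀ x, TensorProduct.rid k H (TensorProduct.map A r (comul (R := k) x)) =
      TensorProduct.lid k H (TensorProduct.map r A' (comul (R := k) x))) (y : Gr k H) :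
    TensorProduct.rid k _ (TensorProduct.map B (r ∘ₗ degreeZero k) (comul (R := k) y)) =
      TensorProduct.lid k _ (TensorProduct.map (r ∘ₗ degreeZero k) B' (comul (R := k) y)) := by
  have : (TensorProduct.rid k _).toLinearMap ∘ₗ TensorProduct.map B (r ∘ₗ degreeZero k) ∘ₗ
      comul (R := k) = (TensorProduct.lid k _).toLinearMap ∘ₗ
        TensorProduct.map (r ∘ₗ degreeZero k) B' ∘ₗ comul (R := k) := hom_ext fun n x hx => by
    simp only [LinearMap.comp_apply, comul_symb hx, LinearEquiv.coe_coe]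
    have h1 := tensFiltration_ext (f := (TensorProduct.rid k _).toLinearMap ∘ₗ
      TensorProduct.map B (r ∘ₗ degreeZero k) ∘ₗ symb₂ k H n)
      (g := symb k H n ∘ₗ (TensorProduct.rid k _).toLinearMap ∘ₗ TensorProduct.map A r)
      (fun i j hij a ha b hb => by
        subst hij
        simp only [LinearMap.comp_apply, symb₂_tmul ha hb, TensorProduct.map_tmul,
          LinearEquiv.coe_coe, TensorProduct.rid_tmul, map_smul, (hA i a ha).2]
        rcases Nat.eq_zero_or_pos j with rfl | hj
        · rw [degreeZero_symb hb, add_zero]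
        · rw [hasDegree_degreeZero j hj.ne' b hb, map_zero, zero_smul,
            symb_eq_zero_of_lt (hA i a ha).1 (by omega), smul_zero])
      (comul_mem_tensFiltration hx)
    have h2 := tensFiltration_ext (f := (TensorProduct.lid k _).toLinearMap ∘ₗ
      TensorProduct.map (r ∘ₗ degreeZero k) B' ∘ₗ symb₂ k H n)
      (g := symb k H n ∘ₗ (TensorProduct.lid k _).toLinearMap ∘ₗ TensorProduct.map r A')
      (fun i j hij a ha b hb => by
        subst hij
        simp only [LinearMap.comp_apply, symb₂_tmul ha hb, TensorProduct.map_tmul,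
          LinearEquiv.coe_coe, TensorProduct.lid_tmul, map_smul, (hA' j b hb).2]
        rcases Nat.eq_zero_or_pos i with rfl | hi
        · rw [degreeZero_symb ha, zero_add]
        · rw [hasDegree_degreeZero i hi.ne' a ha, map_zero, zero_smul,
            symb_eq_zero_of_lt (hA' j b hb).1 (by omega), smul_zero])
      (comul_mem_tensFiltration hx)
    exact h1.trans ((congrArg _ (h x)).trans h2.symm)
  exact LinearMap.congr_fun this y

variable [IsPointed k H] {G : Type w} [CommGroup G] (ι : G ≃* GroupLike k H)
  {R : H ⊗[k] H →ₗ[k] k}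

theorem mulLeft_gl_symb (g : G) (n : ℕ) (x : H) (hx : x ∈ coradFiltration k H n) :
    LinearMap.mulLeft k (ι g).val x ∈ coradFiltration k H n ∧
      LinearMap.mulLeft k (gl ι g) (symb k H n x) =
        symb k H n (LinearMap.mulLeft k (ι g).val x) := by
  rw [LinearMap.mulLeft_apply, LinearMap.mulLeft_apply, gl, symb_mul_symb (groupLike_mem _) hx]
  have := mul_mem_coradFiltration (groupLike_mem (ι g)) hx
  rw [zero_add] at this ⊢
  exact ⟨this, rfl⟩

theorem mulRight_gl_symb (g : G) (n : ℕ) (x : H) (hx : x ∈ coradFiltration k H n) :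
    LinearMap.mulRight k (ι g).val x ∈ coradFiltration k H n ∧
      LinearMap.mulRight k (gl ι g) (symb k H n x) =
        symb k H n (LinearMap.mulRight k (ι g).val x) := by
  rw [LinearMap.mulRight_apply, LinearMap.mulRight_apply, gl, symb_mul_symb hx (groupLike_mem _)]
  exact ⟨mul_mem_coradFiltration hx (groupLike_mem (ι g)), rfl⟩

/-- In `Δ(z) = z ⊗ 1 + d ⊗ z` the form vanishes on `z`, which has degree one. One term survives on
each side of the transferred identity, with scalar `r 1 = 1` on the left and the value of `r` at `d`
on the right. -/
theorem eq_smul_of_mem_skew {A A' : H →ₗ[k] H} {B B' : Gr k H →ₗ[k] Gr k H} {r : H →ₗ[k] k}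
    (hA : ∀ n, ∀ x ∈ coradFiltration k H n, A x ∈ coradFiltration k H n ∧
      B (symb k H n x) = symb k H n (A x))
    (hA' : ∀ n, ∀ x ∈ coradFiltration k H n, A' x ∈ coradFiltration k H n ∧
      B' (symb k H n x) = symb k H n (A' x))
    (h : ∀ x, TensorProduct.rid k H (TensorProduct.map A r (comul (R := k) x)) =
      TensorProduct.lid k H (TensorProduct.map r A' (comul (R := k) x))) (h1 : r 1 = 1) {d : G}
    {z : Gr k H} (hz : z ∈ skew ι d) : B z = r (ι d).val • B' z := by
  have h2 := rid_map_comul_eq hA hA' h z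
  have h3 : degreeZero k z = 0 := by
    obtain ⟨x, hx, hx'⟩ := exists_eq_symb 1 z
    rw [← ((mem_skew ι).1 hz).1, hx', hasDegree_degreeZero 1 one_ne_zero x hx]
  have h4 : degreeZero k (1 : Gr k H) = 1 := degreeZero_symb one_mem_coradical
  rw [((mem_skew ι).1 hz).2] at h2
  simp only [map_add, TensorProduct.map_tmul, TensorProduct.rid_tmul, TensorProduct.lid_tmul,
    LinearMap.comp_apply, h3, h4, h1, map_zero, zero_smul, one_smul, add_zero, zero_add] at h2
  rw [h2, gl, degreeZero_symb (groupLike_mem _)]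

theorem gl_mul_skew (hR : IsCoquasitriangular R) (h : G) {d : G} {z : Gr k H}
    (hz : z ∈ skew ι d) : gl ι h * z = (hR.bichar ι d h : k) • (z * gl ι h) := by
  refine eq_smul_of_mem_skew ι (mulLeft_gl_symb ι h) (mulRight_gl_symb ι h)
    (hR.comm_groupLike_right (ι h)) ?_ hz
  have := hR.bichar_apply ι 1 h
  rw [map_one, MonoidHom.one_apply, map_one, Units.val_one] at this
  exact this.symm

theorem skew_mul_gl (hR : IsCoquasitriangular R) (h : G) {d : G} {z : Gr k H}
    (hz : z ∈ skew ι d) : z * gl ι h = (hR.bichar ι h d : k) • (gl ι h * z) := by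
  refine eq_smul_of_mem_skew ι (mulRight_gl_symb ι h) (mulLeft_gl_symb ι h)
    (hR.comm_groupLike_left (ι h)) ?_ hz
  have := hR.bichar_apply ι h 1
  rw [map_one, map_one, Units.val_one] at this
  exact this.symm

/-- Moving `h` past `z` and back multiplies `h z`, which is nonzero because `h` is invertible, by
both values of the bicharacter. This is the symmetry demanded by `isCoquasitriangular_trivExt`. -/
theorem bichar_mul_bichar (hR : IsCoquasitriangular R) (h : G) {d : G} {z : Gr k H}
    (hz : z ∈ skew ι d) (hz0 : z ≠ 0) : hR.bichar ι d h * hR.bichar ι h d = 1 := by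
  have h1 := gl_mul_skew ι hR h hz
  rw [skew_mul_gl ι hR h hz, smul_smul, ← Units.val_mul] at h1
  have h2 : gl ι h * z ≠ 0 := fun h' => hz0 (by
    rw [← gl_inv_mul_cancel_left ι h z, h', mul_zero])
  ext
  rw [Units.val_one]
  have h3 : ((hR.bichar ι d h * hR.bichar ι h d : kˣ) : k) • (gl ι h * z) = (1 : k) • (gl ι h * z) :=
    h1.symm.trans (one_smul k _).symm
  exact smul_left_injective k h2 h3

end Commutation

end Gr

/-! ### Homogeneous elements of the path coalgebra in terms of coefficients -/

section Homogeneous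

variable {G : Type v} {X : Type w} [CommGroup G] {c : X → G} {k : Type u} [Field k]

theorem mem_homogeneous_of_coef_eq_zero {n : ℕ} {z : PathCoalgebra k (Cayley c)}
    (h : ∀ g l, l.length ≠ n → coef c k g l z = 0) :
    z ∈ PathCoalgebra.homogeneous k (Cayley c) n := by
  rw [← (wordBasis c k).linearCombination_repr z, Finsupp.linearCombination_apply]
  refine sum_mem fun p hp => Submodule.smul_mem _ _ ?_
  have hl : p.2.length = n := by
    by_contra hl
    exact Finsupp.mem_support_iff.1 hp (h p.1 p.2 hl)
  rw [← hl]
  exact word_mem_homogeneous p.1 p.2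

end Homogeneous

namespace Gr

/-! ### Finiteness of the degrees of an element -/

section Grading

variable {k : Type u} {C : Type v} [Field k] [AddCommGroup C] [Module k C] [Coalgebra k C]

theorem HasDegree.eq_zero {M : Type*} [AddCommGroup M] [Module k M] {n : ℕ}
    {φ : Gr k C →ₗ[k] M} (h : HasDegree n φ) {m : ℕ} (hm : m ≠ n) {y : Gr k C}
    (hy : proj k C m y = y) : φ y = 0 := by
  obtain ⟨x, hx, hx'⟩ := exists_eq_symb m y
  rw [← hy, hx', h m hm x hx]

theorem exists_proj_eq_zero (y : Gr k C) : ∃ N, ∀ n ≥ N, proj k C n y = 0 := by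
  obtain ⟨N, hN⟩ := exists_sum_proj y
  refine ⟨N, fun n hn => ?_⟩
  have h := hN (n + 1) (by omega)
  rw [Finset.sum_range_succ, ← hN n hn] at h
  exact left_eq_add.1 h

end Grading

/-! ### The embedding of the associated graded coalgebra into a path coalgebra -/

section Embedding

variable {k : Type u} {H : Type v} [Field k] [Ring H] [HopfAlgebra k H] [IsPointed k H]
  {G : Type w} [CommGroup G] (ι : G ≃* GroupLike k H)

/-- The labels of the arrows: a basis of the elements of degree one with
`Δ(z) = z ⊗ 1 + d ⊗ z`, for every group-like element `d`. -/
def Label : Type (max v w) := Σ d : G, Module.Basis.ofVectorSpaceIndex k (skew ι d)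

/-- The group-like element belonging to a label. -/
def label (x : Label ι) : G := x.1

/-- The element of `gr H` belonging to a label. -/
noncomputable def gen (x : Label ι) : Gr k H := (Module.Basis.ofVectorSpace k (skew ι x.1) x.2).1

theorem gen_mem (x : Label ι) : gen ι x ∈ skew ι (label ι x) :=
  (Module.Basis.ofVectorSpace k (skew ι x.1) x.2).2

theorem gen_ne_zero (x : Label ι) : gen ι x ≠ 0 := fun h =>
  (Module.Basis.ofVectorSpace k (skew ι x.1)).ne_zero x.2 (Subtype.ext h)

/-- The linear form on `gr H` belonging to an arrow. -/
noncomputable def arrowForm (g : G) (x : Label ι) : WithConv (Gr k H →ₗ[k] k) :=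
  WithConv.toConv ((Module.Basis.ofVectorSpace k (skew ι x.1)).coord x.2 ∘ₗ skewPart ι g x.1)

theorem arrowForm_apply (g : G) (x : Label ι) (y : Gr k H) : arrowForm ι g x y =
    (Module.Basis.ofVectorSpace k (skew ι x.1)).repr (skewPart ι g x.1 y) x.2 := rfl

-- The arrow forms are dual to the translates of the generators; this is why the embedding sends
-- these translates to the arrows.
open Classical in
theorem arrowForm_gl_mul_gen (g : G) (x : Label ι) (s : G) (x' : Label ι) :
    arrowForm ι g x (gl ι s * gen ι x') = if g = s ∧ x = x' then 1 else 0 := by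
  rw [arrowForm_apply]
  obtain ⟨d, i⟩ := x
  obtain ⟨d', i'⟩ := x'
  have h := skewPart_gl_mul ι g d s d' (gen_mem ι ⟨d', i'⟩)
  by_cases hs : g = s ∧ d = d'
  · obtain ⟨rfl, rfl⟩ := hs
    rw [if_pos ⟨rfl, rfl⟩] at h
    have h' : skewPart ι g d (gl ι g * gen ι ⟨d, i'⟩) =
      Module.Basis.ofVectorSpace k (skew ι d) i' := Subtype.ext h
    change (Module.Basis.ofVectorSpace k (skew ι d)).repr (skewPart ι g d _) i = _
    rw [h', Module.Basis.repr_self, Finsupp.single_apply]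
    congr 1
    simp only [true_and, eq_iff_iff]
    exact ⟨fun h => by rw [h], fun h => (eq_of_heq (Sigma.mk.inj h).2).symm⟩
  · rw [if_neg (fun h' => hs ⟨h'.1.symm, h'.2.symm⟩)] at h
    have h' : skewPart ι g d (gl ι s * gen ι ⟨d', i'⟩) = 0 := Subtype.ext h
    rw [if_neg (fun h' => hs ⟨h'.1, congrArg Sigma.fst h'.2⟩)]
    change (Module.Basis.ofVectorSpace k (skew ι d)).repr (skewPart ι g d _) i = _
    rw [h', map_zero]
    rfl

theorem hasDegree_arrowForm (g : G) (x : Label ι) : HasDegree 1 (arrowForm ι g x).ofConv :=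
  fun m hm y hy => by
    change (Module.Basis.ofVectorSpace k (skew ι x.1)).coord x.2 (skewPart ι g x.1 _) = 0
    rw [hasDegree_skewPart ι g x.1 m hm y hy, map_zero]

theorem ev_mul_arrowForm (g : G) (x : Label ι) :
    ev ι (g * label ι x) * arrowForm ι g x = arrowForm ι g x :=
  WithConv.ext <| LinearMap.ext fun y => by
    change (ev ι (g * label ι x) * arrowForm ι g x) y = arrowForm ι g x y
    rw [← apply_actL, arrowForm_apply, arrowForm_apply, label, skewPart_actL]

theorem arrowForm_mul_ev (g : G) (x : Label ι) :
    arrowForm ι g x * ev ι g = arrowForm ι g x :=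
  WithConv.ext <| LinearMap.ext fun y => by
    change (arrowForm ι g x * ev ι g) y = arrowForm ι g x y
    rw [← apply_actR, arrowForm_apply, arrowForm_apply, skewPart_actR]

theorem finite_arrowForm (y : Gr k H) :
    {p : G × Label ι | arrowForm ι p.1 p.2 y ≠ 0}.Finite := by
  refine Set.Finite.subset (Set.Finite.biUnion (finite_skewPart ι y) fun p _ =>
    (((Module.Basis.ofVectorSpace k (skew ι p.2)).repr
      (skewPart ι p.1 p.2 y)).support.finite_toSet.image fun i => (p.1, (⟨p.2, i⟩ : Label ι)))) ?_
  rintro ⟨g, d, i⟩ h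
  have h' : (Module.Basis.ofVectorSpace k (skew ι d)).repr (skewPart ι g d y) i ≠ 0 := h
  refine Set.mem_biUnion (x := (g, d)) (fun h0 => h' ?_) ⟨i, Finsupp.mem_support_iff.2 h', rfl⟩
  change skewPart ι g d y = 0 at h0
  rw [h0, map_zero]
  rfl

/-- The form of a word is a convolution of one form of degree one per letter and a form of degree
zero. Both the existence of the embedding and its gradedness follow from this. -/
theorem hasDegree_wordForm (g : G) (l : List (Label ι)) :
    HasDegree l.length (wordForm (label ι) (ev ι) (arrowForm ι) g l).ofConv := by
  induction l with
  | nil => exact hasDegree_ev ι g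
  | cons x l ih =>
    rw [List.length_cons, add_comm]
    exact (hasDegree_arrowForm ι _ x).mul ih

/-- The universal property applies to the coordinates of degrees zero and one. The forms of long
words vanish on a given element because it has components in finitely many degrees only. -/
theorem exists_embedding : ∃ F : Gr k H →ₗc[k] PathCoalgebra k (Cayley (label ι)),
    ∀ g l y, coef (label ι) k g l (F y) = wordForm (label ι) (ev ι) (arrowForm ι) g l y := by
  refine exists_coalgHom (coord ι) (ev_apply ι) (counit_eq ι) (ev_mul_self ι)
    (fun g h => ev_mul_of_ne ι) (ev_mul_arrowForm ι) (finite_arrowForm ι) fun y => ?_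
  obtain ⟨N, hN⟩ := exists_proj_eq_zero y
  refine ⟨N, fun g l hl => ?_⟩
  have h := (hasDegree_wordForm ι g l).apply_proj y
  rw [hN _ hl] at h
  exact h.symm.trans (map_zero _)

/-- The embedding of `gr H` into a path coalgebra. -/
noncomputable def embedding : Gr k H →ₗc[k] PathCoalgebra k (Cayley (label ι)) :=
  (exists_embedding ι).choose

theorem coef_embedding (g : G) (l : List (Label ι)) (y : Gr k H) :
    coef (label ι) k g l (embedding ι y) = wordForm (label ι) (ev ι) (arrowForm ι) g l y :=
  (exists_embedding ι).choose_spec g l y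

theorem embedding_mem_homogeneous {n : ℕ} {y : Gr k H} (hy : proj k H n y = y) :
    embedding ι y ∈ PathCoalgebra.homogeneous k (Cayley (label ι)) n :=
  mem_homogeneous_of_coef_eq_zero fun g l hl => by
    rw [coef_embedding]
    exact (hasDegree_wordForm ι g l).eq_zero (Ne.symm hl) hy

theorem embedding_gl (g : G) : embedding ι (gl ι g) = word (label ι) k g [] := by
  classical
  refine eq_of_coef_eq fun h l => ?_
  rw [coef_word, coef_embedding]
  cases l with
  | nil =>
    rw [wordForm, ev_gl]
    simp only [and_true, eq_comm]
  | cons x l =>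
    rw [if_neg (by simp)]
    exact (hasDegree_wordForm ι h (x :: l)).eq_zero (by simp) (proj_gl ι g)

theorem proj_gl_mul_gen (g : G) (x : Label ι) :
    proj k H 1 (gl ι g * gen ι x) = gl ι g * gen ι x := by
  rw [proj_gl_mul, ((mem_skew ι).1 (gen_mem ι x)).1]

theorem embedding_gl_mul_gen (g : G) (x : Label ι) :
    embedding ι (gl ι g * gen ι x) = word (label ι) k g [x] := by
  classical
  refine eq_of_coef_eq fun h l => ?_
  rw [coef_word, coef_embedding]
  match l with
  | [] =>
    rw [wordForm, ev_eq_zero ι (proj_gl_mul_gen ι g x), if_neg (by simp)]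
  | [y] =>
    -- The form of a one-letter word carries the vertex form of the start point as an extra factor,
    -- which the arrow form absorbs.
    rw [wordForm, wordForm, tgt, arrowForm_mul_ev, arrowForm_gl_mul_gen]
    simp only [List.cons.injEq, and_true]
  | y :: z :: l =>
    rw [if_neg (by simp)]
    exact (hasDegree_wordForm ι h (y :: z :: l)).eq_zero (by simp) (proj_gl_mul_gen ι g x)

theorem skew_le_span (d : G) :
    skew ι d ≤ Submodule.span k (Set.range (gen ι)) := by
  intro z hz
  have h := (Module.Basis.ofVectorSpace k (skew ι d)).linearCombination_repr ⟨z, hz⟩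
  have h' : z = ((Finsupp.linearCombination k (Module.Basis.ofVectorSpace k (skew ι d)))
    ((Module.Basis.ofVectorSpace k (skew ι d)).repr ⟨z, hz⟩)).1 := (congrArg Subtype.val h).symm
  rw [h', Finsupp.linearCombination_apply, Finsupp.sum, Submodule.coe_sum]
  refine sum_mem fun i _ => ?_
  exact Submodule.smul_mem _ _ (Submodule.subset_span ⟨(⟨d, i⟩ : Label ι), rfl⟩)

theorem proj_one_mem (y : Gr k H) : proj k H 1 y ∈
    Submodule.span k (Set.range fun p : G × Label ι => gl ι p.1 * gen ι p.2) := by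
  refine proj_one_induction ι fun g d => ?_
  have h : Submodule.span k (Set.range (gen ι)) ≤ (Submodule.span k (Set.range
      fun p : G × Label ι => gl ι p.1 * gen ι p.2)).comap (LinearMap.mulLeft k (gl ι g)) := by
    refine Submodule.span_le.2 ?_
    rintro _ ⟨x, rfl⟩
    exact Submodule.subset_span ⟨(g, x), rfl⟩
  exact h (skew_le_span ι d (skewPart ι g d y).2)

/-- Induction on the degree. In degrees zero and one the coefficients are full systems of
coordinates. In degree `n + 2` the embedding, being a coalgebra map, shows that the bidegree `(1, n
+ 1)` component of the coproduct is killed by the tensor product of its restrictions to degrees `1`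
and `n + 1`. These are injective by induction, and `symb_eq_zero_of_map_toQuotient` concludes. -/
theorem eq_zero_of_embedding_proj (n : ℕ) (y : Gr k H) (h : embedding ι (proj k H n y) = 0) :
    proj k H n y = 0 := by
  have hc : ∀ g l, wordForm (label ι) (ev ι) (arrowForm ι) g l (proj k H n y) = 0 := fun g l => by
    rw [← coef_embedding, h]
    exact map_zero (coef (label ι) k g l).ofConv
  induction n using Nat.strong_induction_on generalizing y with
  | _ n ih =>
  match n with
  | 0 =>
    rw [← proj_proj, proj_zero_eq ι]
    have : coord ι (proj k H 0 y) = 0 := Finsupp.ext fun g => hc g []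
    rw [this, map_zero]
  | 1 =>
    rw [← proj_proj]
    refine (Submodule.mem_bot k).1 (proj_one_induction ι fun g d => ?_)
    have : skewPart ι g d (proj k H 1 y) = 0 := by
      refine (Module.Basis.ofVectorSpace k (skew ι d)).ext_elem fun i => ?_
      let x : Label ι := ⟨d, i⟩
      have h1 : (arrowForm ι g x * ev ι g) (proj k H 1 y) = 0 := hc g [x]
      rw [arrowForm_mul_ev] at h1
      rw [map_zero]
      exact h1
    rw [this]
    exact (Submodule.mem_bot k).2 (mul_zero _)
  | n + 2 =>
    obtain ⟨x, hx, hxy⟩ := exists_eq_symb (n + 2) y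
    have e : n + 2 = 1 + (n + 1) := by omega
    rw [hxy]
    rw [hxy] at h
    clear hxy hc
    rw [e] at hx h ⊢
    refine symb_eq_zero_of_map_toQuotient hx ?_
    -- It suffices that in degrees `1` and `n + 1` the embedding kills no more than `toQuotient`
    -- does, which is supplied by the induction hypothesis.
    refine map_eq_zero_of_ker_le (f := (embedding ι).toLinearMap ∘ₗ proj k H 1)
      (g := (embedding ι).toLinearMap ∘ₗ proj k H (n + 1)) ?_ ?_ ?_
    · intro w hw
      have h0 := ih 1 (by omega) w hw fun g l => by
        rw [← coef_embedding]
        exact (congrArg (coef (label ι) k g l).ofConv hw).trans (map_zero _)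
      rw [LinearMap.mem_ker, ← (hasDegree_toQuotient 1).apply_proj, h0, map_zero]
    · intro w hw
      have h0 := ih (n + 1) (by omega) w hw fun g l => by
        rw [← coef_embedding]
        exact (congrArg (coef (label ι) k g l).ofConv hw).trans (map_zero _)
      rw [LinearMap.mem_ker, ← (hasDegree_toQuotient (n + 1)).apply_proj, h0, map_zero]
    · refine tensor_eq_of_coef_eq _ fun g l g' l' => ?_
      -- The coefficient of a word only sees the degree equal to its length, so each projection can
      -- either be dropped or annihilates the term.
      have hcomp : ∀ m g l, (coef (label ι) k g l).ofConv ∘ₗ (embedding ι).toLinearMap ∘ₗ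
          proj k H m = if l.length = m then
            (coef (label ι) k g l).ofConv ∘ₗ (embedding ι).toLinearMap else 0 := by
        intro m g l
        refine LinearMap.ext fun w => ?_
        have h1 : ((coef (label ι) k g l).ofConv ∘ₗ (embedding ι).toLinearMap ∘ₗ proj k H m) w =
          wordForm (label ι) (ev ι) (arrowForm ι) g l (proj k H m w) := coef_embedding ι g l _
        rw [h1]
        split_ifs with hl
        · subst hl
          exact ((hasDegree_wordForm ι g l).apply_proj w).trans (coef_embedding ι g l w).symm
        · exact (hasDegree_wordForm ι g l).eq_zero (Ne.symm hl) (proj_proj m w)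
      rw [map_zero, TensorProduct.map_map, hcomp, hcomp]
      split_ifs
      · rw [← TensorProduct.map_map]
        have h2 : TensorProduct.map (embedding ι).toLinearMap (embedding ι).toLinearMap
            (comul (R := k) (symb k H (1 + (n + 1)) x)) = 0 := by
          refine (CoalgHomClass.map_comp_comul_apply (embedding ι) _).trans ?_
          rw [h, map_zero]
        rw [h2, map_zero]
      all_goals simp

theorem embedding_injective : Function.Injective (embedding ι) := by
  refine (injective_iff_map_eq_zero (embedding ι)).2 fun y hy => eq_zero_of_proj_eq_zero fun n =>
    eq_zero_of_embedding_proj ι n y (eq_of_coef_eq fun g l => ?_)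
  have h0 : coef (label ι) k g l 0 = 0 := map_zero (coef (label ι) k g l).ofConv
  rw [coef_embedding, h0]
  by_cases hl : l.length = n
  · subst hl
    refine ((hasDegree_wordForm ι g l).apply_proj y).trans ((coef_embedding ι g l y).symm.trans ?_)
    rw [hy, h0]
  · exact (hasDegree_wordForm ι g l).eq_zero (Ne.symm hl) (proj_proj n y)

end Embedding

end Gr

/-! ### Bialgebra morphisms respect antipodes -/

section Antipode

variable {k : Type u} [Field k] {A : Type v} {B : Type w} [Ring A] [HopfAlgebra k A] [Ring B]
  [HopfAlgebra k B]

/-- Morphisms of bialgebras between Hopf algebras respect the antipodes. -/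
theorem map_antipode_of_bialgHom (F : A →ₐc[k] B) (x : A) :
    F (HopfAlgebra.antipode k x) = HopfAlgebra.antipode k (F x) := by
  -- In the convolution algebra, `F` followed by the antipode is a right inverse of `F`, and the
  -- antipode followed by `F` is a left inverse; so the two agree.
  let f : WithConv (A →ₗ[k] B) := WithConv.toConv (F : A →ₐ[k] B).toLinearMap
  let p : WithConv (A →ₗ[k] B) :=
    WithConv.toConv ((F : A →ₐ[k] B).toLinearMap ∘ₗ HopfAlgebra.antipode k)
  let q : WithConv (A →ₗ[k] B) :=
    WithConv.toConv (HopfAlgebra.antipode k ∘ₗ (F : A →ₐ[k] B).toLinearMap)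
  have hp : p * f = 1 := by
    refine WithConv.ext (LinearMap.ext fun y => ?_)
    change LinearMap.mul' k B (TensorProduct.map ((F : A →ₐ[k] B).toLinearMap ∘ₗ
      HopfAlgebra.antipode k) (F : A →ₐ[k] B).toLinearMap (comul (R := k) y)) =
        algebraMap k B (counit (R := k) y)
    have h : LinearMap.mul' k B ∘ₗ TensorProduct.map ((F : A →ₐ[k] B).toLinearMap ∘ₗ
        HopfAlgebra.antipode k) (F : A →ₐ[k] B).toLinearMap = (F : A →ₐ[k] B).toLinearMap ∘ₗ
          LinearMap.mul' k A ∘ₗ (HopfAlgebra.antipode k).rTensor A :=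
      TensorProduct.ext' fun a b => by simp
    refine (LinearMap.congr_fun h (comul (R := k) y)).trans ?_
    simp only [LinearMap.comp_apply]
    rw [HopfAlgebra.mul_antipode_rTensor_comul_apply]
    exact AlgHomClass.commutes F _
  have hq : f * q = 1 := by
    refine WithConv.ext (LinearMap.ext fun y => ?_)
    change LinearMap.mul' k B (TensorProduct.map (F : A →ₐ[k] B).toLinearMap
      (HopfAlgebra.antipode k ∘ₗ (F : A →ₐ[k] B).toLinearMap) (comul (R := k) y)) =
        algebraMap k B (counit (R := k) y)
    have h : TensorProduct.map (F : A →ₐ[k] B).toLinearMap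
      (HopfAlgebra.antipode k ∘ₗ (F : A →ₐ[k] B).toLinearMap) =
        (HopfAlgebra.antipode k).lTensor B ∘ₗ
          TensorProduct.map (F : A →ₐ[k] B).toLinearMap (F : A →ₐ[k] B).toLinearMap :=
      TensorProduct.ext' fun a b => by simp
    have h2 : TensorProduct.map (F : A →ₐ[k] B).toLinearMap (F : A →ₐ[k] B).toLinearMap
      (comul (R := k) y) = comul (R := k) (F y) := CoalgHomClass.map_comp_comul_apply F y
    rw [h, LinearMap.comp_apply, h2, HopfAlgebra.mul_antipode_lTensor_comul_apply]
    rw [CoalgHomClass.counit_comp_apply F y]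
  exact LinearMap.congr_fun (congrArg WithConv.ofConv (left_inv_eq_right_inv hp hq)) x

end Antipode

/-! ### Vanishing of the trivial extension in positive degrees -/

section TrivialExtension

variable {G : Type v} {X : Type w} [CommGroup G] {c : X → G} {k : Type u} [Field k]
  {χ : G →* G →* kˣ}

namespace ShuffleHopf

theorem trivExt_eq_zero_left (ψ : G →* G →* kˣ) {n : ℕ} (hn : n ≠ 0)
    {z : (shuffleHopf c χ).Carrier} (hz : z ∈ PathCoalgebra.homogeneous k (Cayley c) n)
    (y : (shuffleHopf c χ).Carrier) : trivExt c χ ψ (z ⊗ₜ[k] y) = 0 := by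
  refine homogeneous_le (P := LinearMap.ker ((TensorProduct.lift.equiv _ _ _ _).symm
    (trivExt c χ ψ) |>.flip y)) (fun g l hl => ?_) hz
  cases l with
  | nil => exact absurd hl.symm hn
  | cons x l => exact trivExt_cons_left ψ g x l y

theorem trivExt_eq_zero_right (ψ : G →* G →* kˣ) {n : ℕ} (hn : n ≠ 0)
    {z : (shuffleHopf c χ).Carrier} (hz : z ∈ PathCoalgebra.homogeneous k (Cayley c) n)
    (y : (shuffleHopf c χ).Carrier) : trivExt c χ ψ (y ⊗ₜ[k] z) = 0 := by
  refine homogeneous_le (P := LinearMap.ker ((TensorProduct.lift.equiv _ _ _ _).symm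
    (trivExt c χ ψ) y)) (fun g l hl => ?_) hz
  cases l with
  | nil => exact absurd hl.symm hn
  | cons x l => exact trivExt_cons_right ψ g x l y

end ShuffleHopf

end TrivialExtension

namespace Gr

/-! ### The embedding as a morphism of coquasitriangular Hopf algebras -/

section Realization

variable {k : Type u} {H : Type v} [Field k] [Ring H] [HopfAlgebra k H] [IsPointed k H]
  {G : Type w} [CommGroup G] (ι : G ≃* GroupLike k H) {R : H ⊗[k] H →ₗ[k] k}
  (hR : IsCoquasitriangular R)

theorem label_bichar (x : Label ι) (h : G) :
    hR.bichar ι (label ι x) h * hR.bichar ι h (label ι x) = 1 :=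
  bichar_mul_bichar ι hR h (gen_mem ι x) (gen_ne_zero ι x)

/-- The Hopf algebra structure on the path coalgebra attached to `gr H`. -/
noncomputable abbrev hopf : GradedHopfStructure k (Cayley (label ι)) :=
  shuffleHopf (label ι) (hR.bichar ι)

/-- The embedding of `gr H` into the path coalgebra, regarded as a Hopf algebra. -/
noncomputable def embeddingHopf : Gr k H →ₗc[k] (hopf ι hR).Carrier := embedding ι

open ShuffleHopf

theorem embeddingHopf_gl (g : G) :
    embeddingHopf ι hR (gl ι g) = wd (label ι) (hR.bichar ι) g [] := embedding_gl ι g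

theorem embeddingHopf_gl_mul_gen (g : G) (x : Label ι) :
    embeddingHopf ι hR (gl ι g * gen ι x) = wd (label ι) (hR.bichar ι) g [x] :=
  embedding_gl_mul_gen ι g x

theorem wd_nil_mul_wd_nil (g h : G) :
    wd (label ι) (hR.bichar ι) g [] * wd (label ι) (hR.bichar ι) h [] =
      wd (label ι) (hR.bichar ι) (g * h) [] := wd_nil_mul g h []

theorem wd_single_mul_wd_nil (g : G) (x : Label ι) (h : G) :
    wd (label ι) (hR.bichar ι) g [x] * wd (label ι) (hR.bichar ι) h [] =
      (hR.bichar ι h (label ι x) : k) • wd (label ι) (hR.bichar ι) (g * h) [x] := by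
  refine (wd_mul_wd g [x] h []).trans ?_
  rw [shuffle, shuffle, snoc_word, inv_eq_of_mul_eq_one_right (label_bichar ι hR x h)]
  rfl

/-- The scalar is the one of `wd_single_mul_wd_nil`: degree one of `gr H` and the arrows have the
same bimodule structure over the group. This accounts for the inverse of `χ` in the definition of
`shuffle`. -/
theorem gl_mul_gen_mul_gl (g : G) (x : Label ι) (h : G) :
    gl ι g * gen ι x * gl ι h = (hR.bichar ι h (label ι x) : k) • (gl ι (g * h) * gen ι x) := by
  rw [mul_assoc, skew_mul_gl ι hR h (gen_mem ι x), mul_smul_comm, ← mul_assoc, gl_mul]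

theorem proj_zero_ext {M : Type*} [AddCommGroup M] [Module k M] (φ ψ : Gr k H →ₗ[k] M)
    (h : ∀ g, φ (gl ι g) = ψ (gl ι g)) (y : Gr k H) : φ (proj k H 0 y) = ψ (proj k H 0 y) := by
  rw [proj_zero_eq ι]
  refine LinearMap.congr_fun (f := φ ∘ₗ Finsupp.linearCombination k (gl ι))
    (g := ψ ∘ₗ Finsupp.linearCombination k (gl ι)) (Finsupp.lhom_ext fun g r => ?_) (coord ι y)
  rw [LinearMap.comp_apply, LinearMap.comp_apply, Finsupp.linearCombination_single, map_smul,
    map_smul, h]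

theorem proj_one_ext {M : Type*} [AddCommGroup M] [Module k M] (φ ψ : Gr k H →ₗ[k] M)
    (h : ∀ g x, φ (gl ι g * gen ι x) = ψ (gl ι g * gen ι x)) (y : Gr k H) :
    φ (proj k H 1 y) = ψ (proj k H 1 y) := by
  refine (Submodule.span_le (p := LinearMap.eqLocus φ ψ)).2 ?_ (proj_one_mem ι y)
  rintro _ ⟨p, rfl⟩
  exact h p.1 p.2

theorem embeddingHopf_mul_low (m n : ℕ) (hmn : m + n ≤ 1) (x y : Gr k H) :
    embeddingHopf ι hR (proj k H m x * proj k H n y) =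
      embeddingHopf ι hR (proj k H m x) * embeddingHopf ι hR (proj k H n y) := by
  let Φ : Gr k H →ₗ[k] Gr k H →ₗ[k] (hopf ι hR).Carrier :=
    (LinearMap.mul k (Gr k H)).compr₂ (embeddingHopf ι hR).toLinearMap
  let Ψ : Gr k H →ₗ[k] Gr k H →ₗ[k] (hopf ι hR).Carrier :=
    (LinearMap.mul k (hopf ι hR).Carrier).compl₁₂ (embeddingHopf ι hR).toLinearMap
      (embeddingHopf ι hR).toLinearMap
  have hcases : (m = 0 ∧ n = 0) ∨ (m = 0 ∧ n = 1) ∨ (m = 1 ∧ n = 0) := by omega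
  rcases hcases with ⟨rfl, rfl⟩ | ⟨rfl, rfl⟩ | ⟨rfl, rfl⟩
  · refine proj_zero_ext ι (Φ.flip (proj k H 0 y)) (Ψ.flip (proj k H 0 y)) (fun g => ?_) x
    refine proj_zero_ext ι (Φ (gl ι g)) (Ψ (gl ι g)) (fun h => ?_) y
    change embeddingHopf ι hR (gl ι g * gl ι h) =
      embeddingHopf ι hR (gl ι g) * embeddingHopf ι hR (gl ι h)
    rw [← gl_mul, embeddingHopf_gl, embeddingHopf_gl, embeddingHopf_gl, wd_nil_mul_wd_nil]
  · refine proj_zero_ext ι (Φ.flip (proj k H 1 y)) (Ψ.flip (proj k H 1 y)) (fun g => ?_) x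
    refine proj_one_ext ι (Φ (gl ι g)) (Ψ (gl ι g)) (fun h z => ?_) y
    change embeddingHopf ι hR (gl ι g * (gl ι h * gen ι z)) =
      embeddingHopf ι hR (gl ι g) * embeddingHopf ι hR (gl ι h * gen ι z)
    rw [← mul_assoc, ← gl_mul, embeddingHopf_gl, embeddingHopf_gl_mul_gen,
      embeddingHopf_gl_mul_gen]
    exact (wd_nil_mul g h [z]).symm
  · refine proj_one_ext ι (Φ.flip (proj k H 0 y)) (Ψ.flip (proj k H 0 y)) (fun g z => ?_) x
    refine proj_zero_ext ι (Φ (gl ι g * gen ι z)) (Ψ (gl ι g * gen ι z)) (fun h => ?_) y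
    change embeddingHopf ι hR (gl ι g * gen ι z * gl ι h) =
      embeddingHopf ι hR (gl ι g * gen ι z) * embeddingHopf ι hR (gl ι h)
    rw [gl_mul_gen_mul_gl ι hR, map_smul, embeddingHopf_gl, embeddingHopf_gl_mul_gen,
      embeddingHopf_gl_mul_gen, wd_single_mul_wd_nil]

theorem proj_mul_proj (m n : ℕ) (x y : Gr k H) :
    proj k H (m + n) (proj k H m x * proj k H n y) = proj k H m x * proj k H n y := by
  obtain ⟨a, ha, hx⟩ := exists_eq_symb m x
  obtain ⟨b, hb, hy⟩ := exists_eq_symb n y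
  rw [hx, hy, symb_mul_symb ha hb, proj_symb_self (mul_mem_coradFiltration ha hb)]

/-- Both sides are coalgebra maps from `gr H ⊗ gr H` to the path coalgebra, so the coefficients of
vertices and arrows decide. On homogeneous elements of total degree at most one this is
`embeddingHopf_mul_low`; in higher total degree all these coefficients vanish, as the embedding and
the products are graded. -/
theorem embeddingHopf_mul (x y : Gr k H) :
    embeddingHopf ι hR (x * y) = embeddingHopf ι hR x * embeddingHopf ι hR y := by
  let F : Gr k H ⊗[k] Gr k H →ₗc[k] PathCoalgebra k (Cayley (label ι)) :=
    (embeddingHopf ι hR).comp (Bialgebra.mulCoalgHom k (Gr k H))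
  let F' : Gr k H ⊗[k] Gr k H →ₗc[k] PathCoalgebra k (Cayley (label ι)) :=
    (Bialgebra.mulCoalgHom k (hopf ι hR).Carrier).comp
      (Coalgebra.TensorProduct.map (embeddingHopf ι hR) (embeddingHopf ι hR))
  have hF : ∀ a b, F (a ⊗ₜ[k] b) = embeddingHopf ι hR (a * b) := fun a b => rfl
  have hF' : ∀ a b, F' (a ⊗ₜ[k] b) = embeddingHopf ι hR a * embeddingHopf ι hR b := fun a b => rfl
  have key : F = F' := by
    refine coalgHom_ext fun g l hl => TensorProduct.ext (hom_ext fun m a ha => hom_ext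
      fun n b hb => ?_)
    change coef (label ι) k g l (F (symb k H m a ⊗ₜ[k] symb k H n b)) =
      coef (label ι) k g l (F' (symb k H m a ⊗ₜ[k] symb k H n b))
    rw [hF, hF', ← proj_symb_self ha, ← proj_symb_self hb]
    by_cases hmn : m + n ≤ 1
    · rw [embeddingHopf_mul_low ι hR m n hmn]
    · refine (coef_eq_zero (n := m + n) (embedding_mem_homogeneous ι (proj_mul_proj m n _ _))
        (by omega)).trans ?_
      refine (coef_eq_zero (n := m + n) ?_ (by omega)).symm
      exact (hopf ι hR).mul_mem (embedding_mem_homogeneous ι (proj_proj m _))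
        (embedding_mem_homogeneous ι (proj_proj n _))
  rw [← hF, key, hF']

/-- The embedding of `gr H` into the path coalgebra, as a morphism of bialgebras. -/
noncomputable def embeddingBialg : Gr k H →ₐc[k] (hopf ι hR).Carrier :=
  BialgHom.ofAlgHom
    (AlgHom.ofLinearMap (embeddingHopf ι hR).toLinearMap (by
      rw [← gl_one ι]
      exact embeddingHopf_gl ι hR 1) (embeddingHopf_mul ι hR))
    (AlgHom.ext fun y => CoalgHomClass.counit_comp_apply (embeddingHopf ι hR) y)
    (AlgHom.ext fun y => CoalgHomClass.map_comp_comul_apply (embeddingHopf ι hR) y)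

/-- Both forms vanish as soon as one argument has positive degree, and at group-like elements both
are given by the values of `R`, since the bicharacter is its restriction. -/
theorem trivExt_embedding (x y : Gr k H) :
    trivExt (label ι) (hR.bichar ι) (hR.bichar ι)
      (embeddingHopf ι hR x ⊗ₜ[k] embeddingHopf ι hR y) = grForm R (x ⊗ₜ[k] y) := by
  let Φ : Gr k H →ₗ[k] Gr k H →ₗ[k] k := TensorProduct.curry
    (trivExt (label ι) (hR.bichar ι) (hR.bichar ι) ∘ₗ TensorProduct.map
      (embeddingHopf ι hR).toLinearMap (embeddingHopf ι hR).toLinearMap)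
  let Ψ : Gr k H →ₗ[k] Gr k H →ₗ[k] k := TensorProduct.curry (grForm R)
  have : trivExt (label ι) (hR.bichar ι) (hR.bichar ι) ∘ₗ TensorProduct.map
      (embeddingHopf ι hR).toLinearMap (embeddingHopf ι hR).toLinearMap = grForm R := by
    refine TensorProduct.ext (hom_ext fun m a ha => hom_ext fun n b hb => ?_)
    change trivExt (label ι) (hR.bichar ι) (hR.bichar ι)
      (embeddingHopf ι hR (symb k H m a) ⊗ₜ[k] embeddingHopf ι hR (symb k H n b)) =
      grForm R (symb k H m a ⊗ₜ[k] symb k H n b)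
    by_cases hm : m = 0
    · by_cases hn : n = 0
      · subst hm hn
        rw [← proj_symb_self ha, ← proj_symb_self hb]
        refine proj_zero_ext ι (Φ.flip (proj k H 0 (symb k H 0 b)))
          (Ψ.flip (proj k H 0 (symb k H 0 b))) (fun g => ?_) _
        refine proj_zero_ext ι (Φ (gl ι g)) (Ψ (gl ι g)) (fun h => ?_) _
        change trivExt (label ι) (hR.bichar ι) (hR.bichar ι)
          (embeddingHopf ι hR (gl ι g) ⊗ₜ[k] embeddingHopf ι hR (gl ι h)) =
          grForm R (gl ι g ⊗ₜ[k] gl ι h)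
        rw [embeddingHopf_gl, embeddingHopf_gl, trivExt_wd, if_pos ⟨rfl, rfl⟩, grForm,
          LinearMap.comp_apply, TensorProduct.map_tmul, gl, gl, degreeZero_symb (groupLike_mem _),
          degreeZero_symb (groupLike_mem _)]
        rfl
      · refine (trivExt_eq_zero_right _ hn
          (embedding_mem_homogeneous ι (proj_symb_self hb)) _).trans ?_
        rw [symb_eq_cls ha, symb_eq_cls hb, grForm_cls_of_ne R (Or.inr hn)]
    · refine (trivExt_eq_zero_left _ hm
        (embedding_mem_homogeneous ι (proj_symb_self ha)) _).trans ?_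
      rw [symb_eq_cls ha, symb_eq_cls hb, grForm_cls_of_ne R (Or.inl hm)]
  exact LinearMap.congr_fun this (x ⊗ₜ[k] y)

/-- The realization of `gr H` as a large sub Hopf algebra of a path coalgebra. -/
noncomputable def realization : LargeRealization R (Cayley (label ι)) where
  S := hopf ι hR
  χ := bichar (label ι) (hR.bichar ι) (hR.bichar ι)
  isCoquasitriangular := isCoquasitriangular_trivExt (label_bichar ι hR)
  emb := embeddingBialg ι hR
  injective := embedding_injective ι
  antipode_emb := map_antipode_of_bialgHom _
  large n hn x hx := by
    refine homogeneous_le (P := LinearMap.range (embedding ι).toLinearMap) (fun g l hl => ?_) hx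
    match l with
    | [] => exact ⟨gl ι g, embedding_gl ι g⟩
    | [x] => exact ⟨gl ι g * gen ι x, embedding_gl_mul_gen ι g x⟩
    | _ :: _ :: _ => simp at hl; omega
  form_emb := trivExt_embedding ι hR

theorem realization_isGraded : (realization ι hR).IsGraded := by
  rintro n _ ⟨x, rfl⟩
  refine embedding_mem_homogeneous ι ?_
  rw [← symb_eq_cls x.2, proj_symb_self x.2]

end Realization

end Gr

/-! ### Recovering the quiver from a large subcoalgebra -/

section Uniqueness

variable {k : Type u} [Field k] {C : Type v} [AddCommGroup C] [Module k C] [Coalgebra k C]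

variable (k) in
/-- The elements `x` with `Δ(x) = x ⊗ g + h ⊗ x`. -/
noncomputable def skewPrim (g h : C) : Submodule k C :=
  LinearMap.eqLocus comul ((TensorProduct.mk k C C).flip g + TensorProduct.mk k C C h)

theorem mem_skewPrim {g h x : C} :
    x ∈ skewPrim k g h ↔ comul (R := k) x = x ⊗ₜ[k] g + h ⊗ₜ[k] x := Iff.rfl

theorem conv_apply_of_mem_skewPrim {g h x : C} (hx : x ∈ skewPrim k g h)
    (f f' : WithConv (C →ₗ[k] k)) : (f * f') x = f x * f' g + f h * f' x := by
  rw [LinearMap.convMul_apply, mem_skewPrim.1 hx, map_add, map_add, TensorProduct.map_tmul,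
    TensorProduct.map_tmul, LinearMap.mul'_apply, LinearMap.mul'_apply]

variable {V : Type w} [Quiver.{w'} V]

theorem map_mem_skewPrim (F : C →ₗc[k] PathCoalgebra k V) {g h x : C} (hx : x ∈ skewPrim k g h) :
    F x ∈ skewPrim k (F g) (F h) := by
  rw [mem_skewPrim, ← CoalgHomClass.map_comp_comul_apply, mem_skewPrim.1 hx, map_add,
    TensorProduct.map_tmul, TensorProduct.map_tmul]
  rfl

/-- The tensor square of an injective linear map over a field is injective, so the equation may be
tested in the path coalgebra. -/
theorem mem_skewPrim_of_map {F : C →ₗc[k] PathCoalgebra k V} (hF : Function.Injective F) {g h x : C}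
    (hx : F x ∈ skewPrim k (F g) (F h)) : x ∈ skewPrim k g h := by
  have hFF : Function.Injective (TensorProduct.map F.toLinearMap F.toLinearMap) :=
    TensorProduct.map_injective_of_flat_flat _ _ hF hF
  refine mem_skewPrim.2 (hFF ?_)
  refine (CoalgHomClass.map_comp_comul_apply F x).trans ((mem_skewPrim.1 hx).trans ?_)
  rw [map_add, TensorProduct.map_tmul, TensorProduct.map_tmul]
  rfl

theorem isGroupLikeElem_of_map {F : C →ₗc[k] PathCoalgebra k V} (hF : Function.Injective F) {x : C}
    (hx : IsGroupLikeElem k (F x)) : IsGroupLikeElem k x where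
  counit_eq_one := (CoalgHomClass.counit_comp_apply F x).symm.trans hx.counit_eq_one
  comul_eq_tmul_self := by
    have hFF : Function.Injective (TensorProduct.map F.toLinearMap F.toLinearMap) :=
      TensorProduct.map_injective_of_flat_flat _ _ hF hF
    refine hFF ((CoalgHomClass.map_comp_comul_apply F x).trans (hx.comul_eq_tmul_self.trans ?_))
    rw [TensorProduct.map_tmul]
    rfl

open Classical in
theorem pathCoef_nil_vertex (a c : V) : pathCoef k (Quiver.Path.nil : Quiver.Path c c)
    (PathCoalgebra.vertex k a) = if a = c then 1 else 0 := by
  rw [PathCoalgebra.vertex, pathCoef_path]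
  congr 1
  refine propext ⟨fun h => congrArg Sigma.fst h, fun h => by rw [h]⟩

theorem pathCoef_cons_vertex {a b c : V} (q : Quiver.Path a b) (e : b ⟶ c) (d : V) :
    pathCoef k (q.cons e) (PathCoalgebra.vertex k d) = 0 :=
  pathCoef_eq_zero (by simp)

theorem path_toPath_mem_skewPrim {a b : V} (e : a ⟶ b) : PathCoalgebra.path k e.toPath ∈
    skewPrim k (PathCoalgebra.vertex k a) (PathCoalgebra.vertex k b) := by
  rw [mem_skewPrim, PathCoalgebra.comul_path]
  simp [Quiver.Hom.toPath, pathCuts, PathCoalgebra.vertex, add_comm]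

/-- A skew primitive element of a path coalgebra without components on the arrows is a multiple of
the difference of the two vertices. -/
theorem eq_smul_of_mem_skewPrim {a b : V} {z : PathCoalgebra k V}
    (hz : z ∈ skewPrim k (PathCoalgebra.vertex k a) (PathCoalgebra.vertex k b))
    (h : ∀ e : a ⟶ b, pathCoef k e.toPath z = 0) :
    z = pathCoef k (Quiver.Path.nil : Quiver.Path a a) z •
      (PathCoalgebra.vertex k a - PathCoalgebra.vertex k b) := by
  classical
  refine eq_of_pathCoef_eq fun c d p => ?_
  have hr : pathCoef k p (pathCoef k (Quiver.Path.nil : Quiver.Path a a) z •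
      (PathCoalgebra.vertex k a - PathCoalgebra.vertex k b)) =
      pathCoef k (Quiver.Path.nil : Quiver.Path a a) z * (pathCoef k p (PathCoalgebra.vertex k a) -
        pathCoef k p (PathCoalgebra.vertex k b)) := by
    rw [map_smul, map_sub, smul_eq_mul]
  rw [hr]
  cases p with
  | nil =>
    rw [pathCoef_nil_vertex, pathCoef_nil_vertex]
    have h1 := conv_apply_of_mem_skewPrim hz (pathCoef k (Quiver.Path.nil : Quiver.Path c c))
      (pathCoef k (Quiver.Path.nil : Quiver.Path c c))
    -- For `a ≠ b` the convolution of the vertex coefficients at `b` and `a` is zero, and this makes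
    -- the coefficients of `z` at `a` and `b` opposite.
    have h2 := conv_apply_of_mem_skewPrim hz (pathCoef k (Quiver.Path.nil : Quiver.Path b b))
      (pathCoef k (Quiver.Path.nil : Quiver.Path a a))
    rw [pathCoef_mul_nil, if_pos rfl, pathCoef_nil_vertex, pathCoef_nil_vertex] at h1
    rw [pathCoef_mul_nil, pathCoef_nil_vertex, pathCoef_nil_vertex, if_pos rfl, if_pos rfl] at h2
    by_cases hac : a = c
    · subst hac
      by_cases hab : b = a
      · subst hab
        simp at h1 ⊢
        exact h1
      · simp [hab]
    · by_cases hbc : b = c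
      · subst hbc
        rw [if_neg (Ne.symm hac)] at h2
        change (0 : k) = _ at h2
        simp only [if_neg hac, if_true, zero_sub, mul_neg, mul_one]
        linear_combination -h2
      · simp only [if_neg hac, if_neg hbc, mul_zero, zero_mul, add_zero] at h1
        simp only [if_neg hac, if_neg hbc, sub_zero, mul_zero]
        exact h1
  | cons q e =>
    rw [pathCoef_cons_vertex, pathCoef_cons_vertex, sub_zero, mul_zero]
    cases q with
    | cons q e' =>
      -- The coefficient of a path of length at least two is a convolution of two forms which both
      -- vanish on vertices.
      rw [pathCoef_cons, conv_apply_of_mem_skewPrim hz, pathCoef_cons_vertex,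
        Quiver.Hom.toPath, pathCoef_cons_vertex, mul_zero, zero_mul, add_zero]
    | nil =>
      change pathCoef k e.toPath z = 0
      by_cases hac : a = c
      · subst hac
        by_cases hbd : b = d
        · subst hbd
          exact h e
        -- The coefficient of an arrow absorbs the vertex coefficient at its end point `d`, which
        -- vanishes at `b`. An arrow which does not start at `a` is treated in the same way below,
        -- with its start point.
        · have h1 := conv_apply_of_mem_skewPrim hz
            (pathCoef k (Quiver.Path.nil : Quiver.Path d d)) (pathCoef k e.toPath)
          rw [nil_mul_pathCoef, if_pos rfl, pathCoef_nil_vertex, if_neg hbd, zero_mul, add_zero,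
            Quiver.Hom.toPath, pathCoef_cons_vertex, mul_zero] at h1
          exact h1
      · have h1 := conv_apply_of_mem_skewPrim hz
            (pathCoef k e.toPath) (pathCoef k (Quiver.Path.nil : Quiver.Path c c))
        rw [pathCoef_mul_nil, if_pos rfl, pathCoef_nil_vertex, if_neg hac, mul_zero, zero_add,
          Quiver.Hom.toPath, pathCoef_cons_vertex, zero_mul] at h1
        exact h1

/-- The quotient of the skew primitive elements by the trivial ones. -/
abbrev SkewQuotient (k : Type u) [Field k] {C : Type v} [AddCommGroup C] [Module k C]
    [Coalgebra k C] (g h : C) : Type v :=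
  skewPrim k g h ⧸ (Submodule.span k {g - h}).submoduleOf (skewPrim k g h)

/-- The arrows of a quiver index bases of the spaces of skew primitive elements, modulo the
trivial ones, of every large subcoalgebra of the path coalgebra. -/
theorem nonempty_basis_skewQuotient (F : C →ₗc[k] PathCoalgebra k V) (hF : Function.Injective F)
    (hlarge : ∀ n ≤ 1, ∀ x ∈ PathCoalgebra.homogeneous k V n, ∃ y, F y = x) {a b : V} {g h : C}
    (hg : F g = PathCoalgebra.vertex k a) (hh : F h = PathCoalgebra.vertex k b) :
    Nonempty (Module.Basis (a ⟶ b) k (SkewQuotient k g h)) := by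
  classical
  have hinj : Function.Injective fun e : a ⟶ b =>
      (⟨a, b, e.toPath⟩ : Σ a b : V, Quiver.Path a b) := by
    intro e e' hee
    simp only [Sigma.mk.injEq, heq_eq_eq, true_and] at hee
    exact eq_of_heq (Quiver.Path.cons.inj hee).2.2
  -- Reading off the coefficients of the arrows from `a` to `b` is surjective because the image of
  -- `F` contains all arrows, and its kernel is the trivial part by `eq_smul_of_mem_skewPrim`.
  let α : skewPrim k g h →ₗ[k] (a ⟶ b) →₀ k :=
    Finsupp.lcomapDomain _ hinj ∘ₗ (PathCoalgebra.basis k V).repr.toLinearMap ∘ₗ F.toLinearMap ∘ₗ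
      (skewPrim k g h).subtype
  have hα : ∀ x e, α x e = pathCoef k e.toPath (F x.1) := fun x e => rfl
  have hsurj : Function.Surjective α := by
    refine LinearMap.range_eq_top.1 ?_
    rw [eq_top_iff, ← (Finsupp.basisSingleOne (R := k) (ι := a ⟶ b)).span_eq, Submodule.span_le]
    rintro _ ⟨e, rfl⟩
    obtain ⟨y, hy⟩ := hlarge 1 le_rfl _ (Submodule.subset_span ⟨a, b, e.toPath, rfl, rfl⟩)
    have hys : y ∈ skewPrim k g h := mem_skewPrim_of_map hF (by
      rw [hg, hh, hy]
      exact path_toPath_mem_skewPrim e)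
    refine ⟨⟨y, hys⟩, Finsupp.ext fun e' => ?_⟩
    rw [hα, hy, pathCoef_path, Finsupp.coe_basisSingleOne, Finsupp.single_apply]
    exact if_congr hinj.eq_iff rfl rfl
  have hker : LinearMap.ker α = (Submodule.span k {g - h}).submoduleOf (skewPrim k g h) := by
    ext x
    rw [LinearMap.mem_ker, Submodule.submoduleOf, Submodule.mem_comap,
      Submodule.mem_span_singleton]
    constructor
    · intro hx
      have h1 := map_mem_skewPrim F x.2
      rw [hg, hh] at h1
      have h2 := eq_smul_of_mem_skewPrim h1 fun e => by
        rw [← hα, hx]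
        rfl
      refine ⟨pathCoef k (Quiver.Path.nil : Quiver.Path a a) (F x.1), hF ?_⟩
      rw [map_smul, map_sub, hg, hh, ← h2]
      rfl
    · rintro ⟨r, hr⟩
      ext e
      change r • (g - h) = x.1 at hr
      rw [hα, ← hr, map_smul, map_sub, hg, hh, map_smul, map_sub, Quiver.Hom.toPath,
        pathCoef_cons_vertex, pathCoef_cons_vertex, sub_zero, smul_zero]
      rfl
  exact ⟨Module.Basis.ofRepr ((Submodule.quotEquivOfEq _ _ hker.symm).trans
    (α.quotKerEquivOfSurjective hsurj))⟩

theorem vertex_mem_homogeneous (a : V) :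
    PathCoalgebra.vertex k a ∈ PathCoalgebra.homogeneous k V 0 :=
  Submodule.subset_span ⟨a, a, Quiver.Path.nil, rfl, rfl⟩

/-- The vertices of a quiver correspond to the group-like elements of every large subcoalgebra
of the path coalgebra. -/
theorem exists_equiv_groupLike (F : C →ₗc[k] PathCoalgebra k V) (hF : Function.Injective F)
    (hlarge : ∀ n ≤ 1, ∀ x ∈ PathCoalgebra.homogeneous k V n, ∃ y, F y = x) :
    ∃ φ : V ≃ GroupLike k C, ∀ a, F (φ a).val = PathCoalgebra.vertex k a := by
  choose y hy using fun a : V => hlarge 0 zero_le_one _ (vertex_mem_homogeneous (k := k) a)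
  have hgl : ∀ a, IsGroupLikeElem k (y a) := fun a => isGroupLikeElem_of_map hF (by
    rw [hy]
    exact PathCoalgebra.isGroupLikeElem_vertex a)
  refine ⟨Equiv.ofBijective (fun a => ⟨y a, hgl a⟩) ⟨fun a b hab => ?_, fun x => ?_⟩, hy⟩
  · refine vertex_injective k ?_
    rw [← hy, ← hy]
    exact congrArg (fun z : GroupLike k C => F z.val) hab
  · obtain ⟨a, ha⟩ := exists_eq_vertex_of_isGroupLikeElem (x.2.map F)
    exact ⟨a, GroupLike.val_injective (hF ((hy a).trans ha.symm))⟩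

/-- Two quivers whose path coalgebras have a common large subcoalgebra are isomorphic. -/
theorem quiverIso_of_large {W : Type*} [Quiver W] (F : C →ₗc[k] PathCoalgebra k V)
    (hF : Function.Injective F)
    (hlarge : ∀ n ≤ 1, ∀ x ∈ PathCoalgebra.homogeneous k V n, ∃ y, F y = x)
    (F' : C →ₗc[k] PathCoalgebra k W) (hF' : Function.Injective F')
    (hlarge' : ∀ n ≤ 1, ∀ x ∈ PathCoalgebra.homogeneous k W n, ∃ y, F' y = x) :
    QuiverIso V W := by
  obtain ⟨φ, hφ⟩ := exists_equiv_groupLike F hF hlarge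
  obtain ⟨φ', hφ'⟩ := exists_equiv_groupLike F' hF' hlarge'
  refine ⟨φ.trans φ'.symm, fun a b => ?_⟩
  -- Corresponding vertices of the two quivers come from the same group-like elements of `C`, so
  -- both sets of arrows index bases of one and the same quotient space.
  obtain ⟨B⟩ := nonempty_basis_skewQuotient F hF hlarge (hφ a) (hφ b)
  obtain ⟨B'⟩ := nonempty_basis_skewQuotient F' hF' hlarge'
    (a := φ'.symm (φ a)) (b := φ'.symm (φ b)) (g := (φ a).val) (h := (φ b).val)
    (by rw [← hφ', Equiv.apply_symm_apply]) (by rw [← hφ', Equiv.apply_symm_apply])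
  exact ⟨B.indexEquiv B'⟩

/-- The coalgebra morphism underlying a realization. -/
noncomputable def LargeRealization.coalgHom {H : Type v} [Ring H] [HopfAlgebra k H] [IsPointed k H]
    {R : H ⊗[k] H →ₗ[k] k} (E : LargeRealization R V) : Gr k H →ₗc[k] PathCoalgebra k V :=
  (E.emb : Gr k H →ₗc[k] E.S.Carrier)

end Uniqueness

end CQT

theorem theorem4p2 {k : Type u} {H : Type v} [Field k] [Ring H] [HopfAlgebra k H]
    [CQT.IsPointed k H] (R : H ⊗[k] H →ₗ[k] k) (hR : CQT.IsCoquasitriangular R) :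
    ∃ (V : Type v) (_ : Quiver.{v} V),
      CQT.IsCoquasitriangularHopfQuiver k V ∧
      (∃ E : CQT.LargeRealization R V, E.IsGraded) ∧
      ∀ (W : Type w) [Quiver.{w'} W], CQT.IsCoquasitriangularHopfQuiver k W →
        Nonempty (CQT.LargeRealization R W) → CQT.QuiverIso V W := by
  -- Coquasitriangularity makes the group-like elements commute, so `GroupLike k H` itself serves as
  -- the commutative group of vertices.
  let _ : CommGroup (GroupLike k H) :=
    { (inferInstance : Group (GroupLike k H)) with
      mul_comm := hR.groupLike_mul_comm }
  let ι : GroupLike k H ≃* GroupLike k H := MulEquiv.refl _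
  let E := CQT.Gr.realization ι hR
  refine ⟨CQT.Cayley (CQT.Gr.label ι), inferInstance, ⟨E.S, _, E.isCoquasitriangular⟩,
    ⟨E, CQT.Gr.realization_isGraded ι hR⟩, ?_⟩
  -- Both quivers are recovered from the coalgebra `gr H`, which sits as a large subcoalgebra in
  -- each of the two path coalgebras.
  rintro W _ - ⟨E'⟩
  exact CQT.quiverIso_of_large E.coalgHom E.injective E.large E'.coalgHom E'.injective E'.large
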